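/- All manifolds and maps are $C^\infty$. Let $(E,[\cdot,\cdot],\rho)$ be a Lie algebroid of rank $m$ over an $n$-dimensional manifold $Q$, with projections $\pi\colon E\times\mathbb R\to Q$ and $\pi\colon E^*\times\mathbb R\to Q$. For $P=E\times\mathbb R$ or $P=E^*\times\mathbb R$ let $\mathcal T^EP=\{(a,v)\in E_{\pi(p)}\times T_pP : p\in P,\ \rho(a)=T\pi(v)\}$ be the prolongation of $E$ over $\pi\colon P\to Q$. It is a Lie algebroid over $P$ with anchor $\rho^\pi(a,v)=v$; its bracket is determined by the Leibniz rule and $[(\sigma\circ\pi,X),(\tau\circ\pi,Y)]=([\sigma,\tau]\circ\pi,[X,Y])$. Let $d$ be its exterior differential. Let $L\colon E\times\mathbb R\to\mathbb R$ be a smooth Lagrangian. For $a,b\in E_q$ let $a^V_{(b,s)}$ be the velocity at $t=0$ of $t\mapsto(b+ta,s)$, and put $S(a,v)=(0,a^V)$, $\Delta(b,s)=(0,b^V_{(b,s)})$, $\Theta_L=dL\circ S$, $\eta_L=ds-\Theta_L$ and $E_L=\rho^\pi(\Delta)L-L$. On $\mathcal T^E(E^*\times\mathbb R)$ put $\Theta_{(b^*,s)}(a,v)=b^*(a)$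 and $\eta=ds-\Theta$. The Legendre transformation is $\mathrm{Leg}_L\colon E\times\mathbb R\to E^*\times\mathbb R$, $\mathrm{Leg}_L(a,s)=(\mu(a,s),s)$ with $\mu(a,s)(b)=\frac{d}{dt}\big|_{t=0}L(a+tb,s)$, and its prolongation is $\mathcal T^E\mathrm{Leg}_L(a,v)=(a,(\mathrm{Leg}_L)_*v)$. A Reeb section $R$ of $\eta_L$ (or $\eta$) is a section with $i_R\,d\eta_L=0$, $i_R\eta_L=1$ (resp. with $\eta$). Assume that $L$ is hyperregular, i.e. $\mathrm{Leg}_L$ is a global diffeomorphism, and let $H=E_L\circ\mathrm{Leg}_L^{-1}$. Then there is a unique section $\Gamma_L$ of $\mathcal T^E(E\times\mathbb R)$ (the Lagrangian section) with $$i_{\Gamma_L}\eta_L=-E_L,\qquad i_{\Gamma_L}d\eta_L=dE_L-\rho^\pi(\mathcal R_L)(E_L)\,\eta_L,$$ where $\mathcal R_L$ is the Reeb section of $\eta_L$, and a unique section $\xi_H$ of $\mathcal T^E(E^*\times\mathbb R)$ (the Hamiltonian section) with $$i_{\xi_H}\eta=-H,\qquad i_{\xi_H}d\eta=dH-\rho^\pi(\mathcal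 R)(H)\,\eta,$$ where $\mathcal R$ is the Reeb section of $\eta$, and they are related by the prolonged Legendre map: $$\xi_H\circ\mathrm{Leg}_L=\mathcal T^E\mathrm{Leg}_L\circ\Gamma_L .$$ Moreover, let $I\subset\mathbb R$ be an interval with more than one point. If a smooth curve $c\colon I\to E\times\mathbb R$ is a solution of the Herglotz equations associated to $L$, then $\mathrm{Leg}_L\circ c$ is a solution of the contact Hamilton equations associated to $H$; conversely, if a smooth curve $\sigma\colon I\to E^*\times\mathbb R$ is a solution of the contact Hamilton equations, then $\mathrm{Leg}_L^{-1}\circ\sigma$ is a solution of the Herglotz equations. Thus $c\mapsto\mathrm{Leg}_L\circ c$ is a bijection between the two sets of solutions on $I$. Here, for local coordinates $(q^i)$ on $Q$ and a local basis $(e_\alpha)$ of sections of $E$ with $\rho(e_\alpha)=\rho^i_\alpha\,\partial/\partial q^i$ and $[e_\alpha,e_\beta]=C^\gamma_{\alpha\beta}e_\gamma$, with induced coordinates $(q^i,y^\alpha,s)$ on $E\times\mathbb R$ and $(q^i,y_\alpha,s)$ on $E^*\times\mathbb R$, the Herglotz equations are $$\frac{d}{dt}\frac{\partial L}{\partial y^\alpha}=\rho^i_\alpha\frac{\partial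 L}{\partial q^i}-y^\beta C^\gamma_{\alpha\beta}\frac{\partial L}{\partial y^\gamma}+\frac{\partial L}{\partial y^\alpha}\frac{\partial L}{\partial s},\qquad \frac{dq^i}{dt}=y^\alpha\rho^i_\alpha,\qquad \frac{ds}{dt}=L,$$ and the contact Hamilton equations are $$\frac{dq^i}{dt}=\rho^i_\alpha\frac{\partial H}{\partial y_\alpha},\qquad \frac{dy_\alpha}{dt}=-\Big(\rho^i_\alpha\frac{\partial H}{\partial q^i}+C^\gamma_{\alpha\beta}y_\gamma\frac{\partial H}{\partial y_\beta}+y_\alpha\frac{\partial H}{\partial s}\Big),\qquad \frac{ds}{dt}=y_\alpha\frac{\partial H}{\partial y_\alpha}-H;$$ a curve is a solution if these hold in all such coordinates. -/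

import Mathlib

open Bundle Manifold Set Filter Topology Module
open scoped ContDiff

noncomputable section

namespace ContactAlgebroid

/-! ### Lie algebroids

`Q` is a smooth `n`-dimensional manifold and `E → Q` a smooth real vector bundle with model
fibre `F`. -/

section Algebroid

variable (n : ℕ) {Q : Type*} [TopologicalSpace Q] [ChartedSpace (EuclideanSpace ℝ (Fin n)) Q]
  (F : Type*) [NormedAddCommGroup F] [NormedSpace ℝ F]
  (E : Q → Type*) [∀ q, AddCommGroup (E q)] [∀ q, Module ℝ (E q)]
  [∀ q, TopologicalSpace (E q)] [TopologicalSpace (TotalSpace F E)]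
  [FiberBundle F E] [VectorBundle ℝ F E]

/-- The smooth sections of `E → Q`. -/
abbrev Sec := Cₛ^∞⟮𝓡 n; F, E⟯

variable {n F E}

/-- The product `f σ` of a smooth function and a smooth section. -/
def smulSec (f : C^∞⟮𝓡 n, Q; ℝ⟯) (σ : Sec n F E) : Sec n F E :=
  ⟨fun q => f q • σ q, f.contMDiff.smul_section σ.contMDiff⟩

variable (n F E)

/-- A Lie algebroid structure on the vector bundle `E → Q`: a smooth vector bundle map
`anchor : E → TQ` and a Lie bracket on the real vector space of smooth sections of `E` which satisfy
`[σ, f τ] = f [σ, τ] + (ρ(σ) f) τ`. -/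
structure LieAlgebroid [IsManifold (𝓡 n) ∞ Q] where
  anchor : ∀ q, E q →ₗ[ℝ] TangentSpace (𝓡 n) q
  contMDiff_anchor : ContMDiff ((𝓡 n).prod 𝓘(ℝ, F)) (𝓡 n).tangent ∞
    (fun v : TotalSpace F E => (⟨v.proj, anchor v.proj v.2⟩ : TangentBundle (𝓡 n) Q))
  bracket : Sec n F E →ₗ[ℝ] Sec n F E →ₗ[ℝ] Sec n F E
  bracket_self : ∀ σ, bracket σ σ = 0
  jacobi : ∀ σ τ υ, bracket σ (bracket τ υ) + bracket τ (bracket υ σ) + bracket υ (bracket σ τ) = 0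
  leibniz : ∀ (f : C^∞⟮𝓡 n, Q; ℝ⟯) (σ τ : Sec n F E) (q : Q),
    bracket σ (smulSec f τ) q
      = f q • bracket σ τ q + mvfderiv (𝓡 n) f q (anchor q (σ q)) • τ q

variable {n F E}

/-- A section which is smooth near `q₀` agrees near `q₀` with a globally defined smooth section. -/
theorem exists_extension [IsManifold (𝓡 n) ∞ Q] [T2Space Q] (σ : ∀ q, E q) {u : Set Q}
    (hu : IsOpen u) {q₀ : Q} (hq : q₀ ∈ u)
    (hσ : ContMDiffOn (𝓡 n) ((𝓡 n).prod 𝓘(ℝ, F)) ∞ (fun q => (⟨q, σ q⟩ : TotalSpace F E)) u) :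
    ∃ s : Sec n F E, ∀ᶠ q in 𝓝 q₀, s q = σ q := by
  obtain ⟨f, hf, -⟩ := (SmoothBumpFunction.nhds_basis_support (I := 𝓡 n)
    (hu.mem_nhds hq)).mem_iff.1 (Filter.univ_mem (f := 𝓝 q₀))
  refine ⟨⟨_, ContMDiffOn.smul_section_of_tsupport (f.contMDiff.contMDiffOn) hu hf hσ⟩, ?_⟩
  filter_upwards [f.eventuallyEq_one] with q hq
  change f q • σ q = σ q
  rw [hq, Pi.one_apply, one_smul]

open Classical in
/-- A global smooth section which agrees near `q₀` with the given local section `σ`. -/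
def extendSec (σ : ∀ q, E q) (q₀ : Q) : Sec n F E :=
  if h : ∃ s : Sec n F E, ∀ᶠ q in 𝓝 q₀, s q = σ q then h.choose else 0

/-- The value at `q` of the bracket of two sections `σ`, `τ` of `E` which are defined and smooth
near `q` (the bracket of sections is a local operation). -/
def LieAlgebroid.localBracket [IsManifold (𝓡 n) ∞ Q] (A : LieAlgebroid n F E)
    (σ τ : ∀ q, E q) (q : Q) : E q :=
  A.bracket (extendSec σ q) (extendSec τ q) q

end Algebroid

/-! ### The prolongation of a Lie algebroid over a fibration `pr : P → Q` -/

section Prolongation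

variable {n : ℕ} {Q : Type*} [TopologicalSpace Q] [ChartedSpace (EuclideanSpace ℝ (Fin n)) Q]
  [IsManifold (𝓡 n) ∞ Q]
  {F : Type*} [NormedAddCommGroup F] [NormedSpace ℝ F]
  {E : Q → Type*} [∀ q, AddCommGroup (E q)] [∀ q, Module ℝ (E q)]
  [∀ q, TopologicalSpace (E q)] [TopologicalSpace (TotalSpace F E)]
  [FiberBundle F E] [VectorBundle ℝ F E]
  {V H : Type*} [NormedAddCommGroup V] [NormedSpace ℝ V] [TopologicalSpace H]
  (J : ModelWithCorners ℝ V H)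
  {P : Type*} [TopologicalSpace P] [ChartedSpace H P] [IsManifold J ∞ P]
  (A : LieAlgebroid n F E) (pr : P → Q)

/-- The fibre at `p` of the prolongation: all `(a, v) ∈ E_{pr(p)} × T_p P` with `ρ(a) = T pr(v)`. -/
def prolFiber (p : P) : Submodule ℝ (E (pr p) × TangentSpace J p) where
  carrier := {z | A.anchor (pr p) z.1 = mfderiv J (𝓡 n) pr p z.2}
  add_mem' {z w} hz hw := by
    simp only [Set.mem_ofPred_eq, Prod.fst_add, Prod.snd_add, map_add] at *
    rw [hz, hw]
  zero_mem' := by simp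
  smul_mem' c z hz := by
    simp only [Set.mem_ofPred_eq, Prod.smul_fst, Prod.smul_snd, map_smul] at *
    rw [hz]

/-- Smooth sections of the prolongation `T^E P → P`. -/
structure ProlSec where
  toFun : ∀ p, E (pr p) × TangentSpace J p
  mem : ∀ p, toFun p ∈ prolFiber J A pr p
  contMDiff_fst : ContMDiff J ((𝓡 n).prod 𝓘(ℝ, F)) ∞
    (fun p => (⟨pr p, (toFun p).1⟩ : TotalSpace F E))
  contMDiff_snd : ContMDiff J J.tangent ∞
    (fun p => (⟨p, (toFun p).2⟩ : TangentBundle J P))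

variable {J A pr}

instance : CoeFun (ProlSec J A pr) (fun _ => ∀ p, E (pr p) × TangentSpace J p) := ⟨ProlSec.toFun⟩

/-- The vector field `ρ(Z)` on `P`, the anchor of `T^E P` being `(a, v) ↦ v`. -/
def ProlSec.vectorField (Z : ProlSec J A pr) (p : P) : TangentSpace J p := (Z p).2

/-- The derivative `ρ(Z) f` of a function along a section of the prolongation. -/
def ProlSec.deriv (Z : ProlSec J A pr) (f : P → ℝ) (p : P) : ℝ := mvfderiv J f p (Z.vectorField p)

/-- The first component of `Z`, read as a function `P → F` (near `p₀`) in a trivialization of `E`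
around `pr(p₀)`. -/
def ProlSec.localRep (Z : ProlSec J A pr) (p₀ p : P) : F :=
  (trivializationAt F E (pr p₀) ⟨pr p, (Z p).1⟩).2

/-- The local section of `E` around `q₀` with constant coordinates `c` in a trivialization. -/
def constSec (q₀ : Q) (c : F) (q : Q) : E q := (trivializationAt F E q₀).symm q c

/-- The Lie bracket of two sections `Z = (a, X)` and `W = (b, Y)` of the prolongation. If `(e_α)` is
a local frame of `E` and `a = a^α (e_α ∘ pr)`, `b = b^α (e_α ∘ pr)`, it is
`((X(b^γ) - Y(a^γ)) e_γ + a^α b^β [e_α, e_β], [X, Y])`, which lies in the prolongation again. -/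
def prolBracket (Z W : ProlSec J A pr) (p : P) : E (pr p) × TangentSpace J p :=
  (constSec (pr p)
      (mvfderiv J (W.localRep p) p (Z.vectorField p) - mvfderiv J (Z.localRep p) p (W.vectorField p))
      (pr p)
    + A.localBracket (constSec (pr p) (Z.localRep p p)) (constSec (pr p) (W.localRep p p)) (pr p),
   VectorField.mlieBracket J Z.vectorField W.vectorField p)

variable (E J pr) in
/-- The `1`-sections of the prolongation: at each `p` a linear form in the pair `(a, v)`. It is written
on the whole sum `E_{pr(p)} × T_p P`; only its values on the subspace `prolFiber` are ever used. -/
abbrev OneSec := ∀ p : P, (E (pr p) × TangentSpace J p) →ₗ[ℝ] ℝ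

/-- The exterior differential of a `1`-section `η`:
`dη(Z, W) = ρ(Z)(η(W)) - ρ(W)(η(Z)) - η([Z, W])`. -/
def extDeriv (η : OneSec E J pr) (Z W : ProlSec J A pr) (p : P) : ℝ :=
  Z.deriv (fun p => η p (W p)) p - W.deriv (fun p => η p (Z p)) p - η p (prolBracket Z W p)

/-- `R` is a Reeb section of `η`: `i_R dη = 0` and `i_R η = 1`. -/
def IsReeb (η : OneSec E J pr) (R : ProlSec J A pr) : Prop :=
  (∀ (Z : ProlSec J A pr) (p : P), extDeriv η R Z p = 0) ∧ ∀ p, η p (R p) = 1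

/-- `X` satisfies `i_X η = -h` and `i_X dη = dh - ρ(R)(h) η`, where `R` is the Reeb section
of `η`. -/
def IsContactSection (η : OneSec E J pr) (h : P → ℝ) (X : ProlSec J A pr) : Prop :=
  (∀ p, η p (X p) = - h p) ∧
    ∃ R : ProlSec J A pr, IsReeb η R ∧
      ∀ (Z : ProlSec J A pr) (p : P), extDeriv η X Z p = Z.deriv h p - R.deriv h p * η p (Z p)

end Prolongation

/-! ### The Lagrangian and the Hamiltonian formalism -/

section Phase

variable (n : ℕ) {Q : Type*} [TopologicalSpace Q] [ChartedSpace (EuclideanSpace ℝ (Fin n)) Q]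
  (F : Type*) [NormedAddCommGroup F] [NormedSpace ℝ F]
  (E : Q → Type*) [∀ q, AddCommGroup (E q)] [∀ q, Module ℝ (E q)]
  [∀ q, TopologicalSpace (E q)] [TopologicalSpace (TotalSpace F E)]
  [FiberBundle F E] [VectorBundle ℝ F E]

/-- The manifold `E × ℝ`. -/
abbrev LagSpace := TotalSpace F E × ℝ

/-- The dual bundle `E* → Q`. -/
abbrev DualBundle (q : Q) := E q →L[ℝ] Bundle.Trivial Q ℝ q

/-- The manifold `E* × ℝ`. -/
abbrev HamSpace := TotalSpace (F →L[ℝ] ℝ) (DualBundle E) × ℝ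

/-- The model of the manifold `E × ℝ`. -/
abbrev lagModel := ((𝓡 n).prod 𝓘(ℝ, F)).prod 𝓘(ℝ, ℝ)

/-- The model of the manifold `E* × ℝ`. -/
abbrev hamModel := ((𝓡 n).prod 𝓘(ℝ, F →L[ℝ] ℝ)).prod 𝓘(ℝ, ℝ)

/-- The projection `E × ℝ → Q`. -/
abbrev lagProj (p : LagSpace F E) : Q := p.1.proj

/-- The projection `E* × ℝ → Q`. -/
abbrev hamProj (p : HamSpace F E) : Q := p.1.proj

/-- The smooth functions on `E × ℝ`. -/
abbrev Lagrangian := C^∞⟮lagModel n F, LagSpace F E; ℝ⟯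

variable {n F E}

/-- The curve `t ↦ (b + t a, s)` in `E × ℝ` through `p = (b, s)`. -/
def fiberLine (p : LagSpace F E) (a : E (lagProj F E p)) (t : ℝ) : LagSpace F E :=
  (⟨lagProj F E p, p.1.2 + t • a⟩, p.2)


/-- The inclusion of the model fibre. -/
def fiberIncl (p : LagSpace F E) (w : F) : LagSpace F E :=
  (⟨lagProj F E p, (trivializationAt F E (lagProj F E p)).symm (lagProj F E p) w⟩, p.2)

variable (n) in
theorem contMDiff_fiberIncl [IsManifold (𝓡 n) ∞ Q] [ContMDiffVectorBundle ∞ F E (𝓡 n)]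
    (p : LagSpace F E) : ContMDiff 𝓘(ℝ, F) (lagModel n F) ∞ (fiberIncl p) := by
  refine ContMDiff.prodMk ?_ contMDiff_const
  have h := (trivializationAt F E (lagProj F E p)).contMDiffOn_symm (IB := 𝓡 n) (n := ∞)
  have h2 : ContMDiff 𝓘(ℝ, F) ((𝓡 n).prod 𝓘(ℝ, F)) ∞ (fun w : F => (lagProj F E p, w)) :=
    contMDiff_const.prodMk contMDiff_id
  have hm := FiberBundle.mem_baseSet_trivializationAt' (F := F) (E := E) (lagProj F E p)
  refine (h.comp_contMDiff h2 (fun w => ?_)).congr fun w => ?_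
  · simp [Trivialization.mem_target, hm]
  · simp [Trivialization.mk_symm _ hm]

theorem fiberLine_eq (p : LagSpace F E) (a : E (lagProj F E p)) :
    fiberLine p a = fiberIncl p ∘ fun t : ℝ =>
      (trivializationAt F E (lagProj F E p)).continuousLinearMapAt ℝ (lagProj F E p) p.1.2 +
      t • (trivializationAt F E (lagProj F E p)).continuousLinearMapAt ℝ (lagProj F E p) a := by
  funext t
  have hm := FiberBundle.mem_baseSet_trivializationAt' (F := F) (E := E) (lagProj F E p)
  simp only [fiberLine, fiberIncl, Function.comp, ← map_smul, ← map_add]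
  simp [hm]


variable (n) in
theorem mfderiv_fiberLine [IsManifold (𝓡 n) ∞ Q] [ContMDiffVectorBundle ∞ F E (𝓡 n)]
    (p : LagSpace F E) (a : E (lagProj F E p)) :
    (mfderiv 𝓘(ℝ, ℝ) (lagModel n F) (fiberLine p a) 0 (1 : ℝ) : TangentSpace (lagModel n F) p) =
      mfderiv 𝓘(ℝ, F) (lagModel n F) (fiberIncl p)
        ((trivializationAt F E (lagProj F E p)).continuousLinearMapAt ℝ (lagProj F E p) p.1.2)
        ((trivializationAt F E (lagProj F E p)).continuousLinearMapAt ℝ (lagProj F E p) a) := by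
  rw [fiberLine_eq]
  set x := (trivializationAt F E (lagProj F E p)).continuousLinearMapAt ℝ (lagProj F E p) p.1.2
  set v := (trivializationAt F E (lagProj F E p)).continuousLinearMapAt ℝ (lagProj F E p) a
  have h1 : HasMFDerivAt 𝓘(ℝ, ℝ) 𝓘(ℝ, F) (fun t : ℝ => x + t • v) 0
      (ContinuousLinearMap.toSpanSingleton ℝ v) := by
    have := ((hasDerivAt_id (0:ℝ)).smul_const v).const_add x
    simpa using! this.hasFDerivAt.hasMFDerivAt
  have hx : x + (0:ℝ) • v = x := by simp
  have h2 : HasMFDerivAt 𝓘(ℝ, F) (lagModel n F) (fiberIncl p) (x + (0:ℝ) • v)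
      (mfderiv 𝓘(ℝ, F) (lagModel n F) (fiberIncl p) (x + (0:ℝ) • v)) :=
    ((contMDiff_fiberIncl n p).mdifferentiableAt (by simp)).hasMFDerivAt
  have h3 := (HasMFDerivAt.comp (0:ℝ) h2 h1).mfderiv
  rw [h3]
  change (mfderiv 𝓘(ℝ, F) (lagModel n F) (fiberIncl p) (x + (0 : ℝ) • v)) ((1 : ℝ) • v : F) = _
  rw [one_smul, hx]

/-- The vertical lift `a ↦ a^V ∈ T_p(E × ℝ)`, the velocity of `t ↦ (b + t a, s)` at `t = 0`, where
`p = (b, s)`. -/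
def vertLift [IsManifold (𝓡 n) ∞ Q] [ContMDiffVectorBundle ∞ F E (𝓡 n)] (p : LagSpace F E) :
    E (lagProj F E p) →ₗ[ℝ] TangentSpace (lagModel n F) p where
  toFun a := mfderiv 𝓘(ℝ, ℝ) (lagModel n F) (fiberLine p a) 0 (1 : ℝ)
  map_add' a b := by
    have h := mfderiv_fiberLine n p
    rw [h, h, h, map_add]
    exact map_add (mfderiv 𝓘(ℝ, F) (lagModel n F) (fiberIncl p) _) _ _
  map_smul' c a := by
    have h := mfderiv_fiberLine n p
    rw [h, h, map_smul]
    exact map_smul (mfderiv 𝓘(ℝ, F) (lagModel n F) (fiberIncl p) _) c _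

theorem deriv_fiberLine [IsManifold (𝓡 n) ∞ Q] [ContMDiffVectorBundle ∞ F E (𝓡 n)]
    (L : Lagrangian n F E) (p : LagSpace F E) (a : E (lagProj F E p)) :
    deriv (fun t : ℝ => L (fiberLine p a t)) 0 = mvfderiv (lagModel n F) L p (vertLift p a) := by
  have h1 : MDifferentiableAt 𝓘(ℝ, ℝ) (lagModel n F) (fiberLine p a) 0 := by
    rw [fiberLine_eq]
    refine ((contMDiff_fiberIncl n p).mdifferentiableAt (by simp)).comp (0 : ℝ) ?_
    exact DifferentiableAt.mdifferentiableAt (by fun_prop)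
  have h2 : MDifferentiableAt (lagModel n F) 𝓘(ℝ, ℝ) L (fiberLine p a 0) :=
    L.contMDiff.mdifferentiableAt (by simp)
  have h3 := mfderiv_comp (0 : ℝ) h2 h1
  have h4 : fiberLine p a 0 = p := by simp [fiberLine]
  rw [← fderiv_apply_one_eq_deriv, ← mfderiv_eq_fderiv]
  change mfderiv 𝓘(ℝ, ℝ) 𝓘(ℝ, ℝ) (L ∘ fiberLine p a) 0 (1 : ℝ) = _
  rw [h3]
  change mfderiv (lagModel n F) 𝓘(ℝ, ℝ) L (fiberLine p a 0)
    (mfderiv 𝓘(ℝ, ℝ) (lagModel n F) (fiberLine p a) 0 (1 : ℝ)) = _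
  rw [h4]
  rfl

/-- The vertical endomorphism `S(a, v) = (0, a^V)` of the prolongation of `E` over `E × ℝ`. -/
def vertEndo [IsManifold (𝓡 n) ∞ Q] [ContMDiffVectorBundle ∞ F E (𝓡 n)] (p : LagSpace F E) :
    (E (lagProj F E p) × TangentSpace (lagModel n F) p) →ₗ[ℝ]
      (E (lagProj F E p) × TangentSpace (lagModel n F) p) :=
  LinearMap.inr ℝ _ _ ∘ₗ vertLift p ∘ₗ LinearMap.fst ℝ _ _

variable [IsManifold (𝓡 n) ∞ Q] [ContMDiffVectorBundle ∞ F E (𝓡 n)]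

/-- The Liouville section `Δ(b, s) = (0, b^V)`. -/
def liouville (p : LagSpace F E) : E (lagProj F E p) × TangentSpace (lagModel n F) p :=
  (0, vertLift p p.1.2)

/-- The Poincaré–Cartan `1`-section `Θ_L = dL ∘ S`. -/
def cartanSec (L : Lagrangian n F E) : OneSec E (lagModel n F) (lagProj F E) := fun p =>
  (mvfderiv (lagModel n F) L p).toLinearMap ∘ₗ LinearMap.snd ℝ _ _ ∘ₗ vertEndo p

/-- The `1`-section `η_L = ds - Θ_L`. -/
def lagContact (L : Lagrangian n F E) : OneSec E (lagModel n F) (lagProj F E) := fun p =>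
  (mvfderiv (lagModel n F) (fun p : LagSpace F E => p.2) p).toLinearMap ∘ₗ LinearMap.snd ℝ _ _
    - cartanSec L p

/-- The energy `E_L = ρ(Δ) L - L`. -/
def energy (L : Lagrangian n F E) (p : LagSpace F E) : ℝ :=
  mvfderiv (lagModel n F) L p (liouville p).2 - L p

variable (n) in
/-- The Liouville `1`-section `Θ(a, v) = b*(a)` at `(b*, s) ∈ E* × ℝ`. -/
def liouvilleSec : OneSec E (hamModel n F) (hamProj F E) := fun p =>
  p.1.2.toLinearMap ∘ₗ LinearMap.fst ℝ _ _

variable (n F E) in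
/-- The contact `1`-section `η = ds - Θ`. -/
def hamContact : OneSec E (hamModel n F) (hamProj F E) := fun p =>
  (mvfderiv (hamModel n F) (fun p : HamSpace F E => p.2) p).toLinearMap ∘ₗ LinearMap.snd ℝ _ _
    - liouvilleSec n p

/-- The covector `b ↦ d/dt L(a + t b, s)` at `t = 0`, for `p = (a, s)`. -/
def legendreCovector (L : Lagrangian n F E) (p : LagSpace F E) : DualBundle E (lagProj F E p) where
  toFun b := deriv (fun t : ℝ => L (fiberLine p b t)) 0
  map_add' b c := by simp only [deriv_fiberLine, map_add]
  map_smul' r b := by simp only [deriv_fiberLine, map_smul, RingHom.id_apply]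
  cont := by
    simp only [deriv_fiberLine, vertLift, LinearMap.coe_mk, mfderiv_fiberLine]
    let D : F →L[ℝ] (EuclideanSpace ℝ (Fin n) × F) × ℝ :=
      mfderiv 𝓘(ℝ, F) (lagModel n F) (fiberIncl p)
        ((trivializationAt F E (lagProj F E p)).continuousLinearMapAt ℝ (lagProj F E p) p.1.2)
    exact (mvfderiv (lagModel n F) L p).continuous.comp
      (D.continuous.comp (ContinuousLinearMap.continuous _))

/-- The Legendre transformation `Leg_L : E × ℝ → E* × ℝ`. -/
def legendre (L : Lagrangian n F E) (p : LagSpace F E) : HamSpace F E :=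
  (⟨lagProj F E p, legendreCovector L p⟩, p.2)

/-- The prolongation `T^E Leg_L (a, v) = (a, (Leg_L)_* v)`. -/
def prolLegendre (L : Lagrangian n F E) (p : LagSpace F E)
    (z : E (lagProj F E p) × TangentSpace (lagModel n F) p) :
    E (hamProj F E (legendre L p)) × TangentSpace (hamModel n F) (legendre L p) :=
  (z.1, mfderiv (lagModel n F) (hamModel n F) (legendre L) p z.2)

/-- `Γ` is a Lagrangian section of `L`: `i_Γ η_L = -E_L` and `i_Γ dη_L = dE_L - ρ(R_L)(E_L) η_L`. -/
def IsLagrangianSection (A : LieAlgebroid n F E) (L : Lagrangian n F E)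
    (Γ : ProlSec (lagModel n F) A (lagProj F E)) : Prop :=
  IsContactSection (lagContact L) (energy L) Γ

/-- `ξ` is a Hamiltonian section of `H`: `i_ξ η = -H` and `i_ξ dη = dH - ρ(R)(H) η`. -/
def IsHamiltonianSection (A : LieAlgebroid n F E) (H : HamSpace F E → ℝ)
    (ξ : ProlSec (hamModel n F) A (hamProj F E)) : Prop :=
  IsContactSection (hamContact n F E) H ξ

end Phase

/-! ### The Herglotz equations and the contact Hamilton equations in local coordinates -/

section Equations

variable (n : ℕ) {Q : Type*} [TopologicalSpace Q] [ChartedSpace (EuclideanSpace ℝ (Fin n)) Q]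
  [IsManifold (𝓡 n) ∞ Q]
  (F : Type*) [NormedAddCommGroup F] [NormedSpace ℝ F] [FiniteDimensional ℝ F]
  (E : Q → Type*) [∀ q, AddCommGroup (E q)] [∀ q, Module ℝ (E q)]
  [∀ q, TopologicalSpace (E q)] [TopologicalSpace (TotalSpace F E)]
  [FiberBundle F E] [VectorBundle ℝ F E]

/-- Local coordinates `(q^i)` on an open set of `Q` together with a local basis `(e_α)` of sections
of `E` over it. -/
structure LocalCoords where
  chart : OpenPartialHomeomorph Q (EuclideanSpace ℝ (Fin n))
  chart_mem : chart ∈ IsManifold.maximalAtlas (𝓡 n) ∞ Q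
  frame : Fin (finrank ℝ F) → ∀ q, E q
  isLocalFrameOn : IsLocalFrameOn (𝓡 n) F ∞ frame chart.source

/-- The space of coordinates `(q^i, y^α, s)` or `(q^i, y_α, s)`. -/
abbrev CoordSpace := EuclideanSpace ℝ (Fin n) × (Fin (finrank ℝ F) → ℝ) × ℝ

variable {n F E}

/-- `∂f/∂q^i`. -/
def partialQ (f : CoordSpace n F → ℝ) (i : Fin n) (z : CoordSpace n F) : ℝ :=
  fderiv ℝ f z (EuclideanSpace.single i 1, 0, 0)

/-- `∂f/∂y^α`, or `∂f/∂y_α`. -/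
def partialY (f : CoordSpace n F → ℝ) (α : Fin (finrank ℝ F)) (z : CoordSpace n F) : ℝ :=
  fderiv ℝ f z (0, Pi.single α 1, 0)

/-- `∂f/∂s`. -/
def partialS (f : CoordSpace n F → ℝ) (z : CoordSpace n F) : ℝ :=
  fderiv ℝ f z (0, 0, 1)

/-- A linear form on a fibre of `E` is continuous. -/
def toDual (q : Q) (l : E q →ₗ[ℝ] ℝ) : DualBundle E q where
  toLinearMap := l
  cont := by
    have hm := FiberBundle.mem_baseSet_trivializationAt' (F := F) (E := E) q
    let e := (trivializationAt F E q).continuousLinearEquivAt ℝ q hm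
    have h : Continuous ((l ∘ₗ e.symm.toLinearEquiv.toLinearMap) ∘ e) :=
      (LinearMap.continuous_of_finiteDimensional _).comp e.continuous
    convert h using 1
    funext x
    simp

namespace LocalCoords

variable (κ : LocalCoords n F E)

/-- The functions `ρ^i_α` with `ρ(e_α) = ρ^i_α ∂/∂q^i`. -/
def anchorCoeff (A : LieAlgebroid n F E) (i : Fin n) (α : Fin (finrank ℝ F)) (q : Q) : ℝ :=
  mvfderiv (𝓡 n) κ.chart q (A.anchor q (κ.frame α q)) i

/-- The functions `C^γ_{αβ}` with `[e_α, e_β] = C^γ_{αβ} e_γ`. -/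
def structCoeff (A : LieAlgebroid n F E) (γ α β : Fin (finrank ℝ F)) (q : Q) : ℝ :=
  κ.isLocalFrameOn.coeff γ q (A.localBracket (κ.frame α) (κ.frame β) q)

/-- The coordinates `(q^i, y^α, s)` of a point of `E × ℝ`. -/
def lagCoords (p : LagSpace F E) : CoordSpace n F :=
  (κ.chart p.1.proj, fun α => κ.isLocalFrameOn.coeff α p.1.proj p.1.2, p.2)

/-- The point of `E × ℝ` with coordinates `(q^i, y^α, s)`. -/
def lagPoint (z : CoordSpace n F) : LagSpace F E :=
  (⟨κ.chart.symm z.1, ∑ α, z.2.1 α • κ.frame α (κ.chart.symm z.1)⟩, z.2.2)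

/-- The coordinates `(q^i, y_α, s)` of a point of `E* × ℝ`. -/
def hamCoords (p : HamSpace F E) : CoordSpace n F :=
  (κ.chart p.1.proj, fun α => p.1.2 (κ.frame α p.1.proj), p.2)

/-- The point of `E* × ℝ` with coordinates `(q^i, y_α, s)`. -/
def hamPoint (z : CoordSpace n F) : HamSpace F E :=
  (⟨κ.chart.symm z.1,
    toDual (F := F) _ (∑ α, z.2.1 α • κ.isLocalFrameOn.coeff α (κ.chart.symm z.1))⟩, z.2.2)

end LocalCoords

variable (A : LieAlgebroid n F E)

/-- The smooth curve `c : I → E × ℝ` solves the Herglotz equations: in all local coordinates,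
`d/dt (∂L/∂y^α) = ρ^i_α ∂L/∂q^i - y^β C^γ_{αβ} ∂L/∂y^γ + ∂L/∂y^α ∂L/∂s`,
`dq^i/dt = y^α ρ^i_α` and `ds/dt = L`. -/
def IsHerglotzSolution (L : LagSpace F E → ℝ) (I : Set ℝ) (c : ℝ → LagSpace F E) : Prop :=
  ContMDiffOn 𝓘(ℝ, ℝ) (lagModel n F) ∞ c I ∧
  ∀ (κ : LocalCoords n F E), ∀ t ∈ I, lagProj F E (c t) ∈ κ.chart.source →
    let q := lagProj F E (c t)
    let z := fun r => κ.lagCoords (c r)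
    let L' := fun w => L (κ.lagPoint w)
    (∀ α, HasDerivWithinAt (fun r => partialY L' α (z r))
      (∑ i, κ.anchorCoeff A i α q * partialQ L' i (z t)
        - ∑ β, ∑ γ, (z t).2.1 β * κ.structCoeff A γ α β q * partialY L' γ (z t)
        + partialY L' α (z t) * partialS L' (z t)) I t) ∧
    (∀ i, HasDerivWithinAt (fun r => (z r).1 i)
      (∑ α, (z t).2.1 α * κ.anchorCoeff A i α q) I t) ∧
    HasDerivWithinAt (fun r => (z r).2.2) (L (c t)) I t

/-- The smooth curve `c : I → E* × ℝ` solves the contact Hamilton equations: in all local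
coordinates, `dq^i/dt = ρ^i_α ∂H/∂y_α`,
`dy_α/dt = -(ρ^i_α ∂H/∂q^i + C^γ_{αβ} y_γ ∂H/∂y_β + y_α ∂H/∂s)` and
`ds/dt = y_α ∂H/∂y_α - H`. -/
def IsHamiltonSolution (H : HamSpace F E → ℝ) (I : Set ℝ) (c : ℝ → HamSpace F E) : Prop :=
  ContMDiffOn 𝓘(ℝ, ℝ) (hamModel n F) ∞ c I ∧
  ∀ (κ : LocalCoords n F E), ∀ t ∈ I, hamProj F E (c t) ∈ κ.chart.source →
    let q := hamProj F E (c t)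
    let z := fun r => κ.hamCoords (c r)
    let H' := fun w => H (κ.hamPoint w)
    (∀ i, HasDerivWithinAt (fun r => (z r).1 i)
      (∑ α, κ.anchorCoeff A i α q * partialY H' α (z t)) I t) ∧
    (∀ α, HasDerivWithinAt (fun r => (z r).2.1 α)
      (-(∑ i, κ.anchorCoeff A i α q * partialQ H' i (z t)
        + ∑ β, ∑ γ, κ.structCoeff A γ α β q * (z t).2.1 γ * partialY H' β (z t)
        + (z t).2.1 α * partialS H' (z t))) I t) ∧
    HasDerivWithinAt (fun r => (z r).2.2)
      (∑ α, (z t).2.1 α * partialY H' α (z t) - H (c t)) I t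

end Equations

end ContactAlgebroid

end

/-! The Legendre transformation covers the identity of `Q` and preserves `s`, and it pulls `η` back
to `η_L` because both `Θ_L` at `p` and `Θ` at `Leg_L(p)` evaluate the same covector on the
`E`-component (`lagContact_eq_hamContact`). It is a diffeomorphism, so its prolongation gives a
bijection between the sections of the two prolongations. This bijection respects the contact form,
its differential, derivatives of functions and Reeb sections. The equations for `Γ_L` and `ξ_H` are
therefore the same equations, and existence and uniqueness need a proof only over `E* × ℝ`.

There, in a local frame, an element of the prolongation has free coordinates `(a^α, b_α, r)`. The
system `i_z η = h`, `i_z dη = u_α e^α + v^α dy_α` has the single solution `a^α = v^α`, `b_β = v^α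
C^γ_{αβ} y_γ - u_β`, `r = h + v^α y_α` (`hamForm_contactVec`, `eq_contactVec`). The form `dH - R(H)
η` is of this type: the Reeb section is `∂/∂s`, so the `ds` terms cancel. Local solutions are unique
and hence glue to a smooth global section (`existsUnique_prolSec`).

The link between sections and pointwise linear algebra is `extDeriv_eq`: for `η = ds - λ`, the
number `dη(Z, W)` at `p` depends only on the values of `Z` and `W` at `p`. It rests on the locality
of the algebroid bracket, on a formula for the prolonged bracket in an arbitrary frame
(`prolBracket_fst`), and on `[X, Y]s = X(Ys) - Y(Xs)` (`mvfderiv_mlieBracket`). Applied on both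
sides it also shows that `d` commutes with the Legendre transformation, so brackets of related
sections never have to be compared.

For curves, differentiating `H ∘ Leg_L = y^α ∂L/∂y^α - L` gives `∂H/∂q^i = -∂L/∂q^i`, `∂H/∂y_α =
y^α`, `∂H/∂s = -∂L/∂s` at corresponding points (`fderiv_hamiltonian`). With `y_α = ∂L/∂y^α` the
Herglotz and the Hamilton equations then agree term by term (`isHerglotzSolution_iff`). -/

noncomputable section

namespace ContactAlgebroid

/-! ### Locality of the bracket of a Lie algebroid -/

section Locality

set_option linter.unusedSectionVars false

variable {n : ℕ} {Q : Type*} [TopologicalSpace Q] [ChartedSpace (EuclideanSpace ℝ (Fin n)) Q]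
  [IsManifold (𝓡 n) ∞ Q] [T2Space Q]
  {F : Type*} [NormedAddCommGroup F] [NormedSpace ℝ F]
  {E : Q → Type*} [∀ q, AddCommGroup (E q)] [∀ q, Module ℝ (E q)]
  [∀ q, TopologicalSpace (E q)] [TopologicalSpace (TotalSpace F E)]
  [FiberBundle F E] [VectorBundle ℝ F E]

/-- Evaluation of smooth sections at a point. -/
def evalSec (q : Q) : Sec n F E →ₗ[ℝ] E q where
  toFun σ := σ q
  map_add' _ _ := rfl
  map_smul' _ _ := rfl

theorem exists_bump (n : ℕ) {Q : Type*} [TopologicalSpace Q]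
    [ChartedSpace (EuclideanSpace ℝ (Fin n)) Q] [IsManifold (𝓡 n) ∞ Q] [T2Space Q]
    {u : Set Q} {q₀ : Q} (hu : u ∈ 𝓝 q₀) :
    ∃ f : C^∞⟮𝓡 n, Q; ℝ⟯, (∀ᶠ q in 𝓝 q₀, f q = 1) ∧ tsupport f ⊆ u := by
  obtain ⟨f, -, hf⟩ := (SmoothBumpFunction.nhds_basis_tsupport (I := 𝓡 n) q₀).mem_iff.1 hu
  exact ⟨⟨f, f.contMDiff⟩, f.eventuallyEq_one, hf⟩

/-- The Leibniz rule of a `LieAlgebroid` accepts only global functions, so local coefficient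
functions have to be made global without changing their germ. -/
theorem exists_function_extension (f : Q → ℝ) {u : Set Q} (hu : IsOpen u) {q₀ : Q} (hq : q₀ ∈ u)
    (hf : ContMDiffOn (𝓡 n) 𝓘(ℝ, ℝ) ∞ f u) :
    ∃ g : C^∞⟮𝓡 n, Q; ℝ⟯, ∀ᶠ q in 𝓝 q₀, g q = f q := by
  obtain ⟨b, hb, hbu⟩ := exists_bump n (hu.mem_nhds hq)
  refine ⟨⟨fun q => b q • f q, fun q => ?_⟩, ?_⟩
  · by_cases hqu : q ∈ u
    · exact (b.contMDiff q).smul (hf.contMDiffAt (hu.mem_nhds hqu))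
    · have : ∀ᶠ x in 𝓝 q, b x • f x = 0 := by
        filter_upwards [(isClosed_tsupport b).isOpen_compl.mem_nhds fun h => hqu (hbu h)] with x hx
        rw [image_eq_zero_of_notMem_tsupport hx, zero_smul]
      exact contMDiffAt_const.congr_of_eventuallyEq this
  · filter_upwards [hb] with q h
    simp [h]

variable (A : LieAlgebroid n F E)

namespace LieAlgebroid

theorem bracket_skew (σ τ : Sec n F E) : A.bracket σ τ = - A.bracket τ σ := by
  have h := A.bracket_self (σ + τ)
  simp only [map_add, LinearMap.add_apply, A.bracket_self, zero_add, add_zero] at h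
  exact eq_neg_of_add_eq_zero_right h

theorem leibniz_left (f : C^∞⟮𝓡 n, Q; ℝ⟯) (σ τ : Sec n F E) (q : Q) :
    A.bracket (smulSec f σ) τ q
      = f q • A.bracket σ τ q - mvfderiv (𝓡 n) f q (A.anchor q (τ q)) • σ q := by
  rw [A.bracket_skew, ContMDiffSection.coe_neg, Pi.neg_apply, A.leibniz, A.bracket_skew τ σ,
    ContMDiffSection.coe_neg, Pi.neg_apply]
  module

/-- Let `f` be a bump function equal to `1` near `q` and supported where `τ` vanishes. Then `f τ =
0` globally, and the Leibniz rule at `q` reduces to `0 = [σ, τ](q)`, since `τ(q) = 0` removes the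
derivative of `f`. -/
theorem bracket_eq_zero (σ : Sec n F E) {τ : Sec n F E} {q : Q} (h : ∀ᶠ x in 𝓝 q, τ x = 0) :
    A.bracket σ τ q = 0 := by
  obtain ⟨f, hf, hfu⟩ := exists_bump n h
  have h0 : smulSec f τ = 0 := by
    ext x
    change f x • τ x = 0
    by_cases hx : x ∈ tsupport f
    · have : τ x = 0 := hfu hx
      rw [this, smul_zero]
    · rw [image_eq_zero_of_notMem_tsupport hx, zero_smul]
  have := A.leibniz f σ τ q
  rw [h0, map_zero, h.self_of_nhds, smul_zero, add_zero, hf.self_of_nhds, one_smul] at this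
  exact this.symm

theorem bracket_congr {σ σ' τ τ' : Sec n F E} {q : Q} (hσ : ∀ᶠ x in 𝓝 q, σ x = σ' x)
    (hτ : ∀ᶠ x in 𝓝 q, τ x = τ' x) : A.bracket σ τ q = A.bracket σ' τ' q := by
  have h1 := A.bracket_eq_zero σ (τ := τ - τ') (q := q) <| by
    filter_upwards [hτ] with x hx
    simp [hx]
  have h2 := A.bracket_eq_zero τ' (τ := σ - σ') (q := q) <| by
    filter_upwards [hσ] with x hx
    simp [hx]
  rw [map_sub, ContMDiffSection.coe_sub, Pi.sub_apply, sub_eq_zero] at h1 h2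
  rw [h1, A.bracket_skew, A.bracket_skew σ', ContMDiffSection.coe_neg, ContMDiffSection.coe_neg,
    Pi.neg_apply, Pi.neg_apply, h2]

theorem _root_.ContactAlgebroid.extendSec_eventuallyEq {σ : ∀ q, E q} {s : Sec n F E} {q : Q}
    (h : ∀ᶠ x in 𝓝 q, s x = σ x) : ∀ᶠ x in 𝓝 q, (extendSec σ q : Sec n F E) x = σ x := by
  have h' : ∃ s : Sec n F E, ∀ᶠ x in 𝓝 q, s x = σ x := ⟨s, h⟩
  rw [extendSec, dif_pos h']
  exact h'.choose_spec

/-- By locality the arbitrary choice inside `extendSec` is harmless: any global sections with the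
right germs compute the local bracket. -/
theorem localBracket_eq {σ τ : ∀ q, E q} {s t : Sec n F E} {q : Q}
    (hs : ∀ᶠ x in 𝓝 q, s x = σ x) (ht : ∀ᶠ x in 𝓝 q, t x = τ x) :
    A.localBracket σ τ q = A.bracket s t q :=
  A.bracket_congr
    ((extendSec_eventuallyEq hs).mp (hs.mono fun _ h h' => h'.trans h.symm))
    ((extendSec_eventuallyEq ht).mp (ht.mono fun _ h h' => h'.trans h.symm))

end LieAlgebroid

/-! ### Brackets of local sections in a trivialization -/

variable [ContMDiffVectorBundle ∞ F E (𝓡 n)]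

theorem contMDiffOn_constSec (q₀ : Q) (c : F) :
    ContMDiffOn (𝓡 n) ((𝓡 n).prod 𝓘(ℝ, F)) ∞
      (fun q => (⟨q, constSec q₀ c q⟩ : TotalSpace F E)) (trivializationAt F E q₀).baseSet := by
  refine ((trivializationAt F E q₀).contMDiffOn_section_baseSet_iff).2 ?_
  refine contMDiffOn_const (c := c) |>.congr fun q hq => ?_
  simp [constSec, hq]

theorem exists_sec_eq_constSec (q₀ : Q) (c : F) :
    ∃ s : Sec n F E, ∀ᶠ q in 𝓝 q₀, s q = constSec q₀ c q :=
  exists_extension _ (trivializationAt F E q₀).open_baseSet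
    (FiberBundle.mem_baseSet_trivializationAt' q₀) (contMDiffOn_constSec q₀ c)

/-- The coordinates of a local section of `E` in the trivialization around `q₀`. -/
def secRep (F : Type*) [NormedAddCommGroup F] [NormedSpace ℝ F]
    {E : Q → Type*} [∀ q, TopologicalSpace (E q)] [TopologicalSpace (TotalSpace F E)]
    [FiberBundle F E] (σ : ∀ q, E q) (q₀ q : Q) : F :=
  (trivializationAt F E q₀ ⟨q, σ q⟩).2


theorem secRep_eq {q₀ q : Q} (hq : q ∈ (trivializationAt F E q₀).baseSet) (σ : ∀ q, E q) :
    secRep F σ q₀ q = (trivializationAt F E q₀).continuousLinearMapAt ℝ q (σ q) := by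
  simp [secRep, Trivialization.continuousLinearMapAt_apply, Trivialization.linearMapAt_apply, hq]

theorem constSec_eq {q₀ q : Q} (hq : q ∈ (trivializationAt F E q₀).baseSet) (c : F) :
    constSec q₀ c q = ((trivializationAt F E q₀).symmL ℝ q c : E q) := by
  simp [constSec, Trivialization.symmL_apply _ hq]

theorem constSec_secRep {q₀ q : Q} (hq : q ∈ (trivializationAt F E q₀).baseSet) (σ : ∀ q, E q) :
    constSec q₀ (secRep F σ q₀ q) q = σ q := by
  rw [constSec_eq hq, secRep_eq hq, Trivialization.symmL_continuousLinearMapAt _ hq]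

theorem secRep_sum_smul {ι : Type*} (s : Finset ι) {q₀ q : Q}
    (hq : q ∈ (trivializationAt F E q₀).baseSet) (a : ι → ℝ) (σ : ι → ∀ q, E q) :
    secRep F (fun x => ∑ i ∈ s, a i • σ i x) q₀ q = ∑ i ∈ s, a i • secRep F (σ i) q₀ q := by
  simp only [secRep_eq hq, map_sum, map_smul]

/-- The section `∑ᵢ fᵢ sᵢ`. -/
def sumSmulSec {ι : Type*} [Fintype ι] (f : ι → C^∞⟮𝓡 n, Q; ℝ⟯) (s : ι → Sec n F E) : Sec n F E :=
  ∑ i, smulSec (f i) (s i)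

theorem sumSmulSec_apply {ι : Type*} [Fintype ι] (f : ι → C^∞⟮𝓡 n, Q; ℝ⟯) (s : ι → Sec n F E)
    (q : Q) : sumSmulSec f s q = ∑ i, f i q • s i q := by
  change evalSec q (∑ i, smulSec (f i) (s i)) = _
  rw [map_sum]
  rfl

/-- Bilinearity and the Leibniz rule in both slots; the derivative terms collect into derivatives
along the anchor of the whole combination because the anchor is linear on fibres. -/
theorem LieAlgebroid.bracket_sumSmulSec {ι : Type*} [Fintype ι] (f g : ι → C^∞⟮𝓡 n, Q; ℝ⟯)
    (s : ι → Sec n F E) (q : Q) :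
    A.bracket (sumSmulSec f s) (sumSmulSec g s) q =
      (∑ i, (mvfderiv (𝓡 n) (g i) q (A.anchor q (sumSmulSec f s q))
        - mvfderiv (𝓡 n) (f i) q (A.anchor q (sumSmulSec g s q))) • s i q)
      + ∑ i, ∑ j, (f i q * g j q) • A.bracket (s i) (s j) q := by
  have h : A.bracket (sumSmulSec f s) (sumSmulSec g s) q
      = ∑ i, ∑ j, A.bracket (smulSec (f i) (s i)) (smulSec (g j) (s j)) q := by
    change evalSec q (A.bracket (∑ i, smulSec (f i) (s i)) (∑ i, smulSec (g i) (s i))) = _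
    simp only [map_sum, LinearMap.sum_apply]
    exact Finset.sum_comm
  have h2 : ∀ i j, A.bracket (smulSec (f i) (s i)) (smulSec (g j) (s j)) q
      = (f i q * g j q) • A.bracket (s i) (s j) q
        + (f i q * mvfderiv (𝓡 n) (g j) q (A.anchor q (s i q))) • s j q
        - (g j q * mvfderiv (𝓡 n) (f i) q (A.anchor q (s j q))) • s i q := by
    intro i j
    rw [A.leibniz, A.leibniz_left]
    change _ + mvfderiv (𝓡 n) (g j) q (A.anchor q (f i q • s i q)) • _ = _
    simp only [map_smul, smul_eq_mul]
    module
  simp only [h, h2, sumSmulSec_apply, map_sum, map_smul, Finset.sum_sub_distrib,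
    Finset.sum_add_distrib, sub_smul, Finset.sum_smul, smul_eq_mul]
  rw [Finset.sum_comm (f := fun i j => (f i q * mvfderiv (𝓡 n) (g j) q (A.anchor q (s i q))) • s j q)]
  abel

theorem contMDiffOn_secRep {σ : ∀ q, E q} {u : Set Q} {q₀ : Q}
    (hσ : ContMDiffOn (𝓡 n) ((𝓡 n).prod 𝓘(ℝ, F)) ∞ (fun q => (⟨q, σ q⟩ : TotalSpace F E)) u) :
    ContMDiffOn (𝓡 n) 𝓘(ℝ, F) ∞ (secRep F σ q₀) ((trivializationAt F E q₀).baseSet ∩ u) :=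
  fun q hq => (((trivializationAt F E q₀).contMDiffWithinAt_section (n := ∞) (IB := 𝓡 n)
    _ hq.1).1 (hσ q hq.2)).mono Set.inter_subset_right

theorem mvfderiv_clm_comp {V H P G G' : Type*} [NormedAddCommGroup V] [NormedSpace ℝ V]
    [TopologicalSpace H] {J : ModelWithCorners ℝ V H} [TopologicalSpace P] [ChartedSpace H P]
    [NormedAddCommGroup G] [NormedSpace ℝ G] [NormedAddCommGroup G'] [NormedSpace ℝ G']
    (l : G →L[ℝ] G') {f : P → G} {p : P} (hf : MDifferentiableAt J 𝓘(ℝ, G) f p)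
    (v : TangentSpace J p) : mvfderiv J (fun x => l (f x)) p v = l (mvfderiv J f p v) := by
  have h := (l.hasFDerivAt (x := f p)).hasMFDerivAt.comp p hf.hasMFDerivAt
  have h2 := h.mfderiv
  change mfderiv J 𝓘(ℝ, G') (l ∘ f) p v = _
  rw [h2]
  rfl

variable [FiniteDimensional ℝ F]

open LieAlgebroid in
/-- The bracket of two local sections in the trivialization around a point. -/
theorem LieAlgebroid.localBracket_eq_secRep {σ τ : ∀ q, E q} {u : Set Q} (hu : IsOpen u) {q : Q}
    (hq : q ∈ u)
    (hσ : ContMDiffOn (𝓡 n) ((𝓡 n).prod 𝓘(ℝ, F)) ∞ (fun q => (⟨q, σ q⟩ : TotalSpace F E)) u)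
    (hτ : ContMDiffOn (𝓡 n) ((𝓡 n).prod 𝓘(ℝ, F)) ∞ (fun q => (⟨q, τ q⟩ : TotalSpace F E)) u) :
    A.localBracket σ τ q =
      constSec q (mvfderiv (𝓡 n) (secRep F τ q) q (A.anchor q (σ q))
        - mvfderiv (𝓡 n) (secRep F σ q) q (A.anchor q (τ q))) q
      + A.localBracket (constSec q (secRep F σ q q)) (constSec q (secRep F τ q q)) q := by
  have hb := FiberBundle.mem_baseSet_trivializationAt' (F := F) (E := E) q
  have hbn := (trivializationAt F E q).open_baseSet.mem_nhds hb
  -- The sections `s i` with constant coordinates `b i` form a frame near `q`; `σ` and `τ` are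
  -- expanded in it with global coefficient functions `f`, `g`.
  let b := Module.finBasis ℝ F
  choose s hs using fun i => exists_sec_eq_constSec (n := n) (E := E) q (b i)
  have hs' : ∀ᶠ x in 𝓝 q, ∀ i, s i x = constSec q (b i) x := eventually_all.2 hs
  have coord : ∀ {σ : ∀ q, E q}, ContMDiffOn (𝓡 n) ((𝓡 n).prod 𝓘(ℝ, F)) ∞
      (fun q => (⟨q, σ q⟩ : TotalSpace F E)) u →
      ∃ f : Fin (finrank ℝ F) → C^∞⟮𝓡 n, Q; ℝ⟯,
        ∀ᶠ x in 𝓝 q, ∀ i, f i x = b.coord i (secRep F σ q x) := by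
    intro σ hσ
    choose f hf using fun i => exists_function_extension (n := n)
      (fun x => b.coord i (secRep F σ q x)) ((trivializationAt F E q).open_baseSet.inter hu)
      ⟨hb, hq⟩ ((LinearMap.toContinuousLinearMap (b.coord i)).contMDiff.comp_contMDiffOn
        (contMDiffOn_secRep hσ))
    exact ⟨f, eventually_all.2 hf⟩
  have ext : ∀ (g : Q → F) (f : Fin (finrank ℝ F) → C^∞⟮𝓡 n, Q; ℝ⟯),
      (∀ᶠ x in 𝓝 q, ∀ i, f i x = b.coord i (g x)) →
      ∀ᶠ x in 𝓝 q, sumSmulSec f s x = constSec q (g x) x := by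
    intro g f hf
    filter_upwards [hf, hs', hbn] with x hf hs hx
    rw [sumSmulSec_apply]
    simp only [hf, hs, constSec_eq hx, ← map_smul, ← map_sum]
    congr 1
    exact b.sum_repr (g x)
  have der : ∀ {σ : ∀ q, E q}, ContMDiffOn (𝓡 n) ((𝓡 n).prod 𝓘(ℝ, F)) ∞
      (fun q => (⟨q, σ q⟩ : TotalSpace F E)) u →
      ∀ f : Fin (finrank ℝ F) → C^∞⟮𝓡 n, Q; ℝ⟯,
        (∀ᶠ x in 𝓝 q, ∀ i, f i x = b.coord i (secRep F σ q x)) → ∀ i v,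
        mvfderiv (𝓡 n) (f i) q v = b.coord i (mvfderiv (𝓡 n) (secRep F σ q) q v) := by
    intro σ hσ f hf i v
    have h1 : (f i : Q → ℝ) =ᶠ[𝓝 q] fun x => b.coord i (secRep F σ q x) :=
      hf.mono fun x h => h i
    have h2 : mvfderiv (𝓡 n) (f i) q v
        = mvfderiv (𝓡 n) (fun x => b.coord i (secRep F σ q x)) q v := by
      change mfderiv (𝓡 n) 𝓘(ℝ, ℝ) (f i) q v
        = mfderiv (𝓡 n) 𝓘(ℝ, ℝ) (fun x => b.coord i (secRep F σ q x)) q v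
      rw [h1.mfderiv_eq]
      rfl
    rw [h2]
    refine mvfderiv_clm_comp (LinearMap.toContinuousLinearMap (b.coord i)) ?_ v
    exact ((contMDiffOn_secRep hσ).contMDiffAt
      (((trivializationAt F E q).open_baseSet.inter hu).mem_nhds ⟨hb, hq⟩)).mdifferentiableAt
      (by simp)
  obtain ⟨f, hf⟩ := coord hσ
  obtain ⟨g, hg⟩ := coord hτ
  have hσ' : ∀ᶠ x in 𝓝 q, sumSmulSec f s x = σ x := by
    filter_upwards [ext _ f hf, hbn] with x h hx
    rw [h, constSec_secRep hx]
  have hτ' : ∀ᶠ x in 𝓝 q, sumSmulSec g s x = τ x := by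
    filter_upwards [ext _ g hg, hbn] with x h hx
    rw [h, constSec_secRep hx]
  -- Freezing the coefficients at `q` gives the sections with constant coordinates. Their bracket
  -- has the same double sum, which sees only values at `q`, and no derivative terms; the difference
  -- is the asserted formula.
  let f₀ : Fin (finrank ℝ F) → C^∞⟮𝓡 n, Q; ℝ⟯ := fun i => ContMDiffMap.const (f i q)
  let g₀ : Fin (finrank ℝ F) → C^∞⟮𝓡 n, Q; ℝ⟯ := fun i => ContMDiffMap.const (g i q)
  have hσ₀ := ext (fun _ => secRep F σ q q) f₀ (.of_forall fun x i => hf.self_of_nhds i)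
  have hτ₀ := ext (fun _ => secRep F τ q q) g₀ (.of_forall fun x i => hg.self_of_nhds i)
  have hconst : ∀ (r : ℝ) (v : TangentSpace (𝓡 n) q), mvfderiv (𝓡 n) (fun _ : Q => r) q v = 0 := by
    intro r v
    rw [mvfderiv_const r]
    rfl
  rw [A.localBracket_eq hσ' hτ', A.localBracket_eq hσ₀ hτ₀, A.bracket_sumSmulSec,
    A.bracket_sumSmulSec]
  have e1 : ∀ i v, mvfderiv (𝓡 n) (f₀ i) q v = 0 := fun i v => hconst _ v
  have e2 : ∀ i v, mvfderiv (𝓡 n) (g₀ i) q v = 0 := fun i v => hconst _ v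
  have e3 : ∀ i, f₀ i q = f i q := fun i => rfl
  have e4 : ∀ i, g₀ i q = g i q := fun i => rfl
  simp only [e1, e2, e3, e4, sub_self, zero_smul, Finset.sum_const_zero, zero_add, add_left_inj]
  rw [hσ'.self_of_nhds, hτ'.self_of_nhds]
  simp only [der hσ f hf, der hτ g hg, fun i => (hs i).self_of_nhds, constSec_eq hb, ← map_smul,
    ← map_sum, ← map_sub]
  congr 1
  exact b.sum_repr _

/-- The bracket at `q` of the sections with constant coordinates `c`, `d` in the trivialization
around `q`. -/
theorem LieAlgebroid.exists_localBracket_constSec (q : Q) :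
    ∃ B : F →ₗ[ℝ] F →ₗ[ℝ] E q,
      ∀ c d, A.localBracket (constSec q c) (constSec q d) q = B c d := by
  have hb := FiberBundle.mem_baseSet_trivializationAt' (F := F) (E := E) q
  have hbn := (trivializationAt F E q).open_baseSet.mem_nhds hb
  let b := Module.finBasis ℝ F
  choose s hs using fun i => exists_sec_eq_constSec (n := n) (E := E) q (b i)
  -- Extending linearly from a basis makes the global extension linear in `c`, so the bilinearity of
  -- the bracket passes to the vectors `c` and `d`.
  let S : F →ₗ[ℝ] Sec n F E := b.constr ℝ s
  have hS : ∀ c, ∀ᶠ x in 𝓝 q, S c x = constSec q c x := by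
    intro c
    filter_upwards [eventually_all.2 hs, hbn] with x hx hxb
    change evalSec x (S c) = _
    have : S c = ∑ i, b.repr c i • s i := by simp [S, Basis.constr_apply_fintype]
    rw [this, map_sum]
    simp only [map_smul]
    conv_rhs => rw [← b.sum_repr c]
    change ∑ i, b.repr c i • s i x = _
    simp only [hx, constSec_eq hxb, map_sum, map_smul]
  refine ⟨((A.bracket.compl₁₂ S S).compr₂ (evalSec q)), fun c d => ?_⟩
  rw [A.localBracket_eq (hS c) (hS d)]
  rfl

end Locality

/-! ### Derivatives of vector-valued functions -/

section Derivatives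

variable {V H P : Type*} [NormedAddCommGroup V] [NormedSpace ℝ V] [TopologicalSpace H]
  {J : ModelWithCorners ℝ V H} [TopologicalSpace P] [ChartedSpace H P]

theorem mvfderiv_sum {ι : Type} {G : Type*} [NormedAddCommGroup G] [NormedSpace ℝ G] (s : Finset ι)
    {f : ι → P → G} {p : P} (hf : ∀ i ∈ s, MDifferentiableAt J 𝓘(ℝ, G) (f i) p)
    (v : TangentSpace J p) :
    mvfderiv J (fun x => ∑ i ∈ s, f i x) p v = ∑ i ∈ s, mvfderiv J (f i) p v := by
  classical
  induction s using Finset.induction_on with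
  | empty => simp [mvfderiv_const]
  | insert i s hi ih =>
    have h1 := hf i (Finset.mem_insert_self i s)
    have h2 : MDifferentiableAt J 𝓘(ℝ, G) (fun x => ∑ i ∈ s, f i x) p :=
      Finset.sum_fn s f ▸ MDifferentiableAt.sum fun j hj => hf j (Finset.mem_insert_of_mem hj)
    simp only [Finset.sum_insert hi]
    rw [mvfderiv_fun_add h1 h2, ← ih fun j hj => hf j (Finset.mem_insert_of_mem hj)]
    rfl

theorem mvfderiv_congr {G : Type*} [NormedAddCommGroup G] [NormedSpace ℝ G]
    {f g : P → G} {p : P} (h : f =ᶠ[𝓝 p] g) (v : TangentSpace J p) :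
    mvfderiv J f p v = mvfderiv J g p v := by
  change mfderiv J 𝓘(ℝ, G) f p v = mfderiv J 𝓘(ℝ, G) g p v
  rw [h.mfderiv_eq]
  rfl

theorem mvfderiv_comp_map {V' H' P' G : Type*} [NormedAddCommGroup V'] [NormedSpace ℝ V']
    [TopologicalSpace H'] {J' : ModelWithCorners ℝ V' H'} [TopologicalSpace P'] [ChartedSpace H' P']
    [NormedAddCommGroup G] [NormedSpace ℝ G] {g : P' → G} {f : P → P'} {p : P}
    (hg : MDifferentiableAt J' 𝓘(ℝ, G) g (f p)) (hf : MDifferentiableAt J J' f p)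
    (v : TangentSpace J p) :
    mvfderiv J (fun x => g (f x)) p v = mvfderiv J' g (f p) (mfderiv J J' f p v) :=
  mfderiv_comp_apply p hg hf v

end Derivatives

/-! ### The commutator of vector fields as derivations -/

section Commutator

set_option linter.unusedSectionVars false

variable {V H P : Type*} [NormedAddCommGroup V] [NormedSpace ℝ V] [TopologicalSpace H]
  {J : ModelWithCorners ℝ V H} [J.Boundaryless] [TopologicalSpace P] [ChartedSpace H P]
  [IsManifold J ∞ P]

theorem mvfderiv_eq_fderiv {g : P → ℝ} {p : P} (hg : MDifferentiableAt J 𝓘(ℝ, ℝ) g p) (v : V) :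
    mvfderiv J g p v = fderiv ℝ (g ∘ (extChartAt J p).symm) (extChartAt J p p) v := by
  rw [hg.mvfderiv, J.range_eq_univ, fderivWithin_univ]
  rfl

/-- The pullback applies the inverse of the differential of `φ⁻¹` to `X`, and the chain rule for `g
∘ φ⁻¹` cancels it: in the chart, `X g` is the derivative of `g ∘ φ⁻¹` along the pulled-back field.
-/
theorem fderiv_comp_extChartAt_symm {g : P → ℝ} (hg : MDifferentiable J 𝓘(ℝ, ℝ) g)
    (X : ∀ p, TangentSpace J p) (p : P) {y : V} (hy : y ∈ (extChartAt J p).target) :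
    fderiv ℝ (g ∘ (extChartAt J p).symm) y
      (VectorField.mpullbackWithin 𝓘(ℝ, V) J (extChartAt J p).symm X (range J) y)
      = mvfderiv J g ((extChartAt J p).symm y) (X ((extChartAt J p).symm y)) := by
  have h1 := mdifferentiableWithinAt_extChartAt_symm (I := J) hy
  have h2 := isInvertible_mfderivWithin_extChartAt_symm (I := J) hy
  rw [VectorField.mpullbackWithin_apply]
  rw [J.range_eq_univ, mdifferentiableWithinAt_univ] at h1
  rw [J.range_eq_univ, mfderivWithin_univ] at *
  rw [← mfderiv_eq_fderiv, mfderiv_comp _ (hg _) h1]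
  obtain ⟨e, he⟩ := h2
  change mfderiv J 𝓘(ℝ, ℝ) g _ (mfderiv 𝓘(ℝ, V) J (extChartAt J p).symm y _) = _
  rw [← he, ContinuousLinearMap.inverse_equiv]
  exact congrArg (mfderiv J 𝓘(ℝ, ℝ) g _) (e.apply_symm_apply _)

/-- In the chart at `p`, `X(Yg)` is `D²g(X, Y) + Dg(DY · X)`. The symmetric second derivatives
cancel in the commutator, leaving `Dg` of the coordinate Lie bracket, through which `mlieBracket` is
defined. -/
theorem mvfderiv_mlieBracket [CompleteSpace V] {g : P → ℝ} (hg : ContMDiff J 𝓘(ℝ, ℝ) ∞ g)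
    {X Y : ∀ p, TangentSpace J p}
    (hX : ContMDiff J J.tangent ∞ (fun p => (⟨p, X p⟩ : TangentBundle J P)))
    (hY : ContMDiff J J.tangent ∞ (fun p => (⟨p, Y p⟩ : TangentBundle J P))) (p : P) :
    mvfderiv J g p (VectorField.mlieBracket J X Y p)
      = mvfderiv J (fun p => mvfderiv J g p (Y p)) p (X p)
        - mvfderiv J (fun p => mvfderiv J g p (X p)) p (Y p) := by
  set φ := extChartAt J p
  set x₀ := φ p
  have hx₀ : x₀ ∈ φ.target := mem_extChartAt_target p
  have htn : φ.target ∈ 𝓝 x₀ := extChartAt_target_mem_nhds p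
  have hgd : MDifferentiable J 𝓘(ℝ, ℝ) g := hg.mdifferentiable (by simp)
  have hG : ContDiffAt ℝ ∞ (g ∘ φ.symm) x₀ := by
    have := (contMDiffOn_extChartAt_symm (n := ∞) (I := J) p).contMDiffAt htn
    exact (hg.contMDiffAt.comp x₀ this).contDiffAt
  have pull : ∀ {X : ∀ p, TangentSpace J p},
      ContMDiff J J.tangent ∞ (fun p => (⟨p, X p⟩ : TangentBundle J P)) →
      DifferentiableAt ℝ (VectorField.mpullbackWithin 𝓘(ℝ, V) J φ.symm X (range J) : V → V) x₀ := by
    intro X hX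
    have h := ((hX.contMDiffAt (x := p)).mdifferentiableAt
      (by simp)).mdifferentiableWithinAt (s := univ)
    have : IsManifold J 2 P := IsManifold.of_le (n := ∞) (by norm_cast)
    have := h.differentiableWithinAt_mpullbackWithin_vectorField
    rw [preimage_univ, univ_inter] at this
    exact this.differentiableAt (by rw [J.range_eq_univ]; exact univ_mem)
  -- At the centre of the preferred chart the differential of the chart is the identity, so pulling
  -- back does not change the value there.
  have base : ∀ X : ∀ p, TangentSpace J p,
      VectorField.mpullbackWithin 𝓘(ℝ, V) J φ.symm X (range J) x₀ = X p := by
    intro X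
    have key : ∀ p', p' = p → (X p' : V) = X p := by
      rintro _ rfl
      rfl
    exact (congrArg (mfderivWithin 𝓘(ℝ, V) J φ.symm (range J) x₀).inverse
      (key _ (extChartAt_to_inv p))).trans (mfderivWithin_extChartAt_symm_inverse_apply (X p))
  have second : ∀ {X Y : ∀ p, TangentSpace J p},
      ContMDiff J J.tangent ∞ (fun p => (⟨p, X p⟩ : TangentBundle J P)) →
      ContMDiff J J.tangent ∞ (fun p => (⟨p, Y p⟩ : TangentBundle J P)) →
      ∀ X' Y' : V → V, X' = VectorField.mpullbackWithin 𝓘(ℝ, V) J φ.symm X (range J) →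
      Y' = VectorField.mpullbackWithin 𝓘(ℝ, V) J φ.symm Y (range J) →
      mvfderiv J (fun p => mvfderiv J g p (Y p)) p (X p)
        = fderiv ℝ (fderiv ℝ (g ∘ φ.symm)) x₀ (X' x₀) (Y' x₀) + fderiv ℝ (g ∘ φ.symm) x₀
          (fderiv ℝ Y' x₀ (X' x₀)) := by
    intro X Y hX hY X' Y' hX' hY'
    set h : P → ℝ := fun p => mvfderiv J g p (Y p)
    have hYd : DifferentiableAt ℝ Y' x₀ := hY' ▸ pull hY
    have e : (h ∘ φ.symm) =ᶠ[𝓝 x₀] fun y => fderiv ℝ (g ∘ φ.symm) y (Y' y) := by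
      filter_upwards [htn] with y hy
      rw [hY']
      exact (fderiv_comp_extChartAt_symm hgd Y p hy).symm
    have hd : HasFDerivAt (fun y => fderiv ℝ (g ∘ φ.symm) y (Y' y))
        ((fderiv ℝ (g ∘ φ.symm) x₀).comp (fderiv ℝ Y' x₀)
          + (fderiv ℝ (fderiv ℝ (g ∘ φ.symm)) x₀).flip (Y' x₀)) x₀ :=
      HasFDerivAt.clm_apply
        (((hG.fderiv_right (m := ∞) (by simp)).differentiableAt (by simp)).hasFDerivAt)
        hYd.hasFDerivAt
    -- Differentiability of `Y g` at `p` is read off from its chart expression, a pairing of two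
    -- differentiable factors.
    have hh : MDifferentiableAt J 𝓘(ℝ, ℝ) h p := by
      have h1 : MDifferentiableAt J 𝓘(ℝ, ℝ) ((h ∘ φ.symm) ∘ φ) p :=
        ((hd.congr_of_eventuallyEq e).differentiableAt.mdifferentiableAt).comp p
          (mdifferentiableAt_extChartAt (mem_chart_source H p))
      refine h1.congr_of_eventuallyEq ?_
      filter_upwards [extChartAt_source_mem_nhds (I := J) p] with x hx
      exact congrArg h (φ.left_inv hx).symm
    refine (mvfderiv_eq_fderiv hh _).trans ?_
    have hb : fderiv ℝ (h ∘ φ.symm) x₀ (X p) = fderiv ℝ (h ∘ φ.symm) x₀ (X' x₀) := by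
      rw [hX']
      exact congrArg _ (base X).symm
    refine hb.trans ?_
    rw [e.fderiv_eq, hd.fderiv]
    exact add_comm _ _
  have hsymm : IsSymmSndFDerivAt ℝ (g ∘ φ.symm) x₀ :=
    hG.isSymmSndFDerivAt (by simp; norm_cast)
  obtain ⟨X', hX'⟩ : ∃ X' : V → V, X' = VectorField.mpullbackWithin 𝓘(ℝ, V) J φ.symm X (range J) :=
    ⟨_, rfl⟩
  obtain ⟨Y', hY'⟩ : ∃ Y' : V → V, Y' = VectorField.mpullbackWithin 𝓘(ℝ, V) J φ.symm Y (range J) :=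
    ⟨_, rfl⟩
  rw [second hX hY X' Y' hX' hY', second hY hX Y' X' hY' hX', hsymm.eq, add_sub_add_left_eq_sub,
    ← map_sub]
  refine (mvfderiv_eq_fderiv (hgd p) _).trans ?_
  refine congrArg (fderiv ℝ (g ∘ φ.symm) x₀) ?_
  rw [← VectorField.mlieBracketWithin_univ, VectorField.mlieBracketWithin_apply,
    mfderiv_extChartAt_self, preimage_univ, univ_inter, ← hX', ← hY']
  change (ContinuousLinearMap.id ℝ V).inverse
    (VectorField.lieBracketWithin ℝ X' Y' (range J) x₀) = _
  rw [ContinuousLinearMap.inverse_id, VectorField.lieBracketWithin_eq, J.range_eq_univ,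
    fderivWithin_univ, fderivWithin_univ]
  rfl

end Commutator

/-! ### Local coordinates -/

section Coordinates

set_option linter.unusedSectionVars false

variable {n : ℕ} {Q : Type*} [TopologicalSpace Q] [ChartedSpace (EuclideanSpace ℝ (Fin n)) Q]
  [IsManifold (𝓡 n) ∞ Q] [T2Space Q]
  {F : Type*} [NormedAddCommGroup F] [NormedSpace ℝ F] [FiniteDimensional ℝ F]
  {E : Q → Type*} [∀ q, AddCommGroup (E q)] [∀ q, Module ℝ (E q)]
  [∀ q, TopologicalSpace (E q)] [TopologicalSpace (TotalSpace F E)]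
  [FiberBundle F E] [VectorBundle ℝ F E] [ContMDiffVectorBundle ∞ F E (𝓡 n)]

namespace LocalCoords

variable (κ : LocalCoords n F E)

/-- The coefficients of a vector in the local frame. -/
abbrev coeff (α : Fin (finrank ℝ F)) (q : Q) : E q →ₗ[ℝ] ℝ := κ.isLocalFrameOn.coeff α q

theorem sum_coeff_smul {q : Q} (hq : q ∈ κ.chart.source) (v : E q) :
    ∑ α, κ.coeff α q v • κ.frame α q = v := by
  have := Basis.sum_repr (κ.isLocalFrameOn.toBasisAt hq) v
  simpa [coeff, IsLocalFrameOn.coeff, hq] using this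

theorem coeff_sum_smul {q : Q} (hq : q ∈ κ.chart.source) (a : Fin (finrank ℝ F) → ℝ)
    (α : Fin (finrank ℝ F)) : κ.coeff α q (∑ β, a β • κ.frame β q) = a α := by
  have h : ∀ β, κ.frame β q = κ.isLocalFrameOn.toBasisAt hq β := by simp
  simp only [coeff, IsLocalFrameOn.coeff, hq, dif_pos, h]
  exact congrFun ((κ.isLocalFrameOn.toBasisAt hq).equivFun.apply_symm_apply a) α
    |>.symm ▸ (by simp)

theorem coeff_frame {q : Q} (hq : q ∈ κ.chart.source) (α β : Fin (finrank ℝ F)) :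
    κ.coeff α q (κ.frame β q) = if β = α then 1 else 0 := by
  have h := κ.coeff_sum_smul hq (Pi.single β 1) α
  simpa [Pi.single_apply, eq_comm] using h

/-- The map `y ↦ ∑ y^α e_α` in the trivialization around `q₀`. -/
def frameMap (q₀ q : Q) : (Fin (finrank ℝ F) → ℝ) →L[ℝ] F :=
  ∑ α, (ContinuousLinearMap.proj (R := ℝ) (φ := fun _ : Fin (finrank ℝ F) => ℝ) α).smulRight
    (secRep F (κ.frame α) q₀ q)

theorem frameMap_apply (q₀ q : Q) (y : Fin (finrank ℝ F) → ℝ) :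
    κ.frameMap q₀ q y = ∑ α, y α • secRep F (κ.frame α) q₀ q := by
  simp [frameMap]

theorem contMDiffOn_frameMap (q₀ : Q) :
    ContMDiffOn (𝓡 n) 𝓘(ℝ, (Fin (finrank ℝ F) → ℝ) →L[ℝ] F) ∞ (κ.frameMap q₀)
      ((trivializationAt F E q₀).baseSet ∩ κ.chart.source) := by
  refine contMDiffOn_finsetSum fun α _ => ?_
  exact ((ContinuousLinearMap.smulRightL ℝ (Fin (finrank ℝ F) → ℝ) F
    (ContinuousLinearMap.proj (R := ℝ) (φ := fun _ : Fin (finrank ℝ F) => ℝ) α)).contMDiff).comp_contMDiffOn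
    (contMDiffOn_secRep (κ.isLocalFrameOn.contMDiffOn α))

/-- The frame and the trivialization both identify the fibre with a model space, so the comparison
map is invertible and its inverse reads off frame coefficients. As inversion of operators is smooth,
coefficients of smooth families are smooth. -/
theorem exists_frameMap_equiv {q₀ q : Q} (hq₀ : q ∈ (trivializationAt F E q₀).baseSet)
    (hq : q ∈ κ.chart.source) : ∃ e : (Fin (finrank ℝ F) → ℝ) ≃L[ℝ] F,
      (e : (Fin (finrank ℝ F) → ℝ) →L[ℝ] F) = κ.frameMap q₀ q ∧
      ∀ (v : E q) α, e.symm (trivializationAt F E q₀ ⟨q, v⟩).2 α = κ.coeff α q v := by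
  let e' : (Fin (finrank ℝ F) → ℝ) ≃ₗ[ℝ] F := (κ.isLocalFrameOn.toBasisAt hq).equivFun.symm.trans
    ((trivializationAt F E q₀).linearEquivAt ℝ q hq₀)
  refine ⟨e'.toContinuousLinearEquiv, ?_, fun v α => ?_⟩
  · ext y
    change (trivializationAt F E q₀).linearEquivAt ℝ q hq₀
      ((κ.isLocalFrameOn.toBasisAt hq).equivFun.symm y) = _
    rw [frameMap_apply, Basis.equivFun_symm_apply, map_sum]
    simp only [map_smul, IsLocalFrameOn.toBasisAt_coe]
    rfl
  · change (κ.isLocalFrameOn.toBasisAt hq).equivFun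
      (((trivializationAt F E q₀).linearEquivAt ℝ q hq₀).symm
        ((trivializationAt F E q₀).linearEquivAt ℝ q hq₀ v)) α = _
    rw [LinearEquiv.symm_apply_apply]
    simp [coeff, IsLocalFrameOn.coeff, hq]

/-- The inverse of `frameMap`. -/
def coframeMap (q₀ q : Q) : F →L[ℝ] (Fin (finrank ℝ F) → ℝ) := (κ.frameMap q₀ q).inverse

theorem contMDiffAt_coframeMap {q₀ q : Q} (hq₀ : q ∈ (trivializationAt F E q₀).baseSet)
    (hq : q ∈ κ.chart.source) :
    ContMDiffAt (𝓡 n) 𝓘(ℝ, F →L[ℝ] (Fin (finrank ℝ F) → ℝ)) ∞ (κ.coframeMap q₀) q := by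
  obtain ⟨e, he, -⟩ := κ.exists_frameMap_equiv hq₀ hq
  have h1 := (κ.contMDiffOn_frameMap q₀).contMDiffAt
    (((trivializationAt F E q₀).open_baseSet.inter κ.chart.open_source).mem_nhds ⟨hq₀, hq⟩)
  have h2 : ContDiffAt ℝ ∞ ContinuousLinearMap.inverse (κ.frameMap q₀ q) :=
    he ▸ contDiffAt_map_inverse e
  exact h2.contMDiffAt.comp q h1

theorem coframeMap_apply {q₀ q : Q} (hq₀ : q ∈ (trivializationAt F E q₀).baseSet)
    (hq : q ∈ κ.chart.source) (v : E q) (α : Fin (finrank ℝ F)) :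
    κ.coframeMap q₀ q (trivializationAt F E q₀ ⟨q, v⟩).2 α = κ.coeff α q v := by
  obtain ⟨e, he, hc⟩ := κ.exists_frameMap_equiv hq₀ hq
  rw [coframeMap, ← he, ContinuousLinearMap.inverse_equiv]
  exact hc v α

/-! ### Smoothness of vectors and covectors tested in a local frame -/

variable {V H P : Type*} [NormedAddCommGroup V] [NormedSpace ℝ V] [TopologicalSpace H]
  {J : ModelWithCorners ℝ V H} [TopologicalSpace P] [ChartedSpace H P]

/-- The coefficients of a smooth family of vectors in a local frame are smooth. -/
theorem contMDiffAt_coeff {f : P → TotalSpace F E} {p : P}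
    (hf : ContMDiffAt J ((𝓡 n).prod 𝓘(ℝ, F)) ∞ f p) (hp : (f p).proj ∈ κ.chart.source) :
    ContMDiffAt J 𝓘(ℝ, Fin (finrank ℝ F) → ℝ) ∞
      (fun x => fun α => κ.coeff α (f x).proj (f x).2) p := by
  obtain ⟨h1, h2⟩ := contMDiffAt_totalSpace.1 hf
  have hb := FiberBundle.mem_baseSet_trivializationAt' (F := F) (E := E) (f p).proj
  have h3 := (κ.contMDiffAt_coframeMap hb hp).comp p h1
  refine (h3.clm_apply h2).congr_of_eventuallyEq ?_
  filter_upwards [h1.continuousAt.eventually_mem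
    (((trivializationAt F E (f p).proj).open_baseSet.inter κ.chart.open_source).mem_nhds
      ⟨hb, hp⟩)] with x hx
  funext α
  exact (κ.coframeMap_apply hx.1 hx.2 (f x).2 α).symm

/-- A smooth family of linear combinations of a local frame is smooth. -/
theorem contMDiffAt_sum_smul_frame {b : P → Q} {y : P → Fin (finrank ℝ F) → ℝ} {p : P}
    (hb : ContMDiffAt J (𝓡 n) ∞ b p) (hp : b p ∈ κ.chart.source)
    (hy : ContMDiffAt J 𝓘(ℝ, Fin (finrank ℝ F) → ℝ) ∞ y p) :
    ContMDiffAt J ((𝓡 n).prod 𝓘(ℝ, F)) ∞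
      (fun x => (⟨b x, ∑ α, y x α • κ.frame α (b x)⟩ : TotalSpace F E)) p := by
  refine contMDiffAt_totalSpace.2 ⟨hb, ?_⟩
  have hm := FiberBundle.mem_baseSet_trivializationAt' (F := F) (E := E) (b p)
  have hn := ((trivializationAt F E (b p)).open_baseSet.inter κ.chart.open_source).mem_nhds
    ⟨hm, hp⟩
  refine ((((κ.contMDiffOn_frameMap (b p)).contMDiffAt hn).comp p hb).clm_apply
    hy).congr_of_eventuallyEq ?_
  filter_upwards [hb.continuousAt.eventually_mem hn] with x hx
  refine Eq.trans ?_ (κ.frameMap_apply (b p) (b x) (y x)).symm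
  exact secRep_sum_smul _ hx.1 (y x) κ.frame

/-- A smooth family of covectors with smooth components in a local frame is smooth. -/
theorem contMDiffAt_toDual {b : P → Q} {y : P → Fin (finrank ℝ F) → ℝ} {p : P}
    (hb : ContMDiffAt J (𝓡 n) ∞ b p) (hp : b p ∈ κ.chart.source)
    (hy : ContMDiffAt J 𝓘(ℝ, Fin (finrank ℝ F) → ℝ) ∞ y p) :
    ContMDiffAt J ((𝓡 n).prod 𝓘(ℝ, F →L[ℝ] ℝ)) ∞
      (fun x => (⟨b x, toDual (F := F) (b x) (∑ α, y x α • κ.coeff α (b x))⟩ :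
        TotalSpace (F →L[ℝ] ℝ) (DualBundle E))) p := by
  refine (contMDiffAt_hom_bundle _).2 ⟨hb, ?_⟩
  have hm := FiberBundle.mem_baseSet_trivializationAt' (F := F) (E := E) (b p)
  have hn := ((trivializationAt F E (b p)).open_baseSet.inter κ.chart.open_source).mem_nhds
    ⟨hm, hp⟩
  -- `T y` is the functional `x ↦ ∑ y_α x_α`. In the trivialization the covector becomes `T y`
  -- composed with the coframe map, a product of smooth factors.
  let T : (Fin (finrank ℝ F) → ℝ) →L[ℝ] ((Fin (finrank ℝ F) → ℝ) →L[ℝ] ℝ) :=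
    ∑ α, (ContinuousLinearMap.proj (R := ℝ) (φ := fun _ : Fin (finrank ℝ F) => ℝ) α).smulRight
      (ContinuousLinearMap.proj (R := ℝ) (φ := fun _ : Fin (finrank ℝ F) => ℝ) α)
  have h1 := (κ.contMDiffAt_coframeMap hm hp).comp p hb
  have h2 := T.contMDiff.contMDiffAt.comp p hy
  refine (h2.clm_comp h1).congr_of_eventuallyEq ?_
  filter_upwards [hb.continuousAt.eventually_mem hn] with x hx
  ext c
  have hc : (trivializationAt F E (b p) ⟨b x, (trivializationAt F E (b p)).symmL ℝ (b x) c⟩).2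
      = c := by
    rw [Trivialization.symmL_apply _ hx.1, Trivialization.apply_mk_symm _ hx.1]
  have h4 := fun α => κ.coframeMap_apply hx.1 hx.2 ((trivializationAt F E (b p)).symmL ℝ (b x) c) α
  rw [hc] at h4
  have h5 : T (y x) (κ.coframeMap (b p) (b x) c) = ∑ α, y x α * κ.coframeMap (b p) (b x) c α := by
    simp [T]
  refine Eq.trans ?_ h5.symm
  simp only [h4]
  simp [ContinuousLinearMap.inCoordinates, toDual]

/-- The components of a smooth family of covectors in a local frame are smooth. -/
theorem contMDiffAt_apply_frame {f : P → TotalSpace (F →L[ℝ] ℝ) (DualBundle E)} {p : P}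
    (hf : ContMDiffAt J ((𝓡 n).prod 𝓘(ℝ, F →L[ℝ] ℝ)) ∞ f p) (hp : (f p).proj ∈ κ.chart.source)
    (α : Fin (finrank ℝ F)) :
    ContMDiffAt J 𝓘(ℝ, ℝ) ∞ (fun x => (f x).2 (κ.frame α (f x).proj)) p := by
  have h1 : ContMDiffAt J (𝓡 n) ∞ (fun x => (f x).proj) p := ((contMDiffAt_hom_bundle _).1 hf).1
  have h2 : ContMDiffAt J ((𝓡 n).prod 𝓘(ℝ, F)) ∞
      (fun x => (⟨(f x).proj, κ.frame α (f x).proj⟩ : TotalSpace F E)) p :=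
    (((κ.isLocalFrameOn.contMDiffOn α).contMDiffAt
      (κ.chart.open_source.mem_nhds hp)).comp p h1)
  have h3 := ContMDiffAt.clm_bundle_apply (F₂ := ℝ) (E₂ := Bundle.Trivial Q ℝ)
    (b := fun x => (f x).proj) (ϕ := fun x => (f x).2) hf h2
  exact (contMDiffAt_totalSpace.1 h3).2

theorem toDual_apply_frame {q : Q} (hq : q ∈ κ.chart.source) (y : Fin (finrank ℝ F) → ℝ)
    (α : Fin (finrank ℝ F)) :
    toDual (F := F) q (∑ β, y β • κ.coeff β q) (κ.frame α q) = y α := by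
  change (∑ β, y β • κ.coeff β q) (κ.frame α q) = y α
  simp [κ.coeff_frame hq]

theorem toDual_eq {q : Q} (hq : q ∈ κ.chart.source) (l : DualBundle E q) :
    toDual (F := F) q (∑ β, l (κ.frame β q) • κ.coeff β q) = l := by
  ext v
  change (∑ β, l (κ.frame β q) • κ.coeff β q) v = l v
  conv_rhs => rw [← κ.sum_coeff_smul hq v]
  rw [map_sum]
  simp [mul_comm]

end LocalCoords

/-- A chart at `q` is cut down to the base set of a trivialization, where a basis of the model fibre
provides a frame. -/
theorem exists_localCoords (q : Q) : ∃ κ : LocalCoords n F E, q ∈ κ.chart.source := by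
  let e := trivializationAt F E q
  have hb := FiberBundle.mem_baseSet_trivializationAt' (F := F) (E := E) q
  let φ := (chartAt (EuclideanSpace ℝ (Fin n)) q).restr e.baseSet
  have hs : φ.source = (chartAt (EuclideanSpace ℝ (Fin n)) q).source ∩ e.baseSet := by
    simp [φ, e.open_baseSet.interior_eq]
  refine ⟨⟨φ, ?_, e.localFrame (Module.finBasis ℝ F), ?_⟩, ?_⟩
  · exact restr_mem_maximalAtlas _ (IsManifold.chart_mem_maximalAtlas q) e.open_baseSet
  · exact (e.isLocalFrameOn_localFrame_baseSet (𝓡 n) ∞ _).mono (hs ▸ inter_subset_right)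
  · change q ∈ φ.source
    rw [hs]
    exact ⟨mem_chart_source _ q, hb⟩

end Coordinates

/-! ### The exterior differential of a contact form in a local frame -/

section ExtDeriv

set_option linter.unusedSectionVars false

variable {n : ℕ} {Q : Type*} [TopologicalSpace Q] [ChartedSpace (EuclideanSpace ℝ (Fin n)) Q]
  [IsManifold (𝓡 n) ∞ Q] [T2Space Q]
  {F : Type*} [NormedAddCommGroup F] [NormedSpace ℝ F] [FiniteDimensional ℝ F]
  {E : Q → Type*} [∀ q, AddCommGroup (E q)] [∀ q, Module ℝ (E q)]
  [∀ q, TopologicalSpace (E q)] [TopologicalSpace (TotalSpace F E)]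
  [FiberBundle F E] [VectorBundle ℝ F E] [ContMDiffVectorBundle ∞ F E (𝓡 n)]
  {V H : Type*} [NormedAddCommGroup V] [NormedSpace ℝ V] [TopologicalSpace H]
  {J : ModelWithCorners ℝ V H}
  {P : Type*} [TopologicalSpace P] [ChartedSpace H P] [IsManifold J ∞ P]
  {A : LieAlgebroid n F E} {pr : P → Q}

/-- The tangent map of a smooth map is smooth. The form along a map `b` allows vectors whose base
point moves with a parameter from another manifold. -/
theorem contMDiffAt_mfderiv_apply {V' H' P' V₂ H₂ P₂ : Type*}
    [NormedAddCommGroup V'] [NormedSpace ℝ V'] [TopologicalSpace H'] {J' : ModelWithCorners ℝ V' H'}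
    [TopologicalSpace P'] [ChartedSpace H' P'] [IsManifold J' ∞ P']
    [NormedAddCommGroup V₂] [NormedSpace ℝ V₂] [TopologicalSpace H₂] {J₂ : ModelWithCorners ℝ V₂ H₂}
    [TopologicalSpace P₂] [ChartedSpace H₂ P₂]
    {g : P → P'} {u : Set P} (hu : IsOpen u) (hg : ContMDiffOn J J' ∞ g u)
    {b : P₂ → P} {v : ∀ x, TangentSpace J (b x)} {x : P₂} (hx : b x ∈ u)
    (hv : ContMDiffAt J₂ J.tangent ∞ (fun x => (⟨b x, v x⟩ : TangentBundle J P)) x) :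
    ContMDiffAt J₂ J'.tangent ∞
      (fun x => (⟨g (b x), mfderiv J J' g (b x) (v x)⟩ : TangentBundle J' P')) x := by
  have h1 := hg.contMDiffOn_tangentMapWithin (m := ∞) (by simp) hu.uniqueMDiffOn
  have hb : ContMDiffAt J₂ J ∞ b x := (contMDiffAt_totalSpace.1 hv).1
  have hn : π V (TangentSpace J) ⁻¹' u ∈ 𝓝 (⟨b x, v x⟩ : TangentBundle J P) :=
    (hu.preimage (FiberBundle.continuous_proj V _)).mem_nhds hx
  refine ((h1.contMDiffAt hn).comp x hv).congr_of_eventuallyEq ?_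
  filter_upwards [hb.continuousAt.eventually_mem (hu.mem_nhds hx)] with y hy
  simp only [Function.comp, tangentMapWithin]
  rw [mfderivWithin_of_isOpen hu hy]

theorem contMDiffAt_mvfderiv_apply {G V₂ H₂ P₂ : Type*} [NormedAddCommGroup G] [NormedSpace ℝ G]
    [NormedAddCommGroup V₂] [NormedSpace ℝ V₂] [TopologicalSpace H₂] {J₂ : ModelWithCorners ℝ V₂ H₂}
    [TopologicalSpace P₂] [ChartedSpace H₂ P₂]
    {g : P → G} {u : Set P} (hu : IsOpen u) (hg : ContMDiffOn J 𝓘(ℝ, G) ∞ g u)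
    {b : P₂ → P} {v : ∀ x, TangentSpace J (b x)} {x : P₂} (hx : b x ∈ u)
    (hv : ContMDiffAt J₂ J.tangent ∞ (fun x => (⟨b x, v x⟩ : TangentBundle J P)) x) :
    ContMDiffAt J₂ 𝓘(ℝ, G) ∞ (fun x => mvfderiv J g (b x) (v x)) x :=
  ((contMDiff_snd_tangentBundle_modelSpace G 𝓘(ℝ, G)).contMDiffAt).comp x
    (contMDiffAt_mfderiv_apply hu hg hx hv)

/-! ### The bracket of the prolongation in a local frame -/

namespace ProlSec

variable (κ : LocalCoords n F E) (Z W : ProlSec J A pr)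

/-- The coefficients of a section of the prolongation in a local frame. -/
def coeff (α : Fin (finrank ℝ F)) (p : P) : ℝ := κ.coeff α (pr p) (Z p).1

variable {p : P} (hp : pr p ∈ κ.chart.source)
include hp

theorem contMDiffAt_coeff (α : Fin (finrank ℝ F)) :
    ContMDiffAt J 𝓘(ℝ, ℝ) ∞ (Z.coeff κ α) p :=
  contMDiffAt_pi_space.1 (κ.contMDiffAt_coeff (Z.contMDiff_fst p) hp) α

theorem mdifferentiableAt_coeff (α : Fin (finrank ℝ F)) :
    MDifferentiableAt J 𝓘(ℝ, ℝ) (Z.coeff κ α) p :=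
  (Z.contMDiffAt_coeff κ hp α).mdifferentiableAt (by simp)

theorem sum_coeff_smul : ∑ α, Z.coeff κ α p • κ.frame α (pr p) = (Z p).1 :=
  κ.sum_coeff_smul hp _

variable (hpr : MDifferentiable J (𝓡 n) pr)
include hpr

theorem localRep_eventuallyEq :
    Z.localRep p =ᶠ[𝓝 p]
      fun x => ∑ α, Z.coeff κ α x • secRep F (κ.frame α) (pr p) (pr x) := by
  have hm := FiberBundle.mem_baseSet_trivializationAt' (F := F) (E := E) (pr p)
  filter_upwards [hpr.continuous.continuousAt.eventually_mem
    (((trivializationAt F E (pr p)).open_baseSet.inter κ.chart.open_source).mem_nhds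
      ⟨hm, hp⟩)] with x hx
  rw [← secRep_sum_smul _ hx.1, secRep, Z.sum_coeff_smul κ hx.2]
  rfl

theorem localRep_self : Z.localRep p p = ∑ α, Z.coeff κ α p • secRep F (κ.frame α) (pr p) (pr p) :=
  (Z.localRep_eventuallyEq κ hp hpr).self_of_nhds

theorem mvfderiv_localRep (v : TangentSpace J p) :
    mvfderiv J (Z.localRep p) p v =
      ∑ α, (mvfderiv J (Z.coeff κ α) p v • secRep F (κ.frame α) (pr p) (pr p)
        + Z.coeff κ α p • mvfderiv (𝓡 n) (secRep F (κ.frame α) (pr p)) (pr p)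
          (mfderiv J (𝓡 n) pr p v)) := by
  have hm := FiberBundle.mem_baseSet_trivializationAt' (F := F) (E := E) (pr p)
  have hn := ((trivializationAt F E (pr p)).open_baseSet.inter κ.chart.open_source).mem_nhds
    ⟨hm, hp⟩
  have h1 : ∀ α, MDifferentiableAt (𝓡 n) 𝓘(ℝ, F) (secRep F (κ.frame α) (pr p)) (pr p) :=
    fun α => ((contMDiffOn_secRep (κ.isLocalFrameOn.contMDiffOn α)).contMDiffAt
      hn).mdifferentiableAt (by simp)
  have h2 : ∀ α, MDifferentiableAt J 𝓘(ℝ, F)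
      (fun x => secRep F (κ.frame α) (pr p) (pr x)) p := fun α => (h1 α).comp p (hpr p)
  rw [mvfderiv_congr (Z.localRep_eventuallyEq κ hp hpr), mvfderiv_sum]
  · refine Finset.sum_congr rfl fun α _ => ?_
    rw [mvfderiv_fun_smul (Z.mdifferentiableAt_coeff κ hp α) (h2 α), ← mvfderiv_comp_map (h1 α) (hpr p)]
    exact add_comm _ _
  · exact fun α _ => (Z.mdifferentiableAt_coeff κ hp α).smul (h2 α)

/-- The definition of `prolBracket` uses the trivialization centred at `p`. Passing to another frame
produces derivatives of that frame along `T pr (Z)` and `T pr (W)`; these are exactly the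
corrections by which `[e_α, e_β]` differs from the bracket of constant sections in
`localBracket_eq_secRep`. -/
theorem prolBracket_fst :
    (prolBracket Z W p).1 =
      ∑ α, (mvfderiv J (W.coeff κ α) p (Z p).2 - mvfderiv J (Z.coeff κ α) p (W p).2)
        • κ.frame α (pr p)
      + ∑ α, ∑ β, (Z.coeff κ α p * W.coeff κ β p)
        • A.localBracket (κ.frame α) (κ.frame β) (pr p) := by
  have hm := FiberBundle.mem_baseSet_trivializationAt' (F := F) (E := E) (pr p)
  obtain ⟨B, hB⟩ := A.exists_localBracket_constSec (pr p)
  have hloc := fun α β => A.localBracket_eq_secRep κ.chart.open_source hp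
    (κ.isLocalFrameOn.contMDiffOn α) (κ.isLocalFrameOn.contMDiffOn β)
  -- The constraint `ρ(a) = T pr(v)` expresses the base velocity through the anchors of the frame,
  -- the form in which it occurs in the brackets `[e_α, e_β]`.
  have hZ : mfderiv J (𝓡 n) pr p (Z p).2 = ∑ β, Z.coeff κ β p • A.anchor _ (κ.frame β (pr p)) := by
    rw [← Z.mem p, ← Z.sum_coeff_smul κ hp, map_sum]
    simp only [map_smul]
  have hW : mfderiv J (𝓡 n) pr p (W p).2 = ∑ β, W.coeff κ β p • A.anchor _ (κ.frame β (pr p)) := by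
    rw [← W.mem p, ← W.sum_coeff_smul κ hp, map_sum]
    simp only [map_smul]
  change constSec (pr p) (mvfderiv J (W.localRep p) p (Z p).2
    - mvfderiv J (Z.localRep p) p (W p).2) (pr p) + _ = _
  rw [W.mvfderiv_localRep κ hp hpr, Z.mvfderiv_localRep κ hp hpr, hB, W.localRep_self κ hp hpr,
    Z.localRep_self κ hp hpr, hZ, hW]
  simp only [hloc, hB]
  have hf : ∀ α, ((trivializationAt F E (pr p)).symmL ℝ (pr p)
      (secRep F (κ.frame α) (pr p) (pr p)) : E (pr p)) = κ.frame α (pr p) := fun α => by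
    rw [← constSec_eq hm, constSec_secRep hm]
  simp only [constSec_eq hm, map_sub, map_sum, map_add, map_smul, hf, LinearMap.sum_apply,
    LinearMap.smul_apply, Finset.sum_add_distrib, Finset.smul_sum, smul_add, smul_sub, sub_smul,
    Finset.sum_sub_distrib, smul_smul]
  have swap : ∀ f : Fin (finrank ℝ F) → Fin (finrank ℝ F) → E (pr p),
      ∑ α, ∑ β, (W.coeff κ α p * Z.coeff κ β p) • f α β
        = ∑ α, ∑ β, (Z.coeff κ α p * W.coeff κ β p) • f β α := by
    intro f
    rw [Finset.sum_comm]
    exact Finset.sum_congr rfl fun α _ => Finset.sum_congr rfl fun β _ => by rw [mul_comm]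
  rw [swap, swap fun α β => B (secRep F (κ.frame β) (pr p) (pr p))
    (secRep F (κ.frame α) (pr p) (pr p))]
  abel

end ProlSec

variable [J.Boundaryless] [CompleteSpace V]

/-- The exterior differential of `η = ds - λ`, where `λ` is a family of covectors of `E`, in terms of
the components `λ_α` of `λ` in a local frame of `E`. -/
theorem extDeriv_eq (κ : LocalCoords n F E) (hpr : MDifferentiable J (𝓡 n) pr) {s : P → ℝ}
    (hs : ContMDiff J 𝓘(ℝ, ℝ) ∞ s) (l : ∀ p, DualBundle E (pr p)) {η : OneSec E J pr}
    (hη : ∀ p z, η p z = mvfderiv J s p z.2 - l p z.1) (Z W : ProlSec J A pr) {p : P}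
    (hp : pr p ∈ κ.chart.source)
    (hl : ∀ α, MDifferentiableAt J 𝓘(ℝ, ℝ) (fun x => l x (κ.frame α (pr x))) p) :
    extDeriv η Z W p =
      ∑ α, (Z.coeff κ α p * mvfderiv J (fun x => l x (κ.frame α (pr x))) p (W p).2
        - W.coeff κ α p * mvfderiv J (fun x => l x (κ.frame α (pr x))) p (Z p).2)
      + ∑ α, ∑ β, Z.coeff κ α p * W.coeff κ β p
        * l p (A.localBracket (κ.frame α) (κ.frame β) (pr p)) := by
  have hev : ∀ Z : ProlSec J A pr, (fun x => η x (Z x)) =ᶠ[𝓝 p] fun x =>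
      mvfderiv J s x (Z x).2 - ∑ α, Z.coeff κ α x * l x (κ.frame α (pr x)) := by
    intro Z
    filter_upwards [hpr.continuous.continuousAt.eventually_mem
      (κ.chart.open_source.mem_nhds hp)] with x hx
    rw [hη, ← Z.sum_coeff_smul κ hx, map_sum]
    simp
  have hd : ∀ Z : ProlSec J A pr,
      MDifferentiableAt J 𝓘(ℝ, ℝ) (fun x => mvfderiv J s x (Z x).2) p := by
    intro Z
    exact (contMDiffAt_mvfderiv_apply isOpen_univ hs.contMDiffOn (b := id) (mem_univ p)
      Z.contMDiff_snd.contMDiffAt).mdifferentiableAt (by simp)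
  have hder : ∀ (Z : ProlSec J A pr) v, mvfderiv J (fun x => η x (Z x)) p v =
      mvfderiv J (fun x => mvfderiv J s x (Z x).2) p v
      - ∑ α, (Z.coeff κ α p * mvfderiv J (fun x => l x (κ.frame α (pr x))) p v
        + l p (κ.frame α (pr p)) * mvfderiv J (Z.coeff κ α) p v) := by
    intro Z v
    have hm : ∀ α, MDifferentiableAt J 𝓘(ℝ, ℝ)
        (fun x => Z.coeff κ α x * l x (κ.frame α (pr x))) p :=
      fun α => (Z.mdifferentiableAt_coeff κ hp α).mul (hl α)
    rw [mvfderiv_congr (hev Z), mvfderiv_fun_sub (hd Z)]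
    · change _ - mvfderiv J (fun x => ∑ α, Z.coeff κ α x * l x (κ.frame α (pr x))) p v = _
      rw [mvfderiv_sum _ fun α _ => (hm α :)]
      congr 1
      refine Finset.sum_congr rfl fun α _ => ?_
      rw [mvfderiv_fun_mul (Z.mdifferentiableAt_coeff κ hp α) (hl α)]
      rfl
    · exact Finset.sum_fn Finset.univ
        (fun α x => Z.coeff κ α x * l x (κ.frame α (pr x))) ▸
        MDifferentiableAt.sum fun α _ => hm α
  -- This removes every second-order term in `s`: it is `d(ds) = 0`.
  have hbr := mvfderiv_mlieBracket hs Z.contMDiff_snd W.contMDiff_snd p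
  have h3 : mvfderiv J s p (prolBracket Z W p).2
      = mvfderiv J (fun x => mvfderiv J s x (W x).2) p (Z p).2
        - mvfderiv J (fun x => mvfderiv J s x (Z x).2) p (W p).2 := hbr
  -- The derivatives of the coefficients of `Z` and `W` in the bracket cancel those from the product
  -- rule, so what remains is tensorial.
  have h4 := Z.prolBracket_fst κ W hp hpr
  rw [extDeriv, hη, h3, h4]
  simp only [ProlSec.deriv, ProlSec.vectorField, hder, map_add, map_sum, map_smul, smul_eq_mul]
  simp only [Finset.sum_add_distrib, sub_mul, Finset.sum_sub_distrib, mul_comm (l p _)]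
  ring

end ExtDeriv

/-! ### Derivatives in coordinates -/

section LocalInverse

variable {V H P C G : Type*} [NormedAddCommGroup V] [NormedSpace ℝ V] [TopologicalSpace H]
  {J : ModelWithCorners ℝ V H} [TopologicalSpace P] [ChartedSpace H P]
  [NormedAddCommGroup C] [NormedSpace ℝ C] [NormedAddCommGroup G] [NormedSpace ℝ G]
  {Φ : P → C} {Ψ : C → P} {p : P}

theorem mfderiv_of_leftInverse (hΦ : MDifferentiableAt J 𝓘(ℝ, C) Φ p)
    (hΨ : MDifferentiableAt 𝓘(ℝ, C) J Ψ (Φ p)) (h : ∀ᶠ x in 𝓝 p, Ψ (Φ x) = x)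
    (v : TangentSpace J p) : mfderiv 𝓘(ℝ, C) J Ψ (Φ p) (mvfderiv J Φ p v) = v := by
  have h1 := mfderiv_comp_apply p hΨ hΦ v
  have h2 : Ψ ∘ Φ =ᶠ[𝓝 p] id := h
  have h3 : mfderiv J J (Ψ ∘ Φ) p v = v := by
    rw [h2.mfderiv_eq, mfderiv_id]
    rfl
  exact h1.symm.trans h3

theorem mvfderiv_of_rightInverse (hΦ : MDifferentiableAt J 𝓘(ℝ, C) Φ p)
    (hΨ : MDifferentiableAt 𝓘(ℝ, C) J Ψ (Φ p)) (hp : Ψ (Φ p) = p)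
    (h : ∀ᶠ z in 𝓝 (Φ p), Φ (Ψ z) = z)
    (w : C) : mvfderiv J Φ p (mfderiv 𝓘(ℝ, C) J Ψ (Φ p) w : V) = w := by
  have hΦ' : MDifferentiableAt J 𝓘(ℝ, C) Φ (Ψ (Φ p)) := hp.symm ▸ hΦ
  have h1 := mfderiv_comp_apply (Φ p) hΦ' hΨ w
  have h2 : Φ ∘ Ψ =ᶠ[𝓝 (Φ p)] id := h
  have h3 : mfderiv 𝓘(ℝ, C) 𝓘(ℝ, C) (Φ ∘ Ψ) (Φ p) w = w := by
    rw [h2.mfderiv_eq, mfderiv_id]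
    rfl
  have key : ∀ p' (v : V), p' = p → (mfderiv J 𝓘(ℝ, C) Φ p v : C) = mfderiv J 𝓘(ℝ, C) Φ p' v := by
    rintro _ v rfl
    rfl
  exact ((key _ _ hp).trans h1.symm).trans h3

/-- This reads derivatives in arbitrary coordinates `Φ`, in place of the preferred chart at `p`;
only a local left inverse `Ψ` is needed. -/
theorem mvfderiv_eq_fderiv_comp {g : P → G} (hg : MDifferentiableAt J 𝓘(ℝ, G) g p)
    (hΦ : MDifferentiableAt J 𝓘(ℝ, C) Φ p)
    (hΨ : MDifferentiableAt 𝓘(ℝ, C) J Ψ (Φ p)) (h : ∀ᶠ x in 𝓝 p, Ψ (Φ x) = x)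
    (v : TangentSpace J p) :
    mvfderiv J g p v = fderiv ℝ (fun z => g (Ψ z)) (Φ p) (mvfderiv J Φ p v) := by
  have hg' : MDifferentiableAt J 𝓘(ℝ, G) g (Ψ (Φ p)) := h.self_of_nhds.symm ▸ hg
  have h1 : MDifferentiableAt 𝓘(ℝ, C) 𝓘(ℝ, G) (fun z => g (Ψ z)) (Φ p) := hg'.comp (Φ p) hΨ
  have h2 : mvfderiv J g p v = mvfderiv J (fun x => g (Ψ (Φ x))) p v :=
    mvfderiv_congr (h.mono fun x hx => by rw [hx]) v
  rw [h2, mvfderiv_comp_map h1 hΦ]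
  change mfderiv 𝓘(ℝ, C) 𝓘(ℝ, G) (fun z => g (Ψ z)) (Φ p) _ = _
  rw [mfderiv_eq_fderiv]
  rfl

end LocalInverse

/-! ### Coordinates on `E × ℝ` and `E* × ℝ` -/

section PhaseCoordinates

set_option linter.unusedSectionVars false

variable {n : ℕ} {Q : Type*} [TopologicalSpace Q] [ChartedSpace (EuclideanSpace ℝ (Fin n)) Q]
  [IsManifold (𝓡 n) ∞ Q] [T2Space Q]
  {F : Type*} [NormedAddCommGroup F] [NormedSpace ℝ F] [FiniteDimensional ℝ F]
  {E : Q → Type*} [∀ q, AddCommGroup (E q)] [∀ q, Module ℝ (E q)]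
  [∀ q, TopologicalSpace (E q)] [TopologicalSpace (TotalSpace F E)]
  [FiberBundle F E] [VectorBundle ℝ F E] [ContMDiffVectorBundle ∞ F E (𝓡 n)]

theorem fderiv_eq_sum_partial (f : CoordSpace n F → ℝ) (z w : CoordSpace n F) :
    fderiv ℝ f z w = ∑ i, w.1 i * partialQ f i z + ∑ α, w.2.1 α * partialY f α z
      + w.2.2 * partialS f z := by
  have hw : w = ∑ i, w.1 i • ((EuclideanSpace.single i 1, 0, 0) : CoordSpace n F)
      + ∑ α, w.2.1 α • ((0, Pi.single α 1, 0) : CoordSpace n F)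
      + w.2.2 • ((0, 0, 1) : CoordSpace n F) := by
    refine Prod.ext ?_ (Prod.ext ?_ ?_)
    · ext i
      simp [Prod.fst_sum, Finset.sum_apply, Pi.single_apply]
    · ext α
      simp [Prod.fst_sum, Prod.snd_sum, Finset.sum_apply, Pi.single_apply]
    · simp [Prod.snd_sum]
  conv_lhs => rw [hw]
  simp only [map_add, map_sum, map_smul, smul_eq_mul]
  rfl

namespace LocalCoords

variable (κ : LocalCoords n F E)

theorem contMDiffAt_chart {q : Q} (hq : q ∈ κ.chart.source) :
    ContMDiffAt (𝓡 n) (𝓡 n) ∞ κ.chart q :=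
  contMDiffAt_of_mem_maximalAtlas κ.chart_mem hq

theorem contMDiffAt_chart_symm {x : EuclideanSpace ℝ (Fin n)} (hx : x ∈ κ.chart.target) :
    ContMDiffAt (𝓡 n) (𝓡 n) ∞ κ.chart.symm x :=
  contMDiffAt_symm_of_mem_maximalAtlas κ.chart_mem hx

theorem contMDiffAt_lagCoords {p : LagSpace F E} (hp : p.1.proj ∈ κ.chart.source) :
    ContMDiffAt (lagModel n F) 𝓘(ℝ, CoordSpace n F) ∞ κ.lagCoords p := by
  have h1 : ContMDiffAt (lagModel n F) ((𝓡 n).prod 𝓘(ℝ, F)) ∞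
      (fun x : LagSpace F E => x.1) p := contMDiffAt_fst
  have h2 : ContMDiffAt (lagModel n F) (𝓡 n) ∞ (fun x : LagSpace F E => x.1.proj) p :=
    (contMDiffAt_totalSpace.1 h1).1
  exact ((κ.contMDiffAt_chart hp).comp p h2).prodMk_space
    ((κ.contMDiffAt_coeff h1 hp).prodMk_space contMDiffAt_snd)

theorem contMDiffAt_lagPoint {z : CoordSpace n F} (hz : z.1 ∈ κ.chart.target) :
    ContMDiffAt 𝓘(ℝ, CoordSpace n F) (lagModel n F) ∞ (κ.lagPoint (E := E)) z := by
  have h1 : ContMDiffAt 𝓘(ℝ, CoordSpace n F) (𝓡 n) ∞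
      (fun z : CoordSpace n F => κ.chart.symm z.1) z :=
    (κ.contMDiffAt_chart_symm hz).comp z contDiff_fst.contMDiff.contMDiffAt
  exact (κ.contMDiffAt_sum_smul_frame h1 (κ.chart.map_target hz)
    (contDiff_fst.comp contDiff_snd).contMDiff.contMDiffAt).prodMk
    (contDiff_snd.comp contDiff_snd).contMDiff.contMDiffAt

theorem lagPoint_lagCoords {p : LagSpace F E} (hp : p.1.proj ∈ κ.chart.source) :
    κ.lagPoint (κ.lagCoords p) = p := by
  obtain ⟨⟨q, v⟩, s⟩ := p
  have key : ∀ q', q' = q → (⟨q', ∑ α, κ.coeff α q v • κ.frame α q'⟩ : TotalSpace F E) = ⟨q, v⟩ := by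
    rintro _ rfl
    rw [κ.sum_coeff_smul hp]
  exact Prod.ext (key _ (κ.chart.left_inv hp)) rfl

theorem lagCoords_lagPoint {z : CoordSpace n F} (hz : z.1 ∈ κ.chart.target) :
    κ.lagCoords (κ.lagPoint z) = z :=
  Prod.ext (κ.chart.right_inv hz)
    (Prod.ext (funext fun α => κ.coeff_sum_smul (κ.chart.map_target hz) z.2.1 α) rfl)

theorem contMDiffAt_hamCoords {p : HamSpace F E} (hp : p.1.proj ∈ κ.chart.source) :
    ContMDiffAt (hamModel n F) 𝓘(ℝ, CoordSpace n F) ∞ κ.hamCoords p := by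
  have h1 : ContMDiffAt (hamModel n F) ((𝓡 n).prod 𝓘(ℝ, F →L[ℝ] ℝ)) ∞
      (fun x : HamSpace F E => x.1) p := contMDiffAt_fst
  have h2 : ContMDiffAt (hamModel n F) (𝓡 n) ∞ (fun x : HamSpace F E => x.1.proj) p :=
    (contMDiffAt_totalSpace.1 h1).1
  exact ((κ.contMDiffAt_chart hp).comp p h2).prodMk_space
    ((contMDiffAt_pi_space.2 fun α => κ.contMDiffAt_apply_frame h1 hp α).prodMk_space contMDiffAt_snd)

theorem contMDiffAt_hamPoint {z : CoordSpace n F} (hz : z.1 ∈ κ.chart.target) :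
    ContMDiffAt 𝓘(ℝ, CoordSpace n F) (hamModel n F) ∞ (κ.hamPoint (E := E)) z := by
  have h1 : ContMDiffAt 𝓘(ℝ, CoordSpace n F) (𝓡 n) ∞
      (fun z : CoordSpace n F => κ.chart.symm z.1) z :=
    (κ.contMDiffAt_chart_symm hz).comp z contDiff_fst.contMDiff.contMDiffAt
  exact (κ.contMDiffAt_toDual h1 (κ.chart.map_target hz)
    (contDiff_fst.comp contDiff_snd).contMDiff.contMDiffAt).prodMk
    (contDiff_snd.comp contDiff_snd).contMDiff.contMDiffAt

theorem hamPoint_hamCoords {p : HamSpace F E} (hp : p.1.proj ∈ κ.chart.source) :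
    κ.hamPoint (κ.hamCoords p) = p := by
  obtain ⟨⟨q, l⟩, s⟩ := p
  have key : ∀ q', q' = q → (⟨q', toDual (F := F) q' (∑ α, l (κ.frame α q) • κ.coeff α q')⟩ :
      TotalSpace (F →L[ℝ] ℝ) (DualBundle E)) = ⟨q, l⟩ := by
    rintro _ rfl
    rw [κ.toDual_eq hp]
  exact Prod.ext (key _ (κ.chart.left_inv hp)) rfl

theorem hamCoords_hamPoint {z : CoordSpace n F} (hz : z.1 ∈ κ.chart.target) :
    κ.hamCoords (κ.hamPoint z) = z :=
  Prod.ext (κ.chart.right_inv hz)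
    (Prod.ext (funext fun α => κ.toDual_apply_frame (κ.chart.map_target hz) z.2.1 α) rfl)

theorem eventually_mem_target {z : CoordSpace n F} (hz : z.1 ∈ κ.chart.target) :
    ∀ᶠ w in 𝓝 z, w.1 ∈ κ.chart.target :=
  continuous_fst.continuousAt.eventually_mem (κ.chart.open_target.mem_nhds hz)

theorem eventually_mem_source_lag {p : LagSpace F E} (hp : p.1.proj ∈ κ.chart.source) :
    ∀ᶠ x : LagSpace F E in 𝓝 p, x.1.proj ∈ κ.chart.source :=
  ((FiberBundle.continuous_proj F E).comp continuous_fst).continuousAt.eventually_mem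
    (κ.chart.open_source.mem_nhds hp)

theorem eventually_mem_source_ham {p : HamSpace F E} (hp : p.1.proj ∈ κ.chart.source) :
    ∀ᶠ x : HamSpace F E in 𝓝 p, x.1.proj ∈ κ.chart.source :=
  ((FiberBundle.continuous_proj (F →L[ℝ] ℝ) (DualBundle E)).comp
    continuous_fst).continuousAt.eventually_mem (κ.chart.open_source.mem_nhds hp)

end LocalCoords

end PhaseCoordinates

/-! ### The Legendre transformation in coordinates -/

section Legendre

set_option linter.unusedSectionVars false

variable {n : ℕ} {Q : Type*} [TopologicalSpace Q] [ChartedSpace (EuclideanSpace ℝ (Fin n)) Q]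
  [IsManifold (𝓡 n) ∞ Q] [T2Space Q]
  {F : Type*} [NormedAddCommGroup F] [NormedSpace ℝ F] [FiniteDimensional ℝ F]
  {E : Q → Type*} [∀ q, AddCommGroup (E q)] [∀ q, Module ℝ (E q)]
  [∀ q, TopologicalSpace (E q)] [TopologicalSpace (TotalSpace F E)]
  [FiberBundle F E] [VectorBundle ℝ F E] [ContMDiffVectorBundle ∞ F E (𝓡 n)]

theorem contDiffAt_partialY {f : CoordSpace n F → ℝ} {z : CoordSpace n F} (hf : ContDiffAt ℝ ∞ f z)
    (α : Fin (finrank ℝ F)) : ContDiffAt ℝ ∞ (partialY f α) z :=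
  (hf.fderiv_right (m := ∞) (by simp)).clm_apply contDiffAt_const

theorem contDiffAt_partialQ {f : CoordSpace n F → ℝ} {z : CoordSpace n F} (hf : ContDiffAt ℝ ∞ f z)
    (i : Fin n) : ContDiffAt ℝ ∞ (partialQ f i) z :=
  (hf.fderiv_right (m := ∞) (by simp)).clm_apply contDiffAt_const

theorem contDiffAt_partialS {f : CoordSpace n F → ℝ} {z : CoordSpace n F}
    (hf : ContDiffAt ℝ ∞ f z) : ContDiffAt ℝ ∞ (partialS f) z :=
  (hf.fderiv_right (m := ∞) (by simp)).clm_apply contDiffAt_const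

variable (L : Lagrangian n F E) (κ : LocalCoords n F E)

theorem contDiffAt_lagrangian {z : CoordSpace n F} (hz : z.1 ∈ κ.chart.target) :
    ContDiffAt ℝ ∞ (fun w => L (κ.lagPoint w)) z :=
  (L.contMDiff.contMDiffAt.comp z (κ.contMDiffAt_lagPoint hz)).contDiffAt

/-- In coordinates the curve `t ↦ (a + t b, s)` is a straight line with direction `(0, b^α, 0)`, so
the fibre derivative is a combination of the `∂L/∂y^α`. -/
theorem legendreCovector_eq {p : LagSpace F E} (hp : p.1.proj ∈ κ.chart.source)
    (b : E p.1.proj) :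
    legendreCovector L p b =
      ∑ α, κ.coeff α p.1.proj b * partialY (fun w => L (κ.lagPoint w)) α (κ.lagCoords p) := by
  set w : CoordSpace n F := (0, fun α => κ.coeff α p.1.proj b, 0) with hw
  have h1 : ∀ t : ℝ, fiberLine p b t = κ.lagPoint (κ.lagCoords p + t • w) := by
    intro t
    rw [← κ.lagPoint_lagCoords (p := fiberLine p b t) hp]
    congr 1
    refine Prod.ext ?_ (Prod.ext ?_ ?_)
    · simp [LocalCoords.lagCoords, fiberLine, hw]
    · funext α
      change κ.coeff α p.1.proj (p.1.2 + t • b)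
        = κ.coeff α p.1.proj p.1.2 + t * κ.coeff α p.1.proj b
      rw [map_add, map_smul, smul_eq_mul]
    · simp [LocalCoords.lagCoords, fiberLine, hw]
  have h2 := (contDiffAt_lagrangian L κ (z := κ.lagCoords p)
    (κ.chart.map_source hp)).differentiableAt (by simp)
  have h3 : HasDerivAt (fun t : ℝ => κ.lagCoords p + t • w) w 0 := by
    simpa using! ((hasDerivAt_id (0 : ℝ)).smul_const w).const_add (κ.lagCoords p)
  have h4 : HasFDerivAt (fun w => L (κ.lagPoint w))
      (fderiv ℝ (fun w => L (κ.lagPoint w)) (κ.lagCoords p)) (κ.lagCoords p + (0 : ℝ) • w) := by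
    simpa using h2.hasFDerivAt
  change deriv (fun t : ℝ => L (fiberLine p b t)) 0 = _
  simp only [h1]
  refine (h4.comp_hasDerivAt (0 : ℝ) h3).deriv.trans ?_
  rw [fderiv_eq_sum_partial]
  simp [hw]

theorem legendreCovector_frame {p : LagSpace F E} (hp : p.1.proj ∈ κ.chart.source)
    (α : Fin (finrank ℝ F)) :
    legendreCovector L p (κ.frame α p.1.proj) =
      partialY (fun w => L (κ.lagPoint w)) α (κ.lagCoords p) := by
  rw [legendreCovector_eq L κ hp]
  simp [κ.coeff_frame hp]

theorem energy_eq_legendreCovector (p : LagSpace F E) :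
    energy L p = legendreCovector L p p.1.2 - L p := by
  change mvfderiv (lagModel n F) L p (vertLift p p.1.2) - L p = _
  rw [← deriv_fiberLine]
  rfl

theorem energy_eq {p : LagSpace F E} (hp : p.1.proj ∈ κ.chart.source) :
    energy L p = ∑ α, (κ.lagCoords p).2.1 α
      * partialY (fun w => L (κ.lagPoint w)) α (κ.lagCoords p) - L p := by
  rw [energy_eq_legendreCovector, legendreCovector_eq L κ hp]
  rfl

theorem contMDiff_energy : ContMDiff (lagModel n F) 𝓘(ℝ, ℝ) ∞ (energy L) := by
  intro p
  obtain ⟨κ, hp⟩ := exists_localCoords (n := n) (F := F) (E := E) p.1.proj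
  have hE : ContDiffAt ℝ ∞ (fun z : CoordSpace n F =>
      ∑ α, z.2.1 α * partialY (fun w => L (κ.lagPoint w)) α z) (κ.lagCoords p) := by
    refine ContDiffAt.sum fun α _ => ContDiffAt.mul ?_ (contDiffAt_partialY
      (contDiffAt_lagrangian L κ (κ.chart.map_source hp)) α)
    fun_prop
  refine ((hE.contMDiffAt.comp p (κ.contMDiffAt_lagCoords hp)).sub
    L.contMDiff.contMDiffAt).congr_of_eventuallyEq ?_
  filter_upwards [κ.eventually_mem_source_lag hp] with x hx
  exact energy_eq L κ hx

theorem hamCoords_legendre {p : LagSpace F E} (hp : p.1.proj ∈ κ.chart.source) :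
    κ.hamCoords (legendre L p) = ((κ.lagCoords p).1,
      fun α => partialY (fun w => L (κ.lagPoint w)) α (κ.lagCoords p), (κ.lagCoords p).2.2) :=
  Prod.ext rfl (Prod.ext (funext fun α => legendreCovector_frame L κ hp α) rfl)

variable (Leg : Diffeomorph (lagModel n F) (hamModel n F) (LagSpace F E) (HamSpace F E) ∞)
  (hLeg : ∀ p, Leg p = legendre L p)
include hLeg

theorem contMDiff_hamiltonian :
    ContMDiff (hamModel n F) 𝓘(ℝ, ℝ) ∞ (energy L ∘ Leg.symm) :=
  (contMDiff_energy L).comp Leg.symm.contMDiff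

/-- The differential of the Hamiltonian of a hyperregular Lagrangian. -/
theorem fderiv_hamiltonian {p : LagSpace F E} (hp : p.1.proj ∈ κ.chart.source)
    (u : CoordSpace n F) :
    fderiv ℝ (fun w => (energy L ∘ Leg.symm) (κ.hamPoint w)) (κ.hamCoords (legendre L p)) u =
      ∑ α, (κ.lagCoords p).2.1 α * u.2.1 α
      - ∑ i, u.1 i * partialQ (fun w => L (κ.lagPoint w)) i (κ.lagCoords p)
      - u.2.2 * partialS (fun w => L (κ.lagPoint w)) (κ.lagCoords p) := by
  set L' : CoordSpace n F → ℝ := fun w => L (κ.lagPoint w) with hL'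
  set H' : CoordSpace n F → ℝ := fun w => (energy L ∘ Leg.symm) (κ.hamPoint w) with hH'
  set z := κ.lagCoords p with hz
  have hzt : z.1 ∈ κ.chart.target := κ.chart.map_source hp
  set y := κ.hamCoords (legendre L p) with hy
  have hLd : ∀ w : CoordSpace n F, w.1 ∈ κ.chart.target → ContDiffAt ℝ ∞ L' w :=
    fun w hw => contDiffAt_lagrangian L κ hw
  -- The coordinate form `(q, y, s) ↦ (q, ∂L/∂y, s)` of the Legendre transformation; `D` below is
  -- its differential at `z`.
  let leg : CoordSpace n F → CoordSpace n F := fun w => (w.1, fun α => partialY L' α w, w.2.2)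
  have hleg : ∀ x : LagSpace F E, x.1.proj ∈ κ.chart.source →
      κ.hamCoords (legendre L x) = leg (κ.lagCoords x) := fun x hx => hamCoords_legendre L κ hx
  have hlegz : leg z = y := (hleg p hp).symm
  have hYd := fun α => (contDiffAt_partialY (hLd z hzt) α).differentiableAt (by simp)
  let D : CoordSpace n F →L[ℝ] CoordSpace n F := (ContinuousLinearMap.fst ℝ _ _).prod
      ((ContinuousLinearMap.pi fun α => fderiv ℝ (partialY L' α) z).prod
        ((ContinuousLinearMap.snd ℝ _ _).comp (ContinuousLinearMap.snd ℝ _ _)))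
  have dleg : HasFDerivAt leg D z := by
    refine hasFDerivAt_fst.prodMk ((hasFDerivAt_pi.2 fun α => (hYd α).hasFDerivAt).prodMk ?_)
    exact hasFDerivAt_snd.comp z hasFDerivAt_snd
  have hHd : DifferentiableAt ℝ H' y := by
    have h1 := (contMDiff_hamiltonian L Leg hLeg).contMDiffAt.comp y
      (κ.contMDiffAt_hamPoint (E := E) (z := y) (κ.chart.map_source hp))
    exact h1.contDiffAt.differentiableAt (by simp)
  have hE : (fun w => H' (leg w)) =ᶠ[𝓝 z] fun w => ∑ α, w.2.1 α * partialY L' α w - L' w := by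
    filter_upwards [κ.eventually_mem_target hzt] with w hw
    have hs : (κ.lagPoint (E := E) w).1.proj ∈ κ.chart.source := κ.chart.map_target hw
    have h1 := energy_eq L κ hs
    have h2 := hleg _ hs
    rw [κ.lagCoords_lagPoint hw] at h1 h2
    rw [hH', ← h2]
    simp only [Function.comp]
    rw [κ.hamPoint_hamCoords (p := legendre L (κ.lagPoint w)) hs, ← hLeg, Leg.symm_apply_apply, h1]
  let pY : Fin (finrank ℝ F) → CoordSpace n F →L[ℝ] ℝ := fun α =>
    (ContinuousLinearMap.proj (R := ℝ) (φ := fun _ : Fin (finrank ℝ F) => ℝ) α).comp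
      ((ContinuousLinearMap.fst ℝ _ _).comp (ContinuousLinearMap.snd ℝ _ _))
  have dE : HasFDerivAt (fun w : CoordSpace n F => ∑ α, w.2.1 α * partialY L' α w - L' w)
      (∑ α, (z.2.1 α • fderiv ℝ (partialY L' α) z + partialY L' α z • pY α)
        - fderiv ℝ L' z) z := by
    refine (HasFDerivAt.fun_sum fun α _ => ?_).sub ((hLd z hzt).differentiableAt (by simp)).hasFDerivAt
    exact HasFDerivAt.mul (pY α).hasFDerivAt (hYd α).hasFDerivAt
  have hH2 : HasFDerivAt H' (fderiv ℝ H' y) (leg z) := hlegz.symm ▸ hHd.hasFDerivAt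
  -- Differentiating `H' ∘ leg = ∑ y^α ∂L/∂y^α - L'` determines `dH'` on the image of `D`.
  have hcomp := (hH2.comp z dleg).unique (dE.congr_of_eventuallyEq hE)
  -- the differential of `leg` is onto
  obtain ⟨w, hw⟩ : ∃ w, D w = u := by
    -- `g` is `Leg.symm` in coordinates. Near `y`, `leg ∘ g = id`, so `D ∘ dg = id` and `w = dg(u)`
    -- is a preimage of `u`; hyperregularity enters here.
    let g : CoordSpace n F → CoordSpace n F := fun w => κ.lagCoords (Leg.symm (κ.hamPoint w))
    have hproj : ∀ x : HamSpace F E, (Leg.symm x).1.proj = x.1.proj := by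
      intro x
      conv_rhs => rw [← Leg.apply_symm_apply x, hLeg]
      rfl
    have hg : ∀ᶠ w in 𝓝 y, leg (g w) = w := by
      filter_upwards [κ.eventually_mem_target (z := y) (κ.chart.map_source hp)] with w hw
      have hs : (Leg.symm (κ.hamPoint w)).1.proj ∈ κ.chart.source := by
        rw [hproj]
        exact κ.chart.map_target hw
      rw [← hleg _ hs, ← hLeg, Leg.apply_symm_apply, κ.hamCoords_hamPoint hw]
    have hgy : g y = z := by
      have : κ.hamPoint y = Leg p := by
        rw [hLeg]
        exact κ.hamPoint_hamCoords (p := legendre L p) hp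
      simp only [g, this, Leg.symm_apply_apply, hz]
    have hgd : DifferentiableAt ℝ g y := by
      have h1 := Leg.symm.contMDiff.contMDiffAt.comp y
        (κ.contMDiffAt_hamPoint (E := E) (z := y) (κ.chart.map_source hp))
      have h2 := (κ.contMDiffAt_lagCoords (p := Leg.symm (κ.hamPoint y)) (by
        rw [hproj]; exact κ.chart.map_target (κ.chart.map_source hp))).comp y h1
      exact h2.contDiffAt.differentiableAt (by simp)
    have dleg' : HasFDerivAt leg D (g y) := by rwa [hgy]
    have h3 := (dleg'.comp y hgd.hasFDerivAt).unique ((hasFDerivAt_id y).congr_of_eventuallyEq hg)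
    exact ⟨fderiv ℝ g y u, congrArg (fun l => l u) h3⟩
  have h5 := congrArg (fun l => l w) hcomp
  simp only [ContinuousLinearMap.comp_apply, hw] at h5
  rw [h5, ← hw]
  -- Expanding `dL'` cancels the terms `∂L/∂y^α dy^α`; the terms left involve only `dq`, `d(∂L/∂y)`
  -- and `ds` of `w`, which are the components of `D w = u`.
  have h6 := fderiv_eq_sum_partial L' z w
  simp only [sub_apply, sum_apply,
    add_apply, smul_apply, h6, smul_eq_mul,
    Finset.sum_add_distrib]
  simp [mul_comm, D, pY]
  ring

end Legendre

/-! ### The Herglotz equations and the contact Hamilton equations -/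

section Solutions

set_option linter.unusedSectionVars false

variable {n : ℕ} {Q : Type*} [TopologicalSpace Q] [ChartedSpace (EuclideanSpace ℝ (Fin n)) Q]
  [IsManifold (𝓡 n) ∞ Q] [T2Space Q]
  {F : Type*} [NormedAddCommGroup F] [NormedSpace ℝ F] [FiniteDimensional ℝ F]
  {E : Q → Type*} [∀ q, AddCommGroup (E q)] [∀ q, Module ℝ (E q)]
  [∀ q, TopologicalSpace (E q)] [TopologicalSpace (TotalSpace F E)]
  [FiberBundle F E] [VectorBundle ℝ F E] [ContMDiffVectorBundle ∞ F E (𝓡 n)]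
  (A : LieAlgebroid n F E) (L : Lagrangian n F E)
  (Leg : Diffeomorph (lagModel n F) (hamModel n F) (LagSpace F E) (HamSpace F E) ∞)
  (hLeg : ∀ p, Leg p = legendre L p)
include hLeg

/-- The equivalence holds at each time and in each coordinate system: `fderiv_hamiltonian` turns
each Hamilton equation at `Leg_L(c(t))` into the corresponding Herglotz equation at `c(t)`. -/
theorem isHerglotzSolution_iff (I : Set ℝ) (c : ℝ → LagSpace F E) :
    IsHerglotzSolution A L I c ↔
      IsHamiltonSolution A (energy L ∘ Leg.symm) I (legendre L ∘ c) := by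
  have hLeg' : legendre L = Leg := (funext hLeg).symm
  have hsm : ContMDiffOn 𝓘(ℝ, ℝ) (lagModel n F) ∞ c I ↔
      ContMDiffOn 𝓘(ℝ, ℝ) (hamModel n F) ∞ (legendre L ∘ c) I := by
    rw [hLeg']
    refine ⟨fun h => Leg.contMDiff.comp_contMDiffOn h, fun h => ?_⟩
    refine (Leg.symm.contMDiff.comp_contMDiffOn h).congr fun t _ => ?_
    simp
  rw [IsHerglotzSolution, IsHamiltonSolution, ← hsm]
  refine and_congr_right fun hc => ?_
  refine forall_congr' fun κ => forall₂_congr fun t ht => forall_congr' fun hq => ?_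
  let q := lagProj F E (c t)
  let z : ℝ → CoordSpace n F := fun r => κ.lagCoords (c r)
  let L' : CoordSpace n F → ℝ := fun w => L (κ.lagPoint w)
  change (c t).1.proj ∈ κ.chart.source at hq
  set H' : CoordSpace n F → ℝ := fun w => (energy L ∘ Leg.symm) (κ.hamPoint w) with hH'
  set y : ℝ → CoordSpace n F := fun r => κ.hamCoords ((legendre L ∘ c) r) with hy
  have hfd : ∀ u, fderiv ℝ H' (y t) u = ∑ α, (z t).2.1 α * u.2.1 α
      - ∑ i, u.1 i * partialQ L' i (z t) - u.2.2 * partialS L' (z t) :=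
    fderiv_hamiltonian L κ Leg hLeg hq
  have hQ : ∀ i, partialQ H' i (y t) = - partialQ L' i (z t) := by
    intro i
    rw [partialQ, hfd]
    simp
  have hY : ∀ α, partialY H' α (y t) = (z t).2.1 α := by
    intro α
    rw [partialY, hfd]
    simp [Pi.single_apply]
  have hS : partialS H' (y t) = - partialS L' (z t) := by
    rw [partialS, hfd]
    simp
  have hyα : ∀ r, (c r).1.proj ∈ κ.chart.source → ∀ α, (y r).2.1 α = partialY L' α (z r) :=
    fun r hr α => legendreCovector_frame L κ hr α
  -- The identity `y_α = ∂L/∂y^α` is available only while the curve stays in the coordinate domain.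
  -- Continuity within `I` gives it near `t`, which suffices to compare derivatives within `I`.
  have hev : ∀ α, (fun r => (y r).2.1 α) =ᶠ[𝓝[I] t] fun r => partialY L' α (z r) := by
    intro α
    filter_upwards [(hc t ht).continuousWithinAt.eventually (κ.eventually_mem_source_lag hq)]
      with r hr
    exact hyα r hr α
  have hH : (energy L ∘ Leg.symm) ((legendre L ∘ c) t)
      = ∑ α, (z t).2.1 α * partialY L' α (z t) - L (c t) := by
    rw [Function.comp_apply, Function.comp_apply, ← hLeg, Leg.symm_apply_apply]
    exact energy_eq L κ hq
  have e1 : ∀ α, HasDerivWithinAt (fun r => partialY L' α (z r))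
      (∑ i, κ.anchorCoeff A i α q * partialQ L' i (z t)
        - ∑ β, ∑ γ, (z t).2.1 β * κ.structCoeff A γ α β q * partialY L' γ (z t)
        + partialY L' α (z t) * partialS L' (z t)) I t ↔
      HasDerivWithinAt (fun r => (y r).2.1 α)
      (-(∑ i, κ.anchorCoeff A i α q * partialQ H' i (y t)
        + ∑ β, ∑ γ, κ.structCoeff A γ α β q * (y t).2.1 γ * partialY H' β (y t)
        + (y t).2.1 α * partialS H' (y t))) I t := by
    intro α
    have hv : (∑ i, κ.anchorCoeff A i α q * partialQ L' i (z t)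
        - ∑ β, ∑ γ, (z t).2.1 β * κ.structCoeff A γ α β q * partialY L' γ (z t)
        + partialY L' α (z t) * partialS L' (z t)) =
        (-(∑ i, κ.anchorCoeff A i α q * partialQ H' i (y t)
        + ∑ β, ∑ γ, κ.structCoeff A γ α β q * (y t).2.1 γ * partialY H' β (y t)
        + (y t).2.1 α * partialS H' (y t))) := by
      have hsum : ∑ β, ∑ γ, κ.structCoeff A γ α β q * (y t).2.1 γ * partialY H' β (y t)
          = ∑ β, ∑ γ, (z t).2.1 β * κ.structCoeff A γ α β q * partialY L' γ (z t) :=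
        Finset.sum_congr rfl fun β _ => Finset.sum_congr rfl fun γ _ => by
          rw [hY, hyα t hq]
          ring
      rw [hsum, hS, hyα t hq]
      simp only [hQ, mul_neg, Finset.sum_neg_distrib]
      ring
    rw [hv]
    exact ⟨fun h => h.congr_of_eventuallyEq (hev α) (hyα t hq α),
      fun h => h.congr_of_eventuallyEq (hev α).symm (hyα t hq α).symm⟩
  have e2 : ∀ i, HasDerivWithinAt (fun r => (z r).1 i)
      (∑ α, (z t).2.1 α * κ.anchorCoeff A i α q) I t ↔
      HasDerivWithinAt (fun r => (y r).1 i)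
      (∑ α, κ.anchorCoeff A i α q * partialY H' α (y t)) I t := by
    intro i
    simp only [hY, mul_comm]
    exact Iff.rfl
  have e3 : HasDerivWithinAt (fun r => (z r).2.2) (L (c t)) I t ↔
      HasDerivWithinAt (fun r => (y r).2.2)
      (∑ α, (y t).2.1 α * partialY H' α (y t) - (energy L ∘ Leg.symm) ((legendre L ∘ c) t)) I t := by
    have hv : ∑ α, (y t).2.1 α * partialY H' α (y t)
        - (energy L ∘ Leg.symm) ((legendre L ∘ c) t) = L (c t) := by
      rw [hH]
      simp only [hY, hyα t hq, mul_comm]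
      ring
    rw [hv]
    exact Iff.rfl
  exact ⟨fun h => ⟨fun i => (e2 i).1 (h.2.1 i), fun α => (e1 α).1 (h.1 α), e3.1 h.2.2⟩,
    fun h => ⟨fun α => (e1 α).2 (h.2.1 α), fun i => (e2 i).2 (h.1 i), e3.2 h.2.2⟩⟩

end Solutions

/-! ### The prolongation of `E` over `E* × ℝ` in coordinates -/

section HamiltonSide

set_option linter.unusedSectionVars false

variable {n : ℕ} {Q : Type*} [TopologicalSpace Q] [ChartedSpace (EuclideanSpace ℝ (Fin n)) Q]
  [IsManifold (𝓡 n) ∞ Q] [T2Space Q]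
  {F : Type*} [NormedAddCommGroup F] [NormedSpace ℝ F] [FiniteDimensional ℝ F]
  {E : Q → Type*} [∀ q, AddCommGroup (E q)] [∀ q, Module ℝ (E q)]
  [∀ q, TopologicalSpace (E q)] [TopologicalSpace (TotalSpace F E)]
  [FiberBundle F E] [VectorBundle ℝ F E] [ContMDiffVectorBundle ∞ F E (𝓡 n)]

theorem contMDiff_hamProj : ContMDiff (hamModel n F) (𝓡 n) ∞ (hamProj F E) :=
  (contMDiff_proj (DualBundle E)).comp contMDiff_fst

theorem mdifferentiable_hamProj : MDifferentiable (hamModel n F) (𝓡 n) (hamProj F E) :=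
  contMDiff_hamProj.mdifferentiable (by simp)

namespace LocalCoords

variable (κ : LocalCoords n F E) (A : LieAlgebroid n F E)

/-- The coordinate expression of the vector field `ρ(e_α)`. -/
def anchorVec (α : Fin (finrank ℝ F)) (q : Q) : EuclideanSpace ℝ (Fin n) :=
  mvfderiv (𝓡 n) κ.chart q (A.anchor q (κ.frame α q))

/-- The coordinates of a tangent vector of `E* × ℝ`. -/
def tangentCoords (p : HamSpace F E) (v : TangentSpace (hamModel n F) p) : CoordSpace n F :=
  mvfderiv (hamModel n F) κ.hamCoords p v

/-- The element `(a^α e_α, a^α ρ^i_α ∂/∂q^i + b_α ∂/∂y_α + r ∂/∂s)` of the prolongation. -/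
def prolVec (p : HamSpace F E) (a b : Fin (finrank ℝ F) → ℝ) (r : ℝ) :
    E (hamProj F E p) × TangentSpace (hamModel n F) p :=
  (∑ α, a α • κ.frame α (hamProj F E p),
    mfderiv 𝓘(ℝ, CoordSpace n F) (hamModel n F) (κ.hamPoint (E := E)) (κ.hamCoords p)
      ((∑ α, a α • κ.anchorVec A α (hamProj F E p), b, r) : CoordSpace n F))

/-- It allows the defining condition `ρ(a) = T pr(v)` of the prolongation to be checked on
coordinates. -/
theorem mvfderiv_chart_injective {q : Q} (hq : q ∈ κ.chart.source) {v w : TangentSpace (𝓡 n) q}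
    (h : mvfderiv (𝓡 n) κ.chart q v = mvfderiv (𝓡 n) κ.chart q w) : v = w := by
  have h1 := mfderiv_of_leftInverse (J := 𝓡 n) (Φ := κ.chart) (Ψ := κ.chart.symm)
    ((κ.contMDiffAt_chart hq).mdifferentiableAt (by simp))
    ((κ.contMDiffAt_chart_symm (κ.chart.map_source hq)).mdifferentiableAt (by simp))
    (κ.chart.eventually_left_inverse hq)
  exact (h1 v).symm.trans ((congrArg _ h).trans (h1 w))

variable {p : HamSpace F E} (hp : hamProj F E p ∈ κ.chart.source)
include hp

theorem mdifferentiableAt_hamCoords :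
    MDifferentiableAt (hamModel n F) 𝓘(ℝ, CoordSpace n F) κ.hamCoords p :=
  (κ.contMDiffAt_hamCoords hp).mdifferentiableAt (by simp)

theorem tangentCoords_fst (v : TangentSpace (hamModel n F) p) :
    (κ.tangentCoords p v).1 = mvfderiv (𝓡 n) κ.chart (hamProj F E p)
      (mfderiv (hamModel n F) (𝓡 n) (hamProj F E) p v) :=
  (mvfderiv_clm_comp (ContinuousLinearMap.fst ℝ (EuclideanSpace ℝ (Fin n))
    ((Fin (finrank ℝ F) → ℝ) × ℝ)) (κ.mdifferentiableAt_hamCoords hp) v).symm.trans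
    (mvfderiv_comp_map ((κ.contMDiffAt_chart hp).mdifferentiableAt (by simp))
      (mdifferentiable_hamProj p) v)

theorem tangentCoords_snd_fst (v : TangentSpace (hamModel n F) p) (α : Fin (finrank ℝ F)) :
    (κ.tangentCoords p v).2.1 α =
      mvfderiv (hamModel n F) (fun x : HamSpace F E => x.1.2 (κ.frame α (hamProj F E x))) p v :=
  (mvfderiv_clm_comp ((ContinuousLinearMap.proj (R := ℝ) (φ := fun _ : Fin (finrank ℝ F) => ℝ) α) ∘L
    (ContinuousLinearMap.fst ℝ (Fin (finrank ℝ F) → ℝ) ℝ) ∘L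
    (ContinuousLinearMap.snd ℝ (EuclideanSpace ℝ (Fin n)) ((Fin (finrank ℝ F) → ℝ) × ℝ)))
    (κ.mdifferentiableAt_hamCoords hp) v).symm

theorem tangentCoords_snd_snd (v : TangentSpace (hamModel n F) p) :
    (κ.tangentCoords p v).2.2 = mvfderiv (hamModel n F) (fun x : HamSpace F E => x.2) p v :=
  (mvfderiv_clm_comp ((ContinuousLinearMap.snd ℝ (Fin (finrank ℝ F) → ℝ) ℝ) ∘L
    (ContinuousLinearMap.snd ℝ (EuclideanSpace ℝ (Fin n)) ((Fin (finrank ℝ F) → ℝ) × ℝ)))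
    (κ.mdifferentiableAt_hamCoords hp) v).symm

theorem eventually_hamPoint_hamCoords : ∀ᶠ x : HamSpace F E in 𝓝 p, κ.hamPoint (κ.hamCoords x) = x :=
  (κ.eventually_mem_source_ham hp).mono fun _ hx => κ.hamPoint_hamCoords hx

theorem mdifferentiableAt_hamPoint : MDifferentiableAt 𝓘(ℝ, CoordSpace n F) (hamModel n F)
    (κ.hamPoint (E := E)) (κ.hamCoords p) :=
  (κ.contMDiffAt_hamPoint (κ.chart.map_source hp)).mdifferentiableAt (by simp)

theorem tangentCoords_prolVec (a b : Fin (finrank ℝ F) → ℝ) (r : ℝ) :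
    κ.tangentCoords p (κ.prolVec A p a b r).2 =
      (∑ α, a α • κ.anchorVec A α (hamProj F E p), b, r) :=
  mvfderiv_of_rightInverse (κ.mdifferentiableAt_hamCoords hp) (κ.mdifferentiableAt_hamPoint hp)
    (κ.hamPoint_hamCoords hp)
    ((κ.eventually_mem_target (κ.chart.map_source hp)).mono fun _ hz => κ.hamCoords_hamPoint hz) _

theorem coeff_prolVec (a b : Fin (finrank ℝ F) → ℝ) (r : ℝ) (α : Fin (finrank ℝ F)) :
    κ.coeff α (hamProj F E p) (κ.prolVec A p a b r).1 = a α :=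
  κ.coeff_sum_smul hp a α

theorem prolVec_mem (a b : Fin (finrank ℝ F) → ℝ) (r : ℝ) :
    κ.prolVec A p a b r ∈ prolFiber (hamModel n F) A (hamProj F E) p := by
  refine κ.mvfderiv_chart_injective hp (Eq.trans ?_ (κ.tangentCoords_fst hp _))
  rw [κ.tangentCoords_prolVec A hp]
  simp only [prolVec, map_sum, map_smul, anchorVec]

theorem tangentCoords_fst_of_mem {z : E (hamProj F E p) × TangentSpace (hamModel n F) p}
    (hz : z ∈ prolFiber (hamModel n F) A (hamProj F E) p) :
    (κ.tangentCoords p z.2).1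
      = ∑ α, κ.coeff α (hamProj F E p) z.1 • κ.anchorVec A α (hamProj F E p) := by
  have h : A.anchor (hamProj F E p) z.1 = mfderiv (hamModel n F) (𝓡 n) (hamProj F E) p z.2 := hz
  rw [κ.tangentCoords_fst hp, ← h]
  conv_lhs => rw [← κ.sum_coeff_smul hp z.1]
  simp only [map_sum, map_smul, anchorVec]

/-- The `q`-components of the velocity are forced by the anchor of the first entry, so `(a, b, r)`
are complete coordinates on the fibre of the prolongation; `prolVec_mem` shows that they are also
free. -/
theorem eq_prolVec {z : E (hamProj F E p) × TangentSpace (hamModel n F) p}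
    (hz : z ∈ prolFiber (hamModel n F) A (hamProj F E) p) :
    z = κ.prolVec A p (fun α => κ.coeff α (hamProj F E p) z.1) (κ.tangentCoords p z.2).2.1
      (κ.tangentCoords p z.2).2.2 := by
  refine Prod.ext (κ.sum_coeff_smul hp z.1).symm ?_
  have h := mfderiv_of_leftInverse (κ.mdifferentiableAt_hamCoords hp)
    (κ.mdifferentiableAt_hamPoint hp) (κ.eventually_hamPoint_hamCoords hp) z.2
  have h2 : mvfderiv (hamModel n F) κ.hamCoords p z.2 =
    ((∑ α, κ.coeff α (hamProj F E p) z.1 • κ.anchorVec A α (hamProj F E p),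
      (κ.tangentCoords p z.2).2.1, (κ.tangentCoords p z.2).2.2) : CoordSpace n F) :=
    Prod.ext (κ.tangentCoords_fst_of_mem A hp hz) rfl
  exact h.symm.trans (congrArg _ h2)

theorem contMDiffAt_anchorVec (α : Fin (finrank ℝ F)) :
    ContMDiffAt (𝓡 n) (𝓡 n) ∞ (κ.anchorVec A α) (hamProj F E p) := by
  refine contMDiffAt_mvfderiv_apply (b := id) κ.chart.open_source
    (fun x hx => (κ.contMDiffAt_chart hx).contMDiffWithinAt) hp ?_
  exact (A.contMDiff_anchor _).comp _
    ((κ.isLocalFrameOn.contMDiffOn α).contMDiffAt (κ.chart.open_source.mem_nhds hp))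

/-- Smooth coordinates yield smoothness of both entries of a section. This serves the cut-off
sections of `exists_prolSec_eq` and the glued solution of `existsUnique_prolSec`. -/
theorem contMDiffAt_prolVec {a b : HamSpace F E → Fin (finrank ℝ F) → ℝ} {r : HamSpace F E → ℝ}
    (ha : ContMDiffAt (hamModel n F) 𝓘(ℝ, Fin (finrank ℝ F) → ℝ) ∞ a p)
    (hb : ContMDiffAt (hamModel n F) 𝓘(ℝ, Fin (finrank ℝ F) → ℝ) ∞ b p)
    (hr : ContMDiffAt (hamModel n F) 𝓘(ℝ, ℝ) ∞ r p) :
    ContMDiffAt (hamModel n F) ((𝓡 n).prod 𝓘(ℝ, F)) ∞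
      (fun x => (⟨hamProj F E x, (κ.prolVec A x (a x) (b x) (r x)).1⟩ : TotalSpace F E)) p ∧
    ContMDiffAt (hamModel n F) (hamModel n F).tangent ∞
      (fun x => (⟨x, (κ.prolVec A x (a x) (b x) (r x)).2⟩ :
        TangentBundle (hamModel n F) (HamSpace F E))) p := by
  refine ⟨κ.contMDiffAt_sum_smul_frame contMDiff_hamProj.contMDiffAt hp ha, ?_⟩
  have hu : IsOpen {z : CoordSpace n F | z.1 ∈ κ.chart.target} :=
    κ.chart.open_target.preimage continuous_fst
  have hw : ContMDiffAt (hamModel n F) 𝓘(ℝ, CoordSpace n F) ∞ (fun x : HamSpace F E =>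
      ((∑ α, a x α • κ.anchorVec A α (hamProj F E x), b x, r x) : CoordSpace n F)) p := by
    refine ContMDiffAt.prodMk_space ?_ (hb.prodMk_space hr)
    refine ContMDiffAt.sum fun α _ => ?_
    exact (contMDiffAt_pi_space.1 ha α).smul
      ((κ.contMDiffAt_anchorVec A hp α).comp p contMDiff_hamProj.contMDiffAt)
  have hv : ContMDiffAt (hamModel n F) 𝓘(ℝ, CoordSpace n F).tangent ∞ (fun x : HamSpace F E =>
      (⟨κ.hamCoords x, ((∑ α, a x α • κ.anchorVec A α (hamProj F E x), b x, r x) : CoordSpace n F)⟩ :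
        TangentBundle 𝓘(ℝ, CoordSpace n F) (CoordSpace n F))) p :=
    (contMDiffAt_totalSpace (F := CoordSpace n F)).2 ⟨κ.contMDiffAt_hamCoords hp,
      hw.congr_of_eventuallyEq (Eventually.of_forall fun x => by
        simp only [trivializationAt_model_space_apply])⟩
  have h := contMDiffAt_mfderiv_apply hu
    (fun z hz => (κ.contMDiffAt_hamPoint (E := E) hz).contMDiffWithinAt)
    (κ.chart.map_source hp) hv
  refine h.congr_of_eventuallyEq ?_
  filter_upwards [κ.eventually_hamPoint_hamCoords hp] with x hx
  have key : ∀ (x' : HamSpace F E) (v : TangentSpace (hamModel n F) x'), x' = x →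
      (⟨x, v⟩ : TangentBundle (hamModel n F) (HamSpace F E)) = ⟨x', v⟩ := by
    rintro _ v rfl
    rfl
  exact key _ _ hx

end LocalCoords

end HamiltonSide

/-! ### The contact form of `E* × ℝ` is nondegenerate -/

section ContactForm

set_option linter.unusedSectionVars false

variable {n : ℕ} {Q : Type*} [TopologicalSpace Q] [ChartedSpace (EuclideanSpace ℝ (Fin n)) Q]
  [IsManifold (𝓡 n) ∞ Q] [T2Space Q]
  {F : Type*} [NormedAddCommGroup F] [NormedSpace ℝ F] [FiniteDimensional ℝ F]
  {E : Q → Type*} [∀ q, AddCommGroup (E q)] [∀ q, Module ℝ (E q)]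
  [∀ q, TopologicalSpace (E q)] [TopologicalSpace (TotalSpace F E)]
  [FiberBundle F E] [VectorBundle ℝ F E] [ContMDiffVectorBundle ∞ F E (𝓡 n)]
  (A : LieAlgebroid n F E)

variable {A} in
theorem ProlSec.ext {V H P : Type*} [NormedAddCommGroup V] [NormedSpace ℝ V] [TopologicalSpace H]
    {J : ModelWithCorners ℝ V H} [TopologicalSpace P] [ChartedSpace H P] [IsManifold J ∞ P]
    {pr : P → Q} {X Y : ProlSec J A pr} (h : ∀ p, X p = Y p) : X = Y := by
  obtain ⟨x, _, _, _⟩ := X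
  obtain ⟨y, _, _, _⟩ := Y
  obtain rfl : x = y := funext h
  rfl

/-- Every element of the prolongation is the value of a global section. -/
theorem exists_prolSec_eq {p : HamSpace F E}
    {z : E (hamProj F E p) × TangentSpace (hamModel n F) p}
    (hz : z ∈ prolFiber (hamModel n F) A (hamProj F E) p) :
    ∃ Z : ProlSec (hamModel n F) A (hamProj F E), Z p = z := by
  obtain ⟨κ, hp⟩ := exists_localCoords (n := n) (F := F) (E := E) (hamProj F E p)
  obtain ⟨f, hf, hfu⟩ := exists_bump n (κ.chart.open_source.mem_nhds hp)
  set a := fun α => κ.coeff α (hamProj F E p) z.1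
  set b := (κ.tangentCoords p z.2).2.1
  set r := (κ.tangentCoords p z.2).2.2
  have hfp : ∀ x : HamSpace F E, ContMDiffAt (hamModel n F) 𝓘(ℝ, ℝ) ∞
      (fun x : HamSpace F E => f (hamProj F E x)) x :=
    fun x => f.contMDiff.contMDiffAt.comp x contMDiff_hamProj.contMDiffAt
  -- The coordinates of `z` are extended as constants over the frame domain and multiplied by a bump
  -- function on `Q`; since `prolVec` is linear in them, the result extends by zero.
  let Z : ∀ x : HamSpace F E, E (hamProj F E x) × TangentSpace (hamModel n F) x := fun x =>
    κ.prolVec A x (f (hamProj F E x) • a) (f (hamProj F E x) • b) (f (hamProj F E x) • r)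
  have hZ0 : ∀ x, f (hamProj F E x) = 0 → Z x = 0 := by
    intro x hx
    refine Prod.ext ?_ ?_
    · simp [Z, LocalCoords.prolVec, hx]
    · have h0 : ((∑ α, (f (hamProj F E x) • a) α • κ.anchorVec A α (hamProj F E x),
          f (hamProj F E x) • b, f (hamProj F E x) • r) : CoordSpace n F) = 0 := by
        simp [hx]
      exact (congrArg (mfderiv 𝓘(ℝ, CoordSpace n F) (hamModel n F) (κ.hamPoint (E := E))
        (κ.hamCoords x)) h0).trans (ContinuousLinearMap.map_zero _)
  have hout : ∀ x, hamProj F E x ∉ κ.chart.source → ∀ᶠ y in 𝓝 x, Z y = 0 := by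
    intro x hx
    have hn : (tsupport f)ᶜ ∈ 𝓝 (hamProj F E x) :=
      (isClosed_tsupport f).isOpen_compl.mem_nhds fun h => hx (hfu h)
    filter_upwards [(contMDiff_hamProj (n := n)).continuous.continuousAt.eventually_mem hn] with y hy
    exact hZ0 y (image_eq_zero_of_notMem_tsupport hy)
  have hsm : ∀ x, hamProj F E x ∈ κ.chart.source → _ := fun x hx =>
    κ.contMDiffAt_prolVec A hx ((hfp x).smul (contMDiffAt_const (c := a)))
      ((hfp x).smul (contMDiffAt_const (c := b))) ((hfp x).smul (contMDiffAt_const (c := r)))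
  refine ⟨⟨Z, fun x => ?_, fun x => ?_, fun x => ?_⟩, ?_⟩
  · by_cases hx : hamProj F E x ∈ κ.chart.source
    · exact κ.prolVec_mem A hx _ _ _
    · rw [(hout x hx).self_of_nhds]
      exact Submodule.zero_mem _
  · by_cases hx : hamProj F E x ∈ κ.chart.source
    · exact (hsm x hx).1
    · have h0 : ContMDiffAt (hamModel n F) ((𝓡 n).prod 𝓘(ℝ, F)) ∞
          (fun x : HamSpace F E => (⟨hamProj F E x, (0 : E (hamProj F E x))⟩ : TotalSpace F E)) x :=
        ((contMDiff_zeroSection ℝ E).comp contMDiff_hamProj) x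
      refine h0.congr_of_eventuallyEq ?_
      filter_upwards [hout x hx] with y hy
      rw [hy]
      rfl
  · by_cases hx : hamProj F E x ∈ κ.chart.source
    · exact (hsm x hx).2
    · have h0 : ContMDiffAt (hamModel n F) (hamModel n F).tangent ∞
          (fun x : HamSpace F E => (⟨x, 0⟩ : TangentBundle (hamModel n F) (HamSpace F E))) x :=
        (contMDiff_zeroSection ℝ (TangentSpace (hamModel n F) (M := HamSpace F E))) x
      refine h0.congr_of_eventuallyEq ?_
      filter_upwards [hout x hx] with y hy
      rw [hy]
      rfl
  · have h1 : f (hamProj F E p) = 1 := hf.self_of_nhds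
    change κ.prolVec A p _ _ _ = z
    rw [h1, one_smul, one_smul, one_smul]
    exact (κ.eq_prolVec A hp hz).symm

theorem hamContact_apply (p : HamSpace F E) (z : E (hamProj F E p) × TangentSpace (hamModel n F) p) :
    hamContact n F E p z =
      mvfderiv (hamModel n F) (fun x : HamSpace F E => x.2) p z.2 - p.1.2 z.1 := rfl

/-! ### The contact equations as linear algebra in one fibre -/

namespace LocalCoords

variable (κ : LocalCoords n F E)

/-- The functions `C^γ_{αβ} y_γ`. -/
def dualBracket (α β : Fin (finrank ℝ F)) (p : HamSpace F E) : ℝ :=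
  p.1.2 (A.localBracket (κ.frame α) (κ.frame β) (hamProj F E p))

/-- The coordinate expression of the differential of the contact form. -/
def hamForm (p : HamSpace F E) (z w : E (hamProj F E p) × TangentSpace (hamModel n F) p) : ℝ :=
  ∑ α, (κ.coeff α (hamProj F E p) z.1 * (κ.tangentCoords p w.2).2.1 α
    - κ.coeff α (hamProj F E p) w.1 * (κ.tangentCoords p z.2).2.1 α)
  + ∑ α, ∑ β, κ.coeff α (hamProj F E p) z.1 * κ.coeff β (hamProj F E p) w.1 * κ.dualBracket A α β p

variable {p : HamSpace F E} (hp : hamProj F E p ∈ κ.chart.source)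
include hp

theorem contMDiffAt_covector_frame (α : Fin (finrank ℝ F)) :
    ContMDiffAt (hamModel n F) 𝓘(ℝ, ℝ) ∞
      (fun x : HamSpace F E => x.1.2 (κ.frame α (hamProj F E x))) p :=
  κ.contMDiffAt_apply_frame contMDiffAt_fst hp α

theorem extDeriv_hamContact (Z W : ProlSec (hamModel n F) A (hamProj F E)) :
    extDeriv (hamContact n F E) Z W p = κ.hamForm A p (Z p) (W p) := by
  rw [extDeriv_eq κ mdifferentiable_hamProj (s := fun x : HamSpace F E => x.2) contMDiff_snd
    (fun x => x.1.2) hamContact_apply Z W hp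
    fun α => (κ.contMDiffAt_covector_frame hp α).mdifferentiableAt (by simp)]
  simp only [hamForm, κ.tangentCoords_snd_fst hp]
  rfl

theorem hamContact_eq (z : E (hamProj F E p) × TangentSpace (hamModel n F) p) :
    hamContact n F E p z = (κ.tangentCoords p z.2).2.2
      - ∑ α, κ.coeff α (hamProj F E p) z.1 * p.1.2 (κ.frame α (hamProj F E p)) := by
  rw [hamContact_apply, κ.tangentCoords_snd_snd hp]
  congr 1
  conv_lhs => rw [← κ.sum_coeff_smul hp z.1]
  simp

/-- `localBracket` chooses extensions separately at each point. One pair of global extensions, valid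
near `p`, computes it at all nearby points, and the bracket of that pair is smooth. -/
theorem contMDiffAt_dualBracket (α β : Fin (finrank ℝ F)) :
    ContMDiffAt (hamModel n F) 𝓘(ℝ, ℝ) ∞ (κ.dualBracket A α β) p := by
  obtain ⟨s, hs⟩ := exists_extension (n := n) (F := F) (κ.frame α) κ.chart.open_source hp
    (κ.isLocalFrameOn.contMDiffOn α)
  obtain ⟨t, ht⟩ := exists_extension (n := n) (F := F) (κ.frame β) κ.chart.open_source hp
    (κ.isLocalFrameOn.contMDiffOn β)
  have h2 : ContMDiffAt (hamModel n F) ((𝓡 n).prod 𝓘(ℝ, F)) ∞ (fun x : HamSpace F E =>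
      (⟨hamProj F E x, A.bracket s t (hamProj F E x)⟩ : TotalSpace F E)) p :=
    (A.bracket s t).contMDiff.contMDiffAt.comp p contMDiff_hamProj.contMDiffAt
  have h3 := ContMDiffAt.clm_bundle_apply (F₂ := ℝ) (E₂ := Bundle.Trivial Q ℝ)
    (b := hamProj F E) (ϕ := fun x : HamSpace F E => x.1.2) (contMDiffAt_fst (p := p)) h2
  refine (contMDiffAt_totalSpace.1 h3).2.congr_of_eventuallyEq ?_
  filter_upwards [(contMDiff_hamProj (n := n)).continuous.continuousAt.eventually
    (hs.eventually_nhds.and ht.eventually_nhds)] with x hx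
  rw [dualBracket, A.localBracket_eq hx.1 hx.2]
  rfl

/-- The solution of `i_z η = h`, `i_z dη = u_α e^α + v^α dy_α` in coordinates. -/
def contactVec (p : HamSpace F E) (h : ℝ) (u v : Fin (finrank ℝ F) → ℝ) :
    E (hamProj F E p) × TangentSpace (hamModel n F) p :=
  κ.prolVec A p v (fun β => ∑ α, v α * κ.dualBracket A α β p - u β)
    (h + ∑ α, v α * p.1.2 (κ.frame α (hamProj F E p)))

theorem hamContact_contactVec (h : ℝ) (u v : Fin (finrank ℝ F) → ℝ) :
    hamContact n F E p (κ.contactVec A p h u v) = h := by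
  rw [contactVec, κ.hamContact_eq hp, κ.tangentCoords_prolVec A hp]
  simp only [κ.coeff_prolVec A hp]
  ring

/-- The structure terms in the `∂/∂y_β` component of `contactVec` are there to cancel the double sum
of `hamForm`. -/
theorem hamForm_contactVec (h : ℝ) (u v : Fin (finrank ℝ F) → ℝ)
    (w : E (hamProj F E p) × TangentSpace (hamModel n F) p) :
    κ.hamForm A p (κ.contactVec A p h u v) w =
      ∑ α, (κ.coeff α (hamProj F E p) w.1 * u α + (κ.tangentCoords p w.2).2.1 α * v α) := by
  rw [contactVec, hamForm, κ.tangentCoords_prolVec A hp]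
  simp only [κ.coeff_prolVec A hp]
  rw [Finset.sum_comm (f := fun α β => v α * κ.coeff β (hamProj F E p) w.1 * κ.dualBracket A α β p),
    ← Finset.sum_add_distrib]
  refine Finset.sum_congr rfl fun β _ => ?_
  rw [mul_sub, Finset.mul_sum]
  have : ∑ α, κ.coeff β (hamProj F E p) w.1 * (v α * κ.dualBracket A α β p)
      = ∑ α, v α * κ.coeff β (hamProj F E p) w.1 * κ.dualBracket A α β p :=
    Finset.sum_congr rfl fun α _ => by ring
  rw [this]
  ring

/-- This is the nondegeneracy of the contact form: `dη` fixes the coefficients `a` and `b`, and `η`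
fixes the remaining `ds` component. -/
theorem eq_contactVec {z : E (hamProj F E p) × TangentSpace (hamModel n F) p}
    (hz : z ∈ prolFiber (hamModel n F) A (hamProj F E) p) {h : ℝ} {u v : Fin (finrank ℝ F) → ℝ}
    (hh : hamContact n F E p z = h)
    (hw : ∀ w ∈ prolFiber (hamModel n F) A (hamProj F E) p, κ.hamForm A p z w =
      ∑ α, (κ.coeff α (hamProj F E p) w.1 * u α + (κ.tangentCoords p w.2).2.1 α * v α)) :
    z = κ.contactVec A p h u v := by
  have ha : ∀ α, κ.coeff α (hamProj F E p) z.1 = v α := by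
    intro α
    -- Testing against `∂/∂y_α` isolates the coefficient of `e_α` in `z`.
    have := hw _ (κ.prolVec_mem A hp 0 (Pi.single α 1) 0)
    rw [hamForm, κ.tangentCoords_prolVec A hp] at this
    simp only [κ.coeff_prolVec A hp] at this
    simpa [Pi.single_apply] using this
  have hb : ∀ β, (κ.tangentCoords p z.2).2.1 β = ∑ α, v α * κ.dualBracket A α β p - u β := by
    intro β
    -- Testing against the lift of `e_β` isolates the `∂/∂y_β` component, up to structure terms
    -- already known from `ha`.
    have := hw _ (κ.prolVec_mem A hp (Pi.single β 1) 0 0)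
    rw [hamForm, κ.tangentCoords_prolVec A hp] at this
    simp only [κ.coeff_prolVec A hp, ha] at this
    have h2 : -(κ.tangentCoords p z.2).2.1 β + ∑ α, v α * κ.dualBracket A α β p = u β := by
      simpa [Pi.single_apply] using this
    linarith
  rw [κ.hamContact_eq hp] at hh
  simp only [ha] at hh
  have hr : (κ.tangentCoords p z.2).2.2
      = h + ∑ α, v α * p.1.2 (κ.frame α (hamProj F E p)) := by
    linarith
  refine (κ.eq_prolVec A hp hz).trans ?_
  rw [contactVec, hr, funext ha, funext hb]

end LocalCoords

/-- In local coordinates, `θ = u_α e^α + v^α dy_α` on the prolongation, with smooth `u` and `v`. -/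
def IsSmoothSemibasic (θ : OneSec E (hamModel n F) (hamProj F E)) : Prop :=
  ∀ κ : LocalCoords n F E, ∃ u v : HamSpace F E → Fin (finrank ℝ F) → ℝ,
    ∀ p : HamSpace F E, hamProj F E p ∈ κ.chart.source →
      ContMDiffAt (hamModel n F) 𝓘(ℝ, Fin (finrank ℝ F) → ℝ) ∞ u p ∧
      ContMDiffAt (hamModel n F) 𝓘(ℝ, Fin (finrank ℝ F) → ℝ) ∞ v p ∧
      ∀ w ∈ prolFiber (hamModel n F) A (hamProj F E) p, θ p w =
        ∑ α, (κ.coeff α (hamProj F E p) w.1 * u p α + (κ.tangentCoords p w.2).2.1 α * v p α)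

/-! ### Gluing the local solutions -/

variable {A}

/-- A semibasic form has no `ds` term, so in each frame the system is solved by `contactVec` alone.
Uniqueness makes these solutions agree on overlaps. -/
theorem existsUnique_prolSec {θ : OneSec E (hamModel n F) (hamProj F E)}
    (hθ : IsSmoothSemibasic A θ) {h : HamSpace F E → ℝ}
    (hh : ContMDiff (hamModel n F) 𝓘(ℝ, ℝ) ∞ h) :
    ∃! X : ProlSec (hamModel n F) A (hamProj F E), (∀ p, hamContact n F E p (X p) = h p) ∧
      ∀ (Z : ProlSec (hamModel n F) A (hamProj F E)) p,
        extDeriv (hamContact n F E) X Z p = θ p (Z p) := by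
  choose u v huv using hθ
  have huniq : ∀ κ : LocalCoords n F E, ∀ p, hamProj F E p ∈ κ.chart.source →
      ∀ X : ProlSec (hamModel n F) A (hamProj F E), hamContact n F E p (X p) = h p →
      (∀ Z : ProlSec (hamModel n F) A (hamProj F E),
        extDeriv (hamContact n F E) X Z p = θ p (Z p)) →
      X p = κ.contactVec A p (h p) (u κ p) (v κ p) := by
    intro κ p hp X h1 h2
    -- Every vector of the fibre is the value of a global section, so the equation for all sections
    -- `Z` gives the equation for all test vectors at `p`.
    refine κ.eq_contactVec A hp (X.mem p) h1 fun w hw => ?_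
    obtain ⟨W, rfl⟩ := exists_prolSec_eq A hw
    rw [← κ.extDeriv_hamContact A hp, h2, (huv κ p hp).2.2 _ hw]
  have hsol : ∀ κ : LocalCoords n F E, ∀ p, hamProj F E p ∈ κ.chart.source →
      ∀ X : ProlSec (hamModel n F) A (hamProj F E),
      X p = κ.contactVec A p (h p) (u κ p) (v κ p) → hamContact n F E p (X p) = h p ∧
      ∀ Z : ProlSec (hamModel n F) A (hamProj F E),
        extDeriv (hamContact n F E) X Z p = θ p (Z p) := by
    intro κ p hp X hX
    refine ⟨hX ▸ κ.hamContact_contactVec A hp _ _ _, fun Z => ?_⟩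
    rw [κ.extDeriv_hamContact A hp, hX, κ.hamForm_contactVec A hp, (huv κ p hp).2.2 _ (Z.mem p)]
  choose κ hκ using fun p : HamSpace F E =>
    exists_localCoords (n := n) (F := F) (E := E) (hamProj F E p)
  let X₀ : ∀ p : HamSpace F E, E (hamProj F E p) × TangentSpace (hamModel n F) p :=
    fun p => (κ p).contactVec A p (h p) (u (κ p) p) (v (κ p) p)
  have hmem : ∀ p, X₀ p ∈ prolFiber (hamModel n F) A (hamProj F E) p :=
    fun p => (κ p).prolVec_mem A (hκ p) _ _ _
  -- The solution computed in the chart chosen at `p` is the same in any other chart. Hence near `p`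
  -- a single chart describes `X₀`, and smoothness can be checked there.
  have hX₀ : ∀ (κ' : LocalCoords n F E) (p : HamSpace F E), hamProj F E p ∈ κ'.chart.source →
      X₀ p = κ'.contactVec A p (h p) (u κ' p) (v κ' p) := by
    intro κ' p hp
    obtain ⟨X, hX⟩ := exists_prolSec_eq A (hmem p)
    obtain ⟨h1, h2⟩ := hsol (κ p) p (hκ p) X hX
    exact hX.symm.trans (huniq κ' p hp X h1 h2)
  have hsm : ∀ p, ContMDiffAt (hamModel n F) ((𝓡 n).prod 𝓘(ℝ, F)) ∞
      (fun x => (⟨hamProj F E x, (X₀ x).1⟩ : TotalSpace F E)) p ∧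
    ContMDiffAt (hamModel n F) (hamModel n F).tangent ∞
      (fun x => (⟨x, (X₀ x).2⟩ : TangentBundle (hamModel n F) (HamSpace F E))) p := by
    intro p
    obtain ⟨hu, hv, -⟩ := huv (κ p) p (hκ p)
    have hv' := contMDiffAt_pi_space.1 hv
    have hb : ContMDiffAt (hamModel n F) 𝓘(ℝ, Fin (finrank ℝ F) → ℝ) ∞
        (fun (x : HamSpace F E) β =>
          ∑ α, v (κ p) x α * (κ p).dualBracket A α β x - u (κ p) x β) p :=
      contMDiffAt_pi_space.2 fun β => (ContMDiffAt.sum fun α _ => (hv' α).mul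
        ((κ p).contMDiffAt_dualBracket A (hκ p) α β)).sub (contMDiffAt_pi_space.1 hu β)
    have hr : ContMDiffAt (hamModel n F) 𝓘(ℝ, ℝ) ∞ (fun x : HamSpace F E =>
          h x + ∑ α, v (κ p) x α * x.1.2 ((κ p).frame α (hamProj F E x))) p :=
      (hh p).add (ContMDiffAt.sum fun α _ => (hv' α).mul
        ((κ p).contMDiffAt_covector_frame (hκ p) α))
    have hc := (κ p).contMDiffAt_prolVec A (hκ p) hv hb hr
    have hev := ((κ p).eventually_mem_source_ham (hκ p)).mono fun x hx => hX₀ (κ p) x hx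
    refine ⟨hc.1.congr_of_eventuallyEq ?_, hc.2.congr_of_eventuallyEq ?_⟩ <;>
    · filter_upwards [hev] with x hx
      rw [hx]
      rfl
  let X : ProlSec (hamModel n F) A (hamProj F E) :=
    ⟨X₀, hmem, fun p => (hsm p).1, fun p => (hsm p).2⟩
  refine ⟨X, ⟨fun p => (hsol (κ p) p (hκ p) X rfl).1,
    fun Z p => (hsol (κ p) p (hκ p) X rfl).2 Z⟩, fun Y hY => ?_⟩
  exact ProlSec.ext fun p => huniq (κ p) p (hκ p) Y (hY.1 p) fun Z => hY.2 Z p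

end ContactForm

/-! ### The Hamiltonian section -/

section HamiltonianSection

set_option linter.unusedSectionVars false

variable {n : ℕ} {Q : Type*} [TopologicalSpace Q] [ChartedSpace (EuclideanSpace ℝ (Fin n)) Q]
  [IsManifold (𝓡 n) ∞ Q] [T2Space Q]
  {F : Type*} [NormedAddCommGroup F] [NormedSpace ℝ F] [FiniteDimensional ℝ F]
  {E : Q → Type*} [∀ q, AddCommGroup (E q)] [∀ q, Module ℝ (E q)]
  [∀ q, TopologicalSpace (E q)] [TopologicalSpace (TotalSpace F E)]
  [FiberBundle F E] [VectorBundle ℝ F E] [ContMDiffVectorBundle ∞ F E (𝓡 n)]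
  {A : LieAlgebroid n F E}

/-- The case `θ = 0`, `h = 1` of the general system. -/
theorem existsUnique_isReeb :
    ∃! R : ProlSec (hamModel n F) A (hamProj F E), IsReeb (hamContact n F E) R := by
  have h0 : IsSmoothSemibasic A (0 : OneSec E (hamModel n F) (hamProj F E)) := fun κ =>
    ⟨fun _ => 0, fun _ => 0, fun p _ => ⟨contMDiffAt_const, contMDiffAt_const, fun w _ => by simp⟩⟩
  refine (existsUnique_congr fun R => ?_).1 (existsUnique_prolSec h0 (h := fun _ => 1) contMDiff_const)
  exact and_comm

/-- The Reeb section is `∂/∂s`. -/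
theorem IsReeb.eq_prolVec {R : ProlSec (hamModel n F) A (hamProj F E)}
    (hR : IsReeb (hamContact n F E) R) (κ : LocalCoords n F E) {p : HamSpace F E}
    (hp : hamProj F E p ∈ κ.chart.source) : R p = κ.prolVec A p 0 0 1 := by
  have h : R p = κ.contactVec A p 1 0 0 := by
    refine κ.eq_contactVec A hp (R.mem p) (hR.2 p) fun w hw => ?_
    obtain ⟨W, rfl⟩ := exists_prolSec_eq A hw
    rw [← κ.extDeriv_hamContact A hp, hR.1]
    simp
  rw [h, LocalCoords.contactVec]
  congr 1 <;> simp
  rfl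

namespace LocalCoords

variable (κ : LocalCoords n F E) {p : HamSpace F E} (hp : hamProj F E p ∈ κ.chart.source)
include hp

theorem mvfderiv_eq_sum_partial {H : HamSpace F E → ℝ}
    (hH : ContMDiff (hamModel n F) 𝓘(ℝ, ℝ) ∞ H) (v : TangentSpace (hamModel n F) p) :
    mvfderiv (hamModel n F) H p v =
      ∑ i, (κ.tangentCoords p v).1 i * partialQ (fun w => H (κ.hamPoint w)) i (κ.hamCoords p)
      + ∑ α, (κ.tangentCoords p v).2.1 α * partialY (fun w => H (κ.hamPoint w)) α (κ.hamCoords p)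
      + (κ.tangentCoords p v).2.2 * partialS (fun w => H (κ.hamPoint w)) (κ.hamCoords p) :=
  (mvfderiv_eq_fderiv_comp (hH.mdifferentiable (by simp) p) (κ.mdifferentiableAt_hamCoords hp)
    (κ.mdifferentiableAt_hamPoint hp) (κ.eventually_hamPoint_hamCoords hp) v).trans
    (fderiv_eq_sum_partial _ _ _)

theorem contDiffAt_comp_hamPoint {H : HamSpace F E → ℝ}
    (hH : ContMDiff (hamModel n F) 𝓘(ℝ, ℝ) ∞ H) :
    ContDiffAt ℝ ∞ (fun w => H (κ.hamPoint w)) (κ.hamCoords p) :=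
  (hH.contMDiffAt.comp _ (κ.contMDiffAt_hamPoint (κ.chart.map_source hp))).contDiffAt

theorem _root_.ContactAlgebroid.IsReeb.deriv_eq {R : ProlSec (hamModel n F) A (hamProj F E)}
    (hR : IsReeb (hamContact n F E) R) {H : HamSpace F E → ℝ}
    (hH : ContMDiff (hamModel n F) 𝓘(ℝ, ℝ) ∞ H) :
    R.deriv H p = partialS (fun w => H (κ.hamPoint w)) (κ.hamCoords p) := by
  rw [ProlSec.deriv, ProlSec.vectorField, κ.mvfderiv_eq_sum_partial hp hH, hR.eq_prolVec κ hp,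
    κ.tangentCoords_prolVec A hp]
  simp

end LocalCoords

/-- The coefficient of `ds` in `dH` is `∂H/∂s = R(H)`, which `R(H) η` cancels. Its part `-y_α e^α`
contributes to `u_α = ρ^i_α ∂H/∂q^i + y_α ∂H/∂s`, while `v^α = ∂H/∂y_α`. -/
theorem isSmoothSemibasic_sub {R : ProlSec (hamModel n F) A (hamProj F E)}
    (hR : IsReeb (hamContact n F E) R) {H : HamSpace F E → ℝ}
    (hH : ContMDiff (hamModel n F) 𝓘(ℝ, ℝ) ∞ H) :
    IsSmoothSemibasic A (fun p => (mvfderiv (hamModel n F) H p).toLinearMap ∘ₗ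
      LinearMap.snd ℝ (E (hamProj F E p)) (TangentSpace (hamModel n F) p)
      - R.deriv H p • hamContact n F E p) := by
  intro κ
  set H' : CoordSpace n F → ℝ := fun w => H (κ.hamPoint w) with hH'
  refine ⟨fun p α => ∑ i, κ.anchorVec A α (hamProj F E p) i * partialQ H' i (κ.hamCoords p)
      + partialS H' (κ.hamCoords p) * p.1.2 (κ.frame α (hamProj F E p)),
    fun p α => partialY H' α (κ.hamCoords p), fun p hp => ⟨?_, ?_, fun w hw => ?_⟩⟩
  · have hd := κ.contDiffAt_comp_hamPoint hp hH
    have hc := κ.contMDiffAt_hamCoords hp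
    refine contMDiffAt_pi_space.2 fun α => ContMDiffAt.add (ContMDiffAt.sum fun i _ => ?_) ?_
    · refine ContMDiffAt.mul ?_ ((contDiffAt_partialQ hd i).contMDiffAt.comp p hc)
      have h1 := (κ.contMDiffAt_anchorVec A hp α).comp p contMDiff_hamProj.contMDiffAt
      exact (EuclideanSpace.proj (𝕜 := ℝ) i).contMDiff.contMDiffAt.comp p h1
    · exact ((contDiffAt_partialS hd).contMDiffAt.comp p hc).mul (κ.contMDiffAt_covector_frame hp α)
  · exact contMDiffAt_pi_space.2 fun α => (contDiffAt_partialY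
      (κ.contDiffAt_comp_hamPoint hp hH) α).contMDiffAt.comp p (κ.contMDiffAt_hamCoords hp)
  · change mvfderiv (hamModel n F) H p w.2 - R.deriv H p * hamContact n F E p w = _
    rw [κ.mvfderiv_eq_sum_partial hp hH, hR.deriv_eq κ hp hH, κ.hamContact_eq hp,
      κ.tangentCoords_fst_of_mem A hp hw]
    have h1 : ∑ i, (∑ α, κ.coeff α (hamProj F E p) w.1 • κ.anchorVec A α (hamProj F E p)) i
          * partialQ H' i (κ.hamCoords p)
        = ∑ α, κ.coeff α (hamProj F E p) w.1
          * ∑ i, κ.anchorVec A α (hamProj F E p) i * partialQ H' i (κ.hamCoords p) := by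
      simp only [Finset.mul_sum]
      rw [Finset.sum_comm]
      refine Finset.sum_congr rfl fun i _ => ?_
      simp [Finset.sum_mul, mul_assoc]
    have h2 : ∑ α, κ.coeff α (hamProj F E p) w.1
          * (partialS H' (κ.hamCoords p) * p.1.2 (κ.frame α (hamProj F E p)))
        = partialS H' (κ.hamCoords p)
          * ∑ α, κ.coeff α (hamProj F E p) w.1 * p.1.2 (κ.frame α (hamProj F E p)) := by
      rw [Finset.mul_sum]
      exact Finset.sum_congr rfl fun α _ => by ring
    rw [h1]
    simp only [mul_add, Finset.sum_add_distrib]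
    rw [h2]
    ring

/-- `IsContactSection` only asks for some Reeb section; uniqueness of the Reeb section turns it into
a single system with a fixed right-hand side. -/
theorem existsUnique_isHamiltonianSection {H : HamSpace F E → ℝ}
    (hH : ContMDiff (hamModel n F) 𝓘(ℝ, ℝ) ∞ H) : ∃! ξ, IsHamiltonianSection A H ξ := by
  obtain ⟨R, hR, hR'⟩ := existsUnique_isReeb (A := A)
  refine (existsUnique_congr fun ξ => ?_).1
    (existsUnique_prolSec (isSmoothSemibasic_sub hR hH) hH.neg)
  refine and_congr Iff.rfl ⟨fun h => ⟨R, hR, h⟩, ?_⟩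
  rintro ⟨R', hR'', h⟩
  obtain rfl := hR' R' hR''
  exact h

end HamiltonianSection

/-! ### The Legendre transformation relates the two contact forms -/

section Transport

set_option linter.unusedSectionVars false

theorem mfderiv_leftInverse {V H P V' H' P' : Type*} [NormedAddCommGroup V] [NormedSpace ℝ V]
    [TopologicalSpace H] {J : ModelWithCorners ℝ V H} [TopologicalSpace P] [ChartedSpace H P]
    [NormedAddCommGroup V'] [NormedSpace ℝ V'] [TopologicalSpace H'] {J' : ModelWithCorners ℝ V' H'}
    [TopologicalSpace P'] [ChartedSpace H' P'] {f : P → P'} {g : P' → P}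
    (hf : MDifferentiable J J' f) (hg : MDifferentiable J' J g) (h : Function.LeftInverse g f)
    (p : P) (v : V) : (mfderiv J' J g (f p) (mfderiv J J' f p v) : V) = v := by
  have h1 := mfderiv_comp_apply p (hg (f p)) (hf p) v
  have h2 : mfderiv J J (g ∘ f) p v = v := by
    rw [h.comp_eq_id, mfderiv_id]
    rfl
  exact h1.symm.trans h2

variable {n : ℕ} {Q : Type*} [TopologicalSpace Q] [ChartedSpace (EuclideanSpace ℝ (Fin n)) Q]
  [IsManifold (𝓡 n) ∞ Q] [T2Space Q]
  {F : Type*} [NormedAddCommGroup F] [NormedSpace ℝ F] [FiniteDimensional ℝ F]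
  {E : Q → Type*} [∀ q, AddCommGroup (E q)] [∀ q, Module ℝ (E q)]
  [∀ q, TopologicalSpace (E q)] [TopologicalSpace (TotalSpace F E)]
  [FiberBundle F E] [VectorBundle ℝ F E] [ContMDiffVectorBundle ∞ F E (𝓡 n)]
  {A : LieAlgebroid n F E} (L : Lagrangian n F E)

theorem mdifferentiable_lagProj : MDifferentiable (lagModel n F) (𝓡 n) (lagProj F E) :=
  ((contMDiff_proj E).comp contMDiff_fst : ContMDiff (lagModel n F) (𝓡 n) ∞ (lagProj F E)).mdifferentiable
    (by simp)

/-- By the chain rule `dL(a^V)` is the fibre derivative of `L`. This puts `η_L` in the form `ds - λ`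
of `extDeriv_eq`, with `λ` the Legendre covector. -/
theorem lagContact_apply (p : LagSpace F E) (z : E (lagProj F E p) × TangentSpace (lagModel n F) p) :
    lagContact L p z =
      mvfderiv (lagModel n F) (fun x : LagSpace F E => x.2) p z.2 - legendreCovector L p z.1 := by
  have h := deriv_fiberLine L p z.1
  exact congrArg (fun t => mvfderiv (lagModel n F) (fun x : LagSpace F E => x.2) p z.2 - t) h.symm

variable {L} (Leg : Diffeomorph (lagModel n F) (hamModel n F) (LagSpace F E) (HamSpace F E) ∞)
  (hLeg : ∀ p, Leg p = legendre L p)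

variable (L) in
/-- The sections `Z` and `W` are related by the prolonged Legendre transformation. -/
def LegendreRelated (Z : ProlSec (lagModel n F) A (lagProj F E))
    (W : ProlSec (hamModel n F) A (hamProj F E)) : Prop :=
  ∀ p, W (legendre L p) = prolLegendre L p (Z p)

include hLeg

theorem contMDiff_legendre : ContMDiff (lagModel n F) (hamModel n F) ∞ (legendre L) :=
  (funext hLeg : ⇑Leg = legendre L) ▸ Leg.contMDiff

theorem mdifferentiable_legendre : MDifferentiable (lagModel n F) (hamModel n F) (legendre L) :=
  (contMDiff_legendre Leg hLeg).mdifferentiable (by simp)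

theorem mfderiv_lagProj (p : LagSpace F E) (v : TangentSpace (lagModel n F) p) :
    (mfderiv (lagModel n F) (𝓡 n) (lagProj F E) p v : EuclideanSpace ℝ (Fin n)) =
      mfderiv (hamModel n F) (𝓡 n) (hamProj F E) (legendre L p)
        (mfderiv (lagModel n F) (hamModel n F) (legendre L) p v) :=
  mfderiv_comp_apply p (mdifferentiable_hamProj (legendre L p)) (mdifferentiable_legendre Leg hLeg p) v

/-- The Legendre transformation covers the identity of `Q`, so the projected velocity and the
`E`-component are both unchanged. -/
theorem prolLegendre_mem_iff {p : LagSpace F E}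
    {z : E (lagProj F E p) × TangentSpace (lagModel n F) p} :
    prolLegendre L p z ∈ prolFiber (hamModel n F) A (hamProj F E) (legendre L p) ↔
      z ∈ prolFiber (lagModel n F) A (lagProj F E) p := by
  have h := mfderiv_lagProj Leg hLeg p z.2
  exact ⟨fun hz => Eq.trans hz h.symm, fun hz => Eq.trans hz h⟩

theorem prolLegendre_injective (p : LagSpace F E) :
    Function.Injective (prolLegendre L p) := by
  intro z w h
  have h1 := mfderiv_leftInverse (mdifferentiable_legendre Leg hLeg)
    (Leg.symm.contMDiff.mdifferentiable (by simp)) (fun x => by rw [← hLeg]; simp) p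
  obtain ⟨hfst, hsnd⟩ := Prod.ext_iff.1 h
  exact Prod.ext hfst (((h1 z.2).symm.trans
    (congrArg (mfderiv (hamModel n F) (lagModel n F) Leg.symm (legendre L p))
      hsnd)).trans (h1 w.2))

/-- Both covector terms are `legendreCovector L p` applied to `z.1`, and the `ds` terms agree
because the function `s` is preserved. -/
theorem lagContact_eq_hamContact (p : LagSpace F E)
    (z : E (lagProj F E p) × TangentSpace (lagModel n F) p) :
    lagContact L p z = hamContact n F E (legendre L p) (prolLegendre L p z) := by
  rw [lagContact_apply, hamContact_apply]
  congr 1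
  exact mvfderiv_comp_map (g := fun x : HamSpace F E => x.2) (f := legendre L)
    mdifferentiableAt_snd (mdifferentiable_legendre Leg hLeg p) z.2

theorem exists_legendreRelated_left (W : ProlSec (hamModel n F) A (hamProj F E)) :
    ∃ Z, LegendreRelated L Z W := by
  have hmd := mdifferentiable_legendre Leg hLeg
  have hleft : Function.LeftInverse Leg.symm (legendre L) := fun x => by rw [← hLeg]; simp
  have hright : Function.LeftInverse (legendre L) Leg.symm := fun x => by rw [← hLeg]; simp
  let v : ∀ p : LagSpace F E, TangentSpace (lagModel n F) p := fun p =>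
    mfderiv (hamModel n F) (lagModel n F) Leg.symm (legendre L p) (W (legendre L p)).2
  have hv : ∀ p, mfderiv (lagModel n F) (hamModel n F) (legendre L) p (v p)
      = (W (legendre L p)).2 := by
    intro p
    have key : ∀ (p' : LagSpace F E) (u : (EuclideanSpace ℝ (Fin n) × F) × ℝ), p' = p →
        (mfderiv (lagModel n F) (hamModel n F) (legendre L) p u :
          (EuclideanSpace ℝ (Fin n) × (F →L[ℝ] ℝ)) × ℝ)
        = mfderiv (lagModel n F) (hamModel n F) (legendre L) p' u := by
      rintro _ u rfl
      rfl
    exact (key _ _ (hleft p)).trans (mfderiv_leftInverse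
      (Leg.symm.contMDiff.mdifferentiable (by simp)) hmd hright (legendre L p) _)
  have hWz : ∀ p, W (legendre L p) = prolLegendre L p ((W (legendre L p)).1, v p) :=
    fun p => Prod.ext rfl (hv p).symm
  refine ⟨⟨fun p => ((W (legendre L p)).1, v p), fun p => ?_, ?_, fun p => ?_⟩, hWz⟩
  · exact (prolLegendre_mem_iff Leg hLeg).1 (hWz p ▸ W.mem (legendre L p))
  · exact W.contMDiff_fst.comp (contMDiff_legendre Leg hLeg)
  · have h := contMDiffAt_mfderiv_apply isOpen_univ Leg.symm.contMDiff.contMDiffOn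
      (b := legendre L) (x := p) (mem_univ _)
      (W.contMDiff_snd.comp (contMDiff_legendre Leg hLeg)).contMDiffAt
    refine h.congr_of_eventuallyEq (Eventually.of_forall fun x => ?_)
    have key : ∀ (x' : LagSpace F E) (u : TangentSpace (lagModel n F) x'), x' = x →
        (⟨x, u⟩ : TangentBundle (lagModel n F) (LagSpace F E)) = ⟨x', u⟩ := by
      rintro _ u rfl
      rfl
    exact key _ _ (hleft x)

theorem exists_legendreRelated_right (Z : ProlSec (lagModel n F) A (lagProj F E)) :
    ∃ W, LegendreRelated L Z W := by
  have hleft : Function.LeftInverse Leg.symm (legendre L) := fun x => by rw [← hLeg]; simp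
  have hright : Function.LeftInverse (legendre L) Leg.symm := fun x => by rw [← hLeg]; simp
  -- The pushed-forward vector sits over `legendre L p`, which is equal to `x` but indexes a
  -- different fibre; the pair with its base point keeps track of the identification.
  have hex : ∀ x : HamSpace F E, ∃ w ∈ prolFiber (hamModel n F) A (hamProj F E) x,
      ∀ p, legendre L p = x → (⟨x, w⟩ : Σ x : HamSpace F E,
        E (hamProj F E x) × TangentSpace (hamModel n F) x)
        = ⟨legendre L p, prolLegendre L p (Z p)⟩ := by
    intro x
    obtain ⟨p, rfl⟩ := hright.surjective x
    refine ⟨prolLegendre L p (Z p), (prolLegendre_mem_iff Leg hLeg).2 (Z.mem p), fun p' hp' => ?_⟩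
    obtain rfl := hleft.injective hp'
    rfl
  choose W hW hWZ using hex
  refine ⟨⟨W, hW, ?_, ?_⟩, fun p => eq_of_heq (Sigma.mk.inj (hWZ _ p rfl)).2⟩
  · refine (Z.contMDiff_fst.comp Leg.symm.contMDiff).congr fun x => ?_
    exact congrArg (fun y : Σ x : HamSpace F E, E (hamProj F E x) × TangentSpace (hamModel n F) x =>
      (⟨hamProj F E y.1, y.2.1⟩ : TotalSpace F E)) (hWZ x _ (hright x))
  · have h : ContMDiff (hamModel n F) (hamModel n F).tangent ∞ (fun x : HamSpace F E =>
        (⟨legendre L (Leg.symm x), mfderiv (lagModel n F) (hamModel n F) (legendre L) (Leg.symm x)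
          (Z (Leg.symm x)).2⟩ : TangentBundle (hamModel n F) (HamSpace F E))) := fun x =>
      contMDiffAt_mfderiv_apply isOpen_univ (contMDiff_legendre Leg hLeg).contMDiffOn
        (b := Leg.symm) (mem_univ _) (Z.contMDiff_snd.comp Leg.symm.contMDiff).contMDiffAt
    refine h.congr fun x => ?_
    exact congrArg (fun y : Σ x : HamSpace F E, E (hamProj F E x) × TangentSpace (hamModel n F) x =>
      (⟨y.1, y.2.2⟩ : TangentBundle (hamModel n F) (HamSpace F E))) (hWZ x _ (hright x))

/-! ### Transport of the contact equations along related sections -/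

namespace LegendreRelated

variable {Z Z' : ProlSec (lagModel n F) A (lagProj F E)}
  {W W' : ProlSec (hamModel n F) A (hamProj F E)}

theorem left_unique (h : LegendreRelated L Z W) (h' : LegendreRelated L Z' W) : Z = Z' :=
  ProlSec.ext fun p => prolLegendre_injective Leg hLeg p ((h p).symm.trans (h' p))

theorem deriv_eq (h : LegendreRelated L Z W) {f : HamSpace F E → ℝ}
    (hf : ContMDiff (hamModel n F) 𝓘(ℝ, ℝ) ∞ f) (p : LagSpace F E) :
    Z.deriv (f ∘ legendre L) p = W.deriv f (legendre L p) := by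
  rw [ProlSec.deriv, ProlSec.deriv, ProlSec.vectorField, ProlSec.vectorField, h p]
  exact mvfderiv_comp_map (hf.mdifferentiable (by simp) _) (mdifferentiable_legendre Leg hLeg p) _

theorem contact_eq (h : LegendreRelated L Z W) (p : LagSpace F E) :
    lagContact L p (Z p) = hamContact n F E (legendre L p) (W (legendre L p)) := by
  rw [h p, lagContact_eq_hamContact Leg hLeg]

/-- Both sides are evaluated in one frame of `E`. Related sections have equal coefficients there,
and the components of the Legendre covector are those of `Θ` composed with `legendre L`, so the
chain rule matches the derivative terms. -/
theorem extDeriv_eq (h : LegendreRelated L Z W) (h' : LegendreRelated L Z' W') (p : LagSpace F E) :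
    extDeriv (lagContact L) Z Z' p = extDeriv (hamContact n F E) W W' (legendre L p) := by
  obtain ⟨κ, hp⟩ := exists_localCoords (n := n) (F := F) (E := E) (lagProj F E p)
  have hmd := mdifferentiable_legendre Leg hLeg
  have hc : ∀ α, MDifferentiableAt (hamModel n F) 𝓘(ℝ, ℝ)
      (fun x : HamSpace F E => x.1.2 (κ.frame α (hamProj F E x))) (legendre L p) :=
    fun α => (κ.contMDiffAt_covector_frame (p := legendre L p) hp α).mdifferentiableAt (by simp)
  have hl : ∀ α, MDifferentiableAt (lagModel n F) 𝓘(ℝ, ℝ)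
      (fun x : LagSpace F E => legendreCovector L x (κ.frame α (lagProj F E x))) p :=
    fun α => (hc α).comp p (hmd p)
  have hd : ∀ α (v : TangentSpace (lagModel n F) p), mvfderiv (lagModel n F)
      (fun x : LagSpace F E => legendreCovector L x (κ.frame α (lagProj F E x))) p v
      = mvfderiv (hamModel n F) (fun x : HamSpace F E => x.1.2 (κ.frame α (hamProj F E x)))
        (legendre L p) (mfderiv (lagModel n F) (hamModel n F) (legendre L) p v) :=
    fun α v => mvfderiv_comp_map (hc α) (hmd p) v
  have hcf : ∀ {Z : ProlSec (lagModel n F) A (lagProj F E)}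
      {W : ProlSec (hamModel n F) A (hamProj F E)}, LegendreRelated L Z W → ∀ α,
      W.coeff κ α (legendre L p) = Z.coeff κ α p := by
    intro Z W h α
    rw [ProlSec.coeff, h p]
    rfl
  rw [ContactAlgebroid.extDeriv_eq κ mdifferentiable_lagProj (s := fun x : LagSpace F E => x.2)
      contMDiff_snd (legendreCovector L) (lagContact_apply L) Z Z' hp hl,
    ContactAlgebroid.extDeriv_eq κ mdifferentiable_hamProj (s := fun x : HamSpace F E => x.2)
      contMDiff_snd (fun x => x.1.2) hamContact_apply W W' (p := legendre L p) hp hc]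
  simp only [hcf h, hcf h', hd]
  rw [h p, h' p]
  rfl

/-- The test sections on either side are exactly those related to test sections on the other, so the
quantifiers transfer. -/
theorem isReeb_iff (h : LegendreRelated L Z W) :
    IsReeb (lagContact L) Z ↔ IsReeb (hamContact n F E) W := by
  have hright : Function.LeftInverse (legendre L) Leg.symm := fun x => by rw [← hLeg]; simp
  constructor
  · rintro ⟨h1, h2⟩
    constructor
    · intro W' x
      obtain ⟨p, rfl⟩ := hright.surjective x
      obtain ⟨Z', h'⟩ := exists_legendreRelated_left Leg hLeg W'
      rw [← h.extDeriv_eq Leg hLeg h', h1]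
    · intro x
      obtain ⟨p, rfl⟩ := hright.surjective x
      rw [← h.contact_eq Leg hLeg, h2]
  · rintro ⟨h1, h2⟩
    constructor
    · intro Z' p
      obtain ⟨W', h'⟩ := exists_legendreRelated_right Leg hLeg Z'
      rw [h.extDeriv_eq Leg hLeg h', h1]
    · intro p
      rw [h.contact_eq Leg hLeg, h2]

/-- The Reeb section is transported together with the test sections, and `R(f ∘ Leg_L) = S(f) ∘
Leg_L` for related `R` and `S`. -/
theorem isContactSection_iff (h : LegendreRelated L Z W) {f : HamSpace F E → ℝ}
    (hf : ContMDiff (hamModel n F) 𝓘(ℝ, ℝ) ∞ f) :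
    IsContactSection (lagContact L) (f ∘ legendre L) Z ↔ IsContactSection (hamContact n F E) f W := by
  have hright : Function.LeftInverse (legendre L) Leg.symm := fun x => by rw [← hLeg]; simp
  constructor
  · rintro ⟨h1, R, hR, h2⟩
    obtain ⟨S, hRS⟩ := exists_legendreRelated_right Leg hLeg R
    refine ⟨fun x => ?_, S, (hRS.isReeb_iff Leg hLeg).1 hR, fun W' x => ?_⟩
    · obtain ⟨p, rfl⟩ := hright.surjective x
      rw [← h.contact_eq Leg hLeg, h1, Function.comp_apply]
    · obtain ⟨p, rfl⟩ := hright.surjective x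
      obtain ⟨Z', h'⟩ := exists_legendreRelated_left Leg hLeg W'
      rw [← h.extDeriv_eq Leg hLeg h', h2, h'.deriv_eq Leg hLeg hf, hRS.deriv_eq Leg hLeg hf,
        h'.contact_eq Leg hLeg]
  · rintro ⟨h1, S, hS, h2⟩
    obtain ⟨R, hRS⟩ := exists_legendreRelated_left Leg hLeg S
    refine ⟨fun p => ?_, R, (hRS.isReeb_iff Leg hLeg).2 hS, fun Z' p => ?_⟩
    · rw [h.contact_eq Leg hLeg, h1, Function.comp_apply]
    · obtain ⟨W', h'⟩ := exists_legendreRelated_right Leg hLeg Z'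
      rw [h.extDeriv_eq Leg hLeg h', h2, h'.deriv_eq Leg hLeg hf, hRS.deriv_eq Leg hLeg hf,
        h'.contact_eq Leg hLeg]

theorem isLagrangianSection_iff (h : LegendreRelated L Z W) :
    IsLagrangianSection A L Z ↔ IsHamiltonianSection A (energy L ∘ Leg.symm) W := by
  have hE : energy L = (energy L ∘ Leg.symm) ∘ legendre L := by
    funext p
    simp [← hLeg]
  rw [IsHamiltonianSection, ← h.isContactSection_iff Leg hLeg (contMDiff_hamiltonian L Leg hLeg),
    ← hE]
  rfl

end LegendreRelated

end Transport

end ContactAlgebroid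

end

/-! ### The theorem -/

theorem mainTheorem4 {n : ℕ} {Q : Type*} [TopologicalSpace Q] [T2Space Q]
    [SecondCountableTopology Q] [ChartedSpace (EuclideanSpace ℝ (Fin n)) Q] [IsManifold (𝓡 n) ∞ Q]
    {F : Type*} [NormedAddCommGroup F] [NormedSpace ℝ F] [FiniteDimensional ℝ F]
    {E : Q → Type*} [∀ q, AddCommGroup (E q)] [∀ q, Module ℝ (E q)]
    [∀ q, TopologicalSpace (E q)] [TopologicalSpace (TotalSpace F E)]
    [FiberBundle F E] [VectorBundle ℝ F E] [ContMDiffVectorBundle ∞ F E (𝓡 n)]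
    (A : ContactAlgebroid.LieAlgebroid n F E)
    (L : ContactAlgebroid.Lagrangian n F E)
    (Leg : Diffeomorph (ContactAlgebroid.lagModel n F) (ContactAlgebroid.hamModel n F)
      (ContactAlgebroid.LagSpace F E) (ContactAlgebroid.HamSpace F E) ∞)
    (hLeg : ∀ p, Leg p = ContactAlgebroid.legendre L p)
    (H : ContactAlgebroid.HamSpace F E → ℝ)
    (hH : H = ContactAlgebroid.energy L ∘ Leg.symm) :
    (∃! Γ, ContactAlgebroid.IsLagrangianSection A L Γ) ∧
    (∃! ξ, ContactAlgebroid.IsHamiltonianSection A H ξ) ∧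
    (∀ Γ ξ, ContactAlgebroid.IsLagrangianSection A L Γ →
      ContactAlgebroid.IsHamiltonianSection A H ξ →
      ∀ p, ξ (ContactAlgebroid.legendre L p) = ContactAlgebroid.prolLegendre L p (Γ p)) ∧
    ∀ I : Set ℝ, I.OrdConnected → I.Nontrivial →
      (∀ c, ContactAlgebroid.IsHerglotzSolution A L I c →
        ContactAlgebroid.IsHamiltonSolution A H I (ContactAlgebroid.legendre L ∘ c)) ∧
      (∀ σ, ContactAlgebroid.IsHamiltonSolution A H I σ →
        ContactAlgebroid.IsHerglotzSolution A L I (Leg.symm ∘ σ)) ∧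
      Set.BijOn (fun c => ContactAlgebroid.legendre L ∘ c)
        {c | ContactAlgebroid.IsHerglotzSolution A L I c}
        {σ | ContactAlgebroid.IsHamiltonSolution A H I σ} := by
  subst hH
  have hright : Function.LeftInverse (ContactAlgebroid.legendre L) Leg.symm :=
    fun x => by rw [← hLeg]; simp
  have hleft : Function.LeftInverse Leg.symm (ContactAlgebroid.legendre L) :=
    fun x => by rw [← hLeg]; simp
  have hξ := ContactAlgebroid.existsUnique_isHamiltonianSection (A := A)
    (ContactAlgebroid.contMDiff_hamiltonian L Leg hLeg)
  refine ⟨?_, hξ, fun Γ ξ hΓ hξ' => ?_, fun I _ _ => ?_⟩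
  · obtain ⟨ξ, h1, h2⟩ := hξ
    obtain ⟨Γ, hΓ⟩ := ContactAlgebroid.exists_legendreRelated_left Leg hLeg ξ
    refine ⟨Γ, (hΓ.isLagrangianSection_iff Leg hLeg).2 h1, fun Γ' hΓ' => ?_⟩
    -- A second Lagrangian section pushes forward to a Hamiltonian section, which must be `ξ`;
    -- sections related to the same `ξ` coincide.
    obtain ⟨ξ', h'⟩ := ContactAlgebroid.exists_legendreRelated_right Leg hLeg Γ'
    obtain rfl := h2 ξ' ((h'.isLagrangianSection_iff Leg hLeg).1 hΓ')
    exact h'.left_unique Leg hLeg hΓ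
  · obtain ⟨ξ', h'⟩ := ContactAlgebroid.exists_legendreRelated_right Leg hLeg Γ
    obtain rfl := hξ.unique hξ' ((h'.isLagrangianSection_iff Leg hLeg).1 hΓ)
    exact h'
  · have hiff := ContactAlgebroid.isHerglotzSolution_iff A L Leg hLeg I
    have hcomp : ∀ σ : ℝ → ContactAlgebroid.HamSpace F E,
        ContactAlgebroid.legendre L ∘ (Leg.symm ∘ σ) = σ := fun σ => by
      rw [← Function.comp_assoc, hright.comp_eq_id, Function.id_comp]
    have hinv : ∀ σ, ContactAlgebroid.IsHamiltonSolution A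
        (ContactAlgebroid.energy L ∘ Leg.symm) I σ →
        ContactAlgebroid.IsHerglotzSolution A L I (Leg.symm ∘ σ) := by
      intro σ hσ
      rw [hiff, hcomp]
      exact hσ
    -- Curves are functions on all of `ℝ`, compared everywhere; injectivity of composition therefore
    -- follows from the left inverse `Leg.symm` alone.
    exact ⟨fun c hc => (hiff c).1 hc, hinv, fun c hc => (hiff c).1 hc,
      fun c _ c' _ h => hleft.injective.comp_left h, fun σ hσ => ⟨_, hinv σ hσ, hcomp σ⟩⟩
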